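/- Notation. For $z=(x,\omega)\in\mathbb R^2$ and $\phi\in L^2(\mathbb R)$ let $\pi(z)\phi(t)=e^{2\pi i\omega t}\phi(t-x)$, $\mathcal V_\phi f(z)=\langle f,\pi(z)\phi\rangle$, and, for an integrable bounded symbol $m:\mathbb R^2\to\mathbb R$, let $H_{m,\phi}f=\int_{\mathbb R^2}\mathcal V_\phi f(z)\,m(z)\,\pi(z)\phi\,dz$ on $L^2(\mathbb R)$. Let $\varphi_0(t)=2^{1/4}e^{-\pi t^2}$. Let $\Gamma$ be a family of points of $\mathbb R^2$ that is relatively separated (the number of members of $\Gamma$ in a unit square is bounded uniformly over all squares), and let $\eta_\gamma:\mathbb R^2\to[0,\infty)$, $\gamma\in\Gamma$, be a well-spread family of integrable symbols: there is a continuous $g\in L^2(\mathbb R^2)$ with $g(z)\le C(1+|z|^2)^{-s}$ for some $C$ and some $s>1$ such that $\eta_\gamma(\xi)\le g(\xi-\gamma)$ for all $\gamma\in\Gamma$ and almost all $\xi$. Assume that $a\le\sum_{\gamma\in\Gamma}\eta_\gamma\le b$ almost everywhere for some constants $0<a\le b<\infty$. Let $\Phi=\{\phi_i\}_{i\in\mathcal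 I}\subset L^2(\mathbb R)$ be a collection of windows, choose an index $i(\gamma)\in\mathcal I$ for every $\gamma\in\Gamma$, and put $H_\gamma=H_{\eta_\gamma,\phi_{i(\gamma)}}$. Assume that one of the following two conditions holds. (1) Every member of $\Phi$ is one of two windows $\phi_1,\phi_2$ with $\|\phi_1\|_2=\|\phi_2\|_2=1$ and $\|\phi_1-\phi_2\|_2<\frac12$. (2) There are constants $C$ and $s>1$ with $\big(|\mathcal V_{\varphi_0}\phi_i|*|\mathcal V_{\varphi_0}\phi_i|\big)(z)\le C(1+|z|^2)^{-s}$ for all $i\in\mathcal I$, $z\in\mathbb R^2$, and there is a constant $C_0$ with $2C_0<\|\mathcal V_{\varphi_0}\varphi_0\|_1$ and $|\mathcal V_{\varphi_0}\varphi_0(z)-\mathcal V_{\varphi_0}\phi_i(z)|<C_0|\mathcal V_{\varphi_0}\varphi_0(z)|$ for all $i\in\mathcal I$, $z\in\mathbb R^2$. Then the following hold. (a) There are constants $0<A\le B<\infty$ such that, for all $f\in L^2(\mathbb R)$, $$A\|f\|_2^2\le\sum_{\gamma}\|H_\gamma^2f\|_2^2\le B\|f\|_2^2,\qquad A\|f\|_2^2\le\sum_{\gamma}\|H_\gamma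 f\|_2^2\le B\|f\|_2^2 .$$ If moreover $\|H_\gamma\|\le1$ for all $\gamma$, then $\sum_\gamma\|H_\gamma^2f\|_2^2\le\sum_\gamma\|H_\gamma f\|_2^2$ for all $f\in L^2(\mathbb R)$. (b) Every $H_\gamma$ has a diagonalization $H_\gamma f=\sum_{k\ge1}\lambda_k^\gamma\langle f,\phi_k^\gamma\rangle\phi_k^\gamma$, $f\in L^2(\mathbb R)$, with $(\phi_k^\gamma)_k$ orthonormal and $(\lambda_k^\gamma)_k$ non-negative and non-increasing. (c) Let $0<A\le B$ be any constants such that $A\|f\|_2^2\le\sum_\gamma\|H_\gamma^2f\|_2^2$ and $\sum_\gamma\|H_\gamma f\|_2^2\le B\|f\|_2^2$ for all $f\in L^2(\mathbb R)$, and let $0<\varepsilon<A/B$. Then, for every choice of diagonalizations as in (b), the family of all $\phi_k^\gamma$ with $\gamma\in\Gamma$ and $\lambda_k^\gamma>\varepsilon$ is a frame for $L^2(\mathbb R)$: there are constants $0<A'\le B'<\infty$ with $$A'\|f\|_2^2\le\sum_{\gamma}\sum_{k:\,\lambda_k^\gamma>\varepsilon}|\langle f,\phi_k^\gamma\rangle|^2\le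 B'\|f\|_2^2\qquad\text{for all }f\in L^2(\mathbb R).$$ Likewise, with $H_\gamma^\varepsilon f=\sum_{k:\,\lambda_k^\gamma>\varepsilon}\lambda_k^\gamma\langle f,\phi_k^\gamma\rangle\phi_k^\gamma$, there are constants $0<A''\le B''<\infty$ such that $A''\|f\|_2^2\le\sum_{\gamma}\|H_\gamma^\varepsilon f\|_2^2\le B''\|f\|_2^2$ for all $f\in L^2(\mathbb R)$; so both sums are equivalent to each other as well. -/

import Mathlib

open MeasureTheory
open scoped ComplexConjugate

noncomputable section

namespace TimeFrequency

/-- The Hilbert space `L²(ℝ)` of complex-valued functions. -/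
abbrev L2R : Type := Lp ℂ 2 (volume : Measure ℝ)

/-- Time-frequency shift of a function: `(π(x, ω) φ)(t) = exp(2 π i ω t) φ(t - x)`. -/
def shiftFun (z : ℝ × ℝ) (φ : ℝ → ℂ) (t : ℝ) : ℂ :=
  Complex.exp (((2 * Real.pi * z.2 * t : ℝ) : ℂ) * Complex.I) * φ (t - z.1)

theorem memLp_shiftFun (z : ℝ × ℝ) (φ : L2R) :
    MemLp (shiftFun z φ) 2 (volume : Measure ℝ) := by
  have hφ : MemLp (fun t : ℝ => φ (t - z.1)) 2 (volume : Measure ℝ) :=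
    (Lp.memLp φ).comp_measurePreserving (measurePreserving_sub_right volume z.1)
  have hc : Continuous (fun t : ℝ =>
      Complex.exp (((2 * Real.pi * z.2 * t : ℝ) : ℂ) * Complex.I)) := by
    fun_prop
  refine MemLp.of_le hφ (hc.aestronglyMeasurable.mul hφ.1) (Filter.Eventually.of_forall ?_)
  intro t
  simp only [shiftFun, norm_mul, Complex.norm_exp_ofReal_mul_I, one_mul, le_refl]

/-- Time-frequency shift `π(z) φ` as an element of `L²(ℝ)`. -/
def tfShift (z : ℝ × ℝ) (φ : L2R) : L2R := (memLp_shiftFun z φ).toLp (shiftFun z φ)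

/-- Short-time Fourier transform
`V_φ f (z) = ⟨f, π(z) φ⟩ = ∫ f(t) conj((π(z) φ)(t)) dt`. -/
def stft (φ f : ℝ → ℂ) (z : ℝ × ℝ) : ℂ := ∫ t, f t * conj (shiftFun z φ t)

/-- Time-frequency localization operator
`H_{m,φ} f = ∫ V_φ f(z) m(z) π(z) φ dz`, an `L²(ℝ)`-valued Bochner integral
(absolutely convergent for every integrable symbol `m`, since `V_φ f` is bounded). -/
def locOp (m : ℝ × ℝ → ℝ) (φ f : L2R) : L2R :=
  ∫ z, (stft φ f z * (m z : ℂ)) • tfShift z φ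

/-- The standard Gaussian `2^{1/4} exp(-π t²)`. -/
def gaussianWindow (t : ℝ) : ℂ := (((2 : ℝ) ^ (1 / 4 : ℝ) * Real.exp (-Real.pi * t ^ 2) : ℝ) : ℂ)

/-- The number of points of the family in a square of side length `2` is bounded uniformly. -/
def RelativelySeparated {ι : Type*} (p : ι → ℝ × ℝ) : Prop :=
  ∃ N : ℕ, ∀ z : ℝ × ℝ, {j | ‖p j - z‖ ≤ 1}.encard ≤ (N : ℕ∞)

/-- Polynomial decay `O((1 + |z|²)^{-s})` of some order `s > 1` on the plane. -/
def PolynomialDecay (g : ℝ × ℝ → ℝ) : Prop :=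
  ∃ C s : ℝ, 1 < s ∧ ∀ z : ℝ × ℝ, |g z| ≤ C * (1 + (z.1 ^ 2 + z.2 ^ 2)) ^ (-s)

/-- A well-spread family of symbols `η j`, the `j`-th one being attached to the point `p j`
of phase space. For a set `Γ` of points, take `ι = Γ` and `p` the inclusion; for two sets
`Γ₁`, `Γ₂`, take `ι = Γ₁ ⊕ Γ₂`. -/
structure WellSpread {ι : Type*} (p : ι → ℝ × ℝ) (η : ι → ℝ × ℝ → ℝ) : Prop where
  separated : RelativelySeparated p
  integrable : ∀ j, Integrable (η j)
  envelope : ∃ g : ℝ × ℝ → ℝ, Continuous g ∧ MemLp g 2 ∧ PolynomialDecay g ∧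
    ∀ j, ∀ᵐ ξ, |η j ξ| ≤ g (ξ - p j)

/-- `∑ η_j ≈ 1`. -/
def SumEquivOne {ι : Type*} (η : ι → ℝ × ℝ → ℝ) : Prop :=
  ∃ a b : ℝ, 0 < a ∧ a ≤ b ∧
    ∀ᵐ z : ℝ × ℝ, Summable (fun j => η j z) ∧ a ≤ ∑' j, η j z ∧ ∑' j, η j z ≤ b

/-- Norm condition on the windows: there are only two windows, they are normalized, and they
are at distance less than `1/2`. -/
def NormCondition {I : Type*} (Φ : I → L2R) : Prop :=
  ∃ φ₁ φ₂ : L2R, ‖φ₁‖ = 1 ∧ ‖φ₂‖ = 1 ∧ ‖φ₁ - φ₂‖ < 1 / 2 ∧ ∀ i, Φ i = φ₁ ∨ Φ i = φ₂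

/-- Phase-space condition on the windows, in terms of the STFT with Gaussian window. -/
def PhaseSpaceCondition {I : Type*} (Φ : I → L2R) : Prop :=
  (∃ C s : ℝ, 1 < s ∧ ∀ (i : I) (z : ℝ × ℝ),
    ∫ w, ‖stft gaussianWindow (Φ i) w‖ * ‖stft gaussianWindow (Φ i) (z - w)‖
      ≤ C * (1 + (z.1 ^ 2 + z.2 ^ 2)) ^ (-s)) ∧
  (∃ C₀ : ℝ,
    (∀ (i : I) (z : ℝ × ℝ),
      ‖stft gaussianWindow gaussianWindow z - stft gaussianWindow (Φ i) z‖
        < C₀ * ‖stft gaussianWindow gaussianWindow z‖) ∧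
    2 * C₀ < ∫ z, ‖stft gaussianWindow gaussianWindow z‖)

/-- `A ‖f‖² ≤ ∑_j ‖T_j f‖² ≤ B ‖f‖²` for all `f`, the sum being convergent. -/
def SqSumBounds {ι : Type*} (T : ι → L2R → L2R) (A B : ℝ) : Prop :=
  ∀ f : L2R, Summable (fun j => ‖T j f‖ ^ 2) ∧
    A * ‖f‖ ^ 2 ≤ ∑' j, ‖T j f‖ ^ 2 ∧ ∑' j, ‖T j f‖ ^ 2 ≤ B * ‖f‖ ^ 2

/-- A family of vectors is a frame for `L²(ℝ)`. -/
def IsFrame {κ : Type*} (v : κ → L2R) : Prop :=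
  ∃ A B : ℝ, 0 < A ∧ A ≤ B ∧ ∀ f : L2R, Summable (fun k => ‖inner ℂ (v k) f‖ ^ 2) ∧
    A * ‖f‖ ^ 2 ≤ ∑' k, ‖inner ℂ (v k) f‖ ^ 2 ∧ ∑' k, ‖inner ℂ (v k) f‖ ^ 2 ≤ B * ‖f‖ ^ 2

/-- A diagonalization `H f = ∑_k λ_k ⟨f, e_k⟩ e_k` with `(e_k)` orthonormal and `(λ_k)`
non-negative and non-increasing. (`inner ℂ` is linear in its second argument.) -/
structure IsEigenSystem (H : L2R → L2R) (lam : ℕ → ℝ) (e : ℕ → L2R) : Prop where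
  orthonormal : Orthonormal ℂ e
  nonneg : ∀ k, 0 ≤ lam k
  antitone : Antitone lam
  hasSum : ∀ f, HasSum (fun k => ((lam k : ℂ) * inner ℂ (e k) f) • e k) (H f)

/-- The truncated operator `H^ε f = ∑_{k : λ_k > ε} λ_k ⟨f, e_k⟩ e_k`. -/
def truncOp (lam : ℕ → ℝ) (e : ℕ → L2R) (ε : ℝ) (f : L2R) : L2R :=
  ∑' k : {k : ℕ // ε < lam k}, ((lam k : ℂ) * inner ℂ (e k) f) • e k

end TimeFrequency

end

open TimeFrequency

/-! The heart of the matter is the lower bound A‖f‖² ≤ Σ‖H_γ f‖²; the rest follows from positivity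
and compactness. The symbols being non-negative, ⟨H_γ f, f⟩ = ∫ η_γ |V f|². For finitely many unit
windows, Moyal's formula and Σ η_γ ≤ b bound Σ⟨H_γ f, f⟩ by a multiple of ‖f‖²; if the windows are
close to each other, this sum is also at least κ‖f‖² with κ > 0 (`exists_form_lower_bound`).

To pass from forms to norms, the second f in ⟨H_γ f, f⟩ is replaced by A_γ f, where A_γ is the
localization operator with a wide Gaussian symbol of scale 1/r centred at γ. It is a Gaussian
average, over ζ = r u, of shifts π(ζ) with a phase correction depending on γ
(`inner_locOp_gaussianSymbol`). By covariance, such a corrected shift multiplies V f(z) by the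
symplectic character of ζ at z - γ, up to an error from moving the window. Decay of η_γ away from γ
makes this character close to 1 in the mean, uniformly after summation over γ
(`exists_sum_mul_phase_le`, `sum_norm_inner_sub_twisted_le`). Hence Σ|⟨H_γ f, f - A_γ f⟩| ≤
(κ/2)‖f‖² for small r, and Cauchy–Schwarz gives (κ/2)‖f‖² ≤ (Σ‖H_γ f‖²)^{1/2} (Σ‖A_γ f‖²)^{1/2}. The
last factor is O(‖f‖) because the points are relatively separated (`exists_norm_sq_lower_bound`).

Squares of the operators are reached through ‖Tf‖² ≤ δ⟨Tf, f⟩ + δ⁻²‖T²f‖² for positive T.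
Eigenfunctions are reached through λ⁴ ≤ b⁴ 1_{λ>ε} + ε²λ², summed against |⟨f, e⟩|²; here ε²B < A.

Norm condition: there are two unit windows, so the finite-window argument applies directly.
Phase-space condition: dividing Bargmann transforms gives a bounded entire function, so by Liouville
every window is a multiple cφ₀ of the Gaussian with |c - 1| ≤ C₀ < 1; the factor |c|² is moved into
the symbol, which leaves a single window. -/

noncomputable section

namespace TimeFrequency

/-! ### Positive operators: form inequalities and the compact spectral theorem. -/

section Abstract

open ContinuousLinearMap Filter Topology
open scoped ComplexOrder

variable {E : Type*} [NormedAddCommGroup E] [InnerProductSpace ℂ E]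

/-- Cauchy–Schwarz inequality for the form `⟨T x, y⟩` of a positive operator. -/
theorem re_inner_sq_le {T : E →L[ℂ] E} (hT : T.IsPositive) (x y : E) :
    (RCLike.re (inner ℂ (T x) y)) ^ 2
      ≤ RCLike.re (inner ℂ (T x) x) * RCLike.re (inner ℂ (T y) y) := by
  have key : ∀ t : ℝ, 0 ≤ RCLike.re (inner ℂ (T y) y) * (t * t)
      + (2 * RCLike.re (inner ℂ (T x) y)) * t + RCLike.re (inner ℂ (T x) x) := by
    intro t
    have h := hT.re_inner_nonneg_left (x + (t : ℂ) • y)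
    have hs : inner ℂ (T y) x = conj (inner ℂ (T x) y) := by
      rw [inner_conj_symm]; exact hT.inner_left_eq_inner_right y x
    have hre : RCLike.re (inner ℂ (T y) x) = RCLike.re (inner ℂ (T x) y) := by
      rw [hs]; exact RCLike.conj_re _
    simp only [map_add, map_smul, inner_add_left, inner_add_right, inner_smul_left,
      inner_smul_right, Complex.conj_ofReal, RCLike.re_to_complex, Complex.re_ofReal_mul,
      Complex.add_re] at h hre ⊢
    rw [hre] at h
    linarith
  have := discrim_le_zero key
  unfold discrim at this
  linarith

/-- Cauchy–Schwarz with y = T f gives ‖Tf‖⁴ ≤ ⟨Tf, f⟩⟨T(Tf), Tf⟩, whose last factor is at most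
b‖Tf‖². -/
theorem norm_sq_apply_le {T : E →L[ℂ] E} (hT : T.IsPositive) {b : ℝ}
    (hb : ∀ f, RCLike.re (inner ℂ (T f) f) ≤ b * ‖f‖ ^ 2) (f : E) :
    ‖T f‖ ^ 2 ≤ b * RCLike.re (inner ℂ (T f) f) := by
  have h := re_inner_sq_le hT f (T f)
  rw [inner_self_eq_norm_sq] at h
  have h0 := hT.re_inner_nonneg_left f
  have h1 := mul_le_mul_of_nonneg_left (hb (T f)) h0
  rcases eq_or_lt_of_le (sq_nonneg ‖T f‖) with h2 | h2
  · rw [← h2] at h1 h ⊢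
    by_cases hf : f = 0
    · simp [hf]
    have : 0 < ‖f‖ ^ 2 := by positivity
    have hb0 : 0 ≤ b := by
      by_contra hneg
      have := hb f
      nlinarith
    positivity
  · nlinarith

theorem norm_apply_le_of_form_le {T : E →L[ℂ] E} (hT : T.IsPositive) {b : ℝ} (hb0 : 0 ≤ b)
    (hb : ∀ f, RCLike.re (inner ℂ (T f) f) ≤ b * ‖f‖ ^ 2) (f : E) : ‖T f‖ ≤ b * ‖f‖ := by
  have h1 := norm_sq_apply_le hT hb f
  have h2 := mul_le_mul_of_nonneg_left (hb f) hb0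
  refine le_of_sq_le_sq ?_ (by positivity)
  nlinarith

/-- The same instance of Cauchy–Schwarz, with ⟨T(Tf), Tf⟩ ≤ ‖T(Tf)‖‖Tf‖. -/
theorem norm_apply_cube_le {T : E →L[ℂ] E} (hT : T.IsPositive) (f : E) :
    ‖T f‖ ^ 3 ≤ RCLike.re (inner ℂ (T f) f) * ‖T (T f)‖ := by
  have h := re_inner_sq_le hT f (T f)
  rw [inner_self_eq_norm_sq] at h
  have h0 := hT.re_inner_nonneg_left f
  have h1 : RCLike.re (inner ℂ (T (T f)) (T f)) ≤ ‖T (T f)‖ * ‖T f‖ := re_inner_le_norm _ _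
  have h2 := mul_le_mul_of_nonneg_left h1 h0
  rcases eq_or_lt_of_le (norm_nonneg (T f)) with h3 | h3
  · rw [← h3]; simp only [ne_eq, OfNat.ofNat_ne_zero, not_false_eq_true, zero_pow]; positivity
  · refine le_of_mul_le_mul_right ?_ h3
    nlinarith

/-- Either ‖Tf‖² ≤ δ⟨Tf, f⟩ already, or the cubic inequality forces δ‖Tf‖ ≤ ‖T(Tf)‖. This is what
transfers lower bounds from Σ‖T_j f‖² to Σ‖T_j² f‖². -/
theorem norm_sq_apply_le_interpolation {T : E →L[ℂ] E} (hT : T.IsPositive) {δ : ℝ} (hδ : 0 < δ)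
    (f : E) : ‖T f‖ ^ 2 ≤ δ * RCLike.re (inner ℂ (T f) f) + ‖T (T f)‖ ^ 2 / δ ^ 2 := by
  have h := norm_apply_cube_le hT f
  have h0 := hT.re_inner_nonneg_left f
  set q := RCLike.re (inner ℂ (T f) f)
  set n := ‖T f‖
  set p := ‖T (T f)‖
  have hn : 0 ≤ n := norm_nonneg _
  have hp : 0 ≤ p := norm_nonneg _
  have hp2 : 0 ≤ p ^ 2 / δ ^ 2 := by positivity
  by_cases hc : n ^ 2 ≤ δ * q
  · linarith
  · push Not at hc
    have hnpos : 0 < n ^ 2 := lt_of_le_of_lt (by positivity) hc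
    have h1 : n * δ ≤ p := by
      refine le_of_mul_le_mul_left ?_ hnpos
      nlinarith
    have h2 : n ^ 2 ≤ p ^ 2 / δ ^ 2 := by
      rw [le_div_iff₀ (by positivity), ← mul_pow]
      exact pow_le_pow_left₀ (by positivity) h1 2
    have : 0 ≤ δ * q := by positivity
    linarith

variable [CompleteSpace E]

/-- For self-adjoint T the spectral radius is ‖T‖, so some spectral value has this modulus;
compactness makes it an eigenvalue when it is nonzero, and positivity makes it equal to ‖T‖. -/
theorem exists_norm_eigenvector [Nontrivial E] {T : E →L[ℂ] E} (hT : T.IsPositive)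
    (hc : IsCompactOperator T) : ∃ v : E, ‖v‖ = 1 ∧ T v = (‖T‖ : ℂ) • v := by
  by_cases h0 : ‖T‖ = 0
  · obtain ⟨v, hv⟩ := exists_norm_eq E zero_le_one
    refine ⟨v, hv, ?_⟩
    rw [norm_eq_zero.mp h0]; simp
  obtain ⟨μ, hμ, hμn⟩ := spectrum.exists_nnnorm_eq_spectralRadius T
  rw [T.spectralRadius_eq_nnnorm hT.isSelfAdjoint] at hμn
  have hμT : ‖μ‖ = ‖T‖ := congrArg NNReal.toReal (ENNReal.coe_injective hμn)
  have hμ0 : μ ≠ 0 := by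
    rintro rfl
    exact h0 (by rw [← hμT, norm_zero])
  have hev := (hc.hasEigenvalue_iff_mem_spectrum hμ0).mpr hμ
  obtain ⟨w, hw⟩ := hev.exists_hasEigenvector
  have hw0 : w ≠ 0 := hw.2
  have hTw : T w = μ • w := hw.apply_eq_smul
  have hμre : μ = (‖T‖ : ℂ) := by
    have hin := hT.inner_nonneg_right w
    rw [hTw, inner_smul_right, inner_self_eq_norm_sq_to_K] at hin
    have hwn : 0 < ‖w‖ ^ 2 := by positivity
    have h2 : 0 ≤ μ := by
      rw [Complex.le_def] at hin ⊢
      obtain ⟨ha, hb⟩ := hin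
      have e : ((‖w‖ : ℂ)) ^ 2 = ((‖w‖ ^ 2 : ℝ) : ℂ) := by push_cast; rfl
      simp only [Complex.coe_algebraMap] at ha hb
      rw [e] at ha hb
      simp only [Complex.zero_re, Complex.zero_im, Complex.re_mul_ofReal,
        Complex.im_mul_ofReal] at ha hb ⊢
      refine ⟨nonneg_of_mul_nonneg_left ha hwn, ?_⟩
      rcases mul_eq_zero.mp hb.symm with h | h
      · exact h.symm
      · exact absurd h hwn.ne'
    rw [← hμT]
    exact (Complex.norm_of_nonneg' h2).symm
  refine ⟨((‖w‖⁻¹ : ℝ) : ℂ) • w, ?_, ?_⟩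
  · rw [norm_smul]
    simp [hw0]
  · rw [map_smul, hTw, hμre, smul_comm]

/-- By self-adjointness Vᗮ is invariant, and it is nonzero in infinite dimension; the restriction of
T to it has an eigenvector for its norm. -/
theorem exists_maximal_eigenvector (hE : ¬ FiniteDimensional ℂ E) {T : E →L[ℂ] E}
    (hT : T.IsPositive) (hc : IsCompactOperator T) (V : Submodule ℂ E) [FiniteDimensional ℂ V]
    (hV : ∀ v ∈ V, T v ∈ V) :
    ∃ v ∈ Vᗮ, ‖v‖ = 1 ∧ ∃ μ : ℝ, 0 ≤ μ ∧ T v = (μ : ℂ) • v ∧ ∀ w ∈ Vᗮ, ‖T w‖ ≤ μ * ‖w‖ := by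
  have hW : ∀ w ∈ Vᗮ, T w ∈ Vᗮ := by
    intro w hw
    rw [Submodule.mem_orthogonal] at hw ⊢
    intro u hu
    rw [← hT.inner_left_eq_inner_right]
    exact hw _ (hV u hu)
  have hnt : Nontrivial Vᗮ := by
    rw [Submodule.nontrivial_iff_ne_bot]
    intro hbot
    have : V = ⊤ := (Submodule.orthogonal_eq_bot_iff).mp hbot
    apply hE
    have h2 : FiniteDimensional ℂ (⊤ : Submodule ℂ E) := this ▸ ‹FiniteDimensional ℂ V›
    exact Module.Finite.equiv (Submodule.topEquiv (R := ℂ) (M := E))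
  let S : Vᗮ →L[ℂ] Vᗮ := T.restrict hW
  have hSpos : S.IsPositive := by
    rw [isPositive_iff_complex]
    intro x
    exact (isPositive_iff_complex T).mp hT x
  have hSc : IsCompactOperator S := IsCompactOperator.restrict' (f := (T : E →ₗ[ℂ] E)) hc hW
  obtain ⟨v, hv1, hv2⟩ := exists_norm_eigenvector hSpos hSc
  refine ⟨v, v.2, hv1, ‖S‖, S.opNorm_nonneg, congrArg Subtype.val hv2, ?_⟩
  intro w hw
  exact S.le_opNorm ⟨w, hw⟩

/-- Greedy choice in the complement of the previous eigenvectors. Infinite dimension keeps it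
running, so the index set is all of ℕ even when T has finite rank; zero eigenvalues then appear. -/
theorem exists_eigenSequence (hE : ¬ FiniteDimensional ℂ E) {T : E →L[ℂ] E}
    (hT : T.IsPositive) (hc : IsCompactOperator T) :
    ∃ (lam : ℕ → ℝ) (e : ℕ → E), Orthonormal ℂ e ∧ (∀ k, 0 ≤ lam k) ∧
      (∀ k, T (e k) = (lam k : ℂ) • e k) ∧
      ∀ n w, (∀ k < n, inner ℂ (e k) w = 0) → ‖T w‖ ≤ lam n * ‖w‖ := by
  classical
  let good : Submodule ℂ E → Prop := fun V => FiniteDimensional ℂ V ∧ ∀ v ∈ V, T v ∈ V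
  -- The choice is made for every subspace, with junk value 0 on bad ones, so that the recursion
  -- runs on bare subspaces and `good` is proved afterwards.
  have hpick : ∀ V : Submodule ℂ E, ∃ v : E, ∃ μ : ℝ, good V → (v ∈ Vᗮ ∧ ‖v‖ = 1 ∧ 0 ≤ μ ∧
      T v = (μ : ℂ) • v ∧ ∀ w ∈ Vᗮ, ‖T w‖ ≤ μ * ‖w‖) := by
    intro V
    by_cases hV : good V
    · have := hV.1
      obtain ⟨v, h1, h2, μ, h3, h4, h5⟩ := exists_maximal_eigenvector hE hT hc V hV.2
      exact ⟨v, μ, fun _ => ⟨h1, h2, h3, h4, h5⟩⟩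
    · exact ⟨0, 0, fun h => absurd h hV⟩
  choose pick mu hspec using hpick
  let Vs : ℕ → Submodule ℂ E := fun n =>
    Nat.rec ⊥ (fun _ V => V ⊔ Submodule.span ℂ {pick V}) n
  have hVs : ∀ n, Vs (n + 1) = Vs n ⊔ Submodule.span ℂ {pick (Vs n)} := fun n => rfl
  have hgood : ∀ n, good (Vs n) := by
    intro n
    induction n with
    | zero =>
      refine ⟨inferInstanceAs (FiniteDimensional ℂ (⊥ : Submodule ℂ E)), ?_⟩
      intro v hv
      have hv0 : v = 0 := (Submodule.mem_bot ℂ).mp hv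
      rw [hv0, map_zero]
      exact Submodule.zero_mem _
    | succ n ih =>
      refine ⟨?_, ?_⟩
      · exact @Submodule.finiteDimensional_sup ℂ E _ _ _ _ _ ih.1 inferInstance
      · intro v hv
        rw [hVs] at hv ⊢
        obtain ⟨y, hy, z, hz, rfl⟩ := Submodule.mem_sup.mp hv
        obtain ⟨c, rfl⟩ := Submodule.mem_span_singleton.mp hz
        rw [map_add, map_smul, (hspec _ ih).2.2.2.1]
        refine Submodule.add_mem_sup (ih.2 y hy) ?_
        exact Submodule.smul_mem _ _ (Submodule.smul_mem _ _ (Submodule.mem_span_singleton_self _))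
  have hmono : Monotone Vs := monotone_nat_of_le_succ fun n => by rw [hVs]; exact le_sup_left
  have hmem : ∀ n, pick (Vs n) ∈ Vs (n + 1) := fun n => by
    rw [hVs]; exact Submodule.mem_sup_right (Submodule.mem_span_singleton_self _)
  have horth : ∀ m n, m < n → inner ℂ (pick (Vs m)) (pick (Vs n)) = 0 := by
    intro m n hmn
    exact (Submodule.mem_orthogonal _ _).mp (hspec _ (hgood n)).1 _ (hmono hmn (hmem m))
  refine ⟨fun n => mu (Vs n), fun n => pick (Vs n), ⟨fun n => (hspec _ (hgood n)).2.1, ?_⟩,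
    fun n => (hspec _ (hgood n)).2.2.1, fun n => (hspec _ (hgood n)).2.2.2.1, ?_⟩
  · intro m n hmn
    rcases lt_or_gt_of_ne hmn with h | h
    · exact horth m n h
    · exact inner_eq_zero_symm.mp (horth n m h)
  · intro n w hw
    refine (hspec _ (hgood n)).2.2.2.2 w ?_
    clear hmem horth hmono
    induction n with
    | zero =>
      rw [Submodule.mem_orthogonal]
      intro u hu
      rw [(Submodule.mem_bot ℂ).mp hu, inner_zero_left]
    | succ n ih =>
      have h1 := ih fun k hk => hw k (by omega)
      rw [hVs, ← Submodule.inf_orthogonal]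
      refine ⟨h1, ?_⟩
      rw [SetLike.mem_coe, Submodule.mem_orthogonal_singleton_iff_inner_right]
      exact hw n (by omega)

theorem exists_spectral_decomposition (hE : ¬ FiniteDimensional ℂ E) {T : E →L[ℂ] E}
    (hT : T.IsPositive) (hc : IsCompactOperator T) :
    ∃ (lam : ℕ → ℝ) (e : ℕ → E), Orthonormal ℂ e ∧ (∀ k, 0 ≤ lam k) ∧ Antitone lam ∧
      ∀ f, HasSum (fun k => ((lam k : ℂ) * inner ℂ (e k) f) • e k) (T f) := by
  obtain ⟨lam, e, horth, hnn, heig, hmax⟩ := exists_eigenSequence hE hT hc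
  have hnorm : ∀ k, ‖T (e k)‖ = lam k := fun k => by
    rw [heig, norm_smul, horth.1 k, mul_one, Complex.norm_of_nonneg (hnn k)]
  have hanti : Antitone lam := by
    intro m n hmn
    have := hmax m (e n) fun k hk => horth.2 (by omega)
    rwa [hnorm, horth.1, mul_one] at this
  have hlim : Tendsto lam atTop (𝓝 0) := by
    have hbdd : BddBelow (Set.range lam) := ⟨0, by rintro _ ⟨k, rfl⟩; exact hnn k⟩
    have ht := tendsto_atTop_ciInf hanti hbdd
    set c := ⨅ k, lam k
    have hcle : ∀ k, c ≤ lam k := fun k => ciInf_le hbdd k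
    have hc0 : 0 ≤ c := le_ciInf hnn
    rcases eq_or_lt_of_le hc0 with h | h
    · rwa [← h] at ht
    -- If the eigenvalues stayed above c > 0, the vectors T e_n would be orthogonal with norms at
    -- least c, hence at mutual distance at least √2 c, and no subsequence could converge.
    exfalso
    obtain ⟨K, hK, hsub⟩ := hc.image_closedBall_subset_compact (𝕜₁ := ℂ) (f := (T : E →ₗ[ℂ] E)) 1
    have hin : ∀ n, T (e n) ∈ K := fun n =>
      hsub ⟨e n, by simp [horth.1 n], rfl⟩
    obtain ⟨a, _, φ, hφ, hlimφ⟩ := hK.tendsto_subseq hin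
    have hcau := hlimφ.cauchySeq
    rw [Metric.cauchySeq_iff'] at hcau
    obtain ⟨N, hN⟩ := hcau c h
    have h1 := hN (N + 1) (by omega)
    have hne : φ (N + 1) ≠ φ N := (hφ (Nat.lt_succ_self N)).ne'
    simp only [Function.comp_apply, dist_eq_norm] at h1
    have h2 : ‖T (e (φ (N + 1))) - T (e (φ N))‖ ^ 2
        = lam (φ (N + 1)) ^ 2 + lam (φ N) ^ 2 := by
      have hz : inner ℂ (T (e (φ (N + 1)))) (T (e (φ N))) = 0 := by
        rw [heig, heig, inner_smul_left, inner_smul_right, horth.2 hne]; simp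
      rw [@norm_sub_sq ℂ, hz, hnorm, hnorm]; simp
    have h3 := hcle (φ (N + 1))
    have h4 := hcle (φ N)
    have h5 : ‖T (e (φ (N + 1))) - T (e (φ N))‖ ^ 2 < c ^ 2 :=
      pow_lt_pow_left₀ h1 (norm_nonneg _) two_ne_zero
    nlinarith
  refine ⟨lam, e, horth, hnn, hanti, fun f => ?_⟩
  have hsum : Summable (fun k => ((lam k : ℂ) * inner ℂ (e k) f) • e k) := by
    refine (horth.orthogonalFamily.summable_iff_norm_sq_summable
      (fun k => (lam k : ℂ) * inner ℂ (e k) f)).mpr ?_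
    refine Summable.of_nonneg_of_le (fun k => sq_nonneg _) (fun k => ?_)
      ((horth.inner_products_summable f).mul_left (lam 0 ^ 2))
    rw [norm_mul, mul_pow, Complex.norm_of_nonneg (hnn k)]
    have := hanti (Nat.zero_le k)
    gcongr
    exact hnn k
  have hpart : Tendsto (fun n => ∑ k ∈ Finset.range n, ((lam k : ℂ) * inner ℂ (e k) f) • e k)
      atTop (𝓝 (T f)) := by
    rw [tendsto_iff_norm_sub_tendsto_zero]
    have hz : Tendsto (fun n => lam n * ‖f‖) atTop (𝓝 0) := by
      simpa using hlim.mul_const ‖f‖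
    refine squeeze_zero (fun n => norm_nonneg _) (fun n => ?_) hz
    -- Since f - s is orthogonal to the first n eigenvectors, maximality bounds ‖T(f - s)‖ by lam n
    -- ‖f‖.
    set s := ∑ k ∈ Finset.range n, (inner ℂ (e k) f) • e k with hs
    have hTs : T s = ∑ k ∈ Finset.range n, ((lam k : ℂ) * inner ℂ (e k) f) • e k := by
      rw [hs, map_sum]
      refine Finset.sum_congr rfl fun k _ => ?_
      rw [map_smul, heig, smul_smul, mul_comm]
    have hin : ∀ k < n, inner ℂ (e k) (f - s) = 0 := by
      intro k hk
      rw [inner_sub_right, hs, horth.inner_right_sum _ (Finset.mem_range.mpr hk), sub_self]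
    have hle : ‖f - s‖ ≤ ‖f‖ := by
      have hfs : inner ℂ s (f - s) = 0 := by
        nth_rewrite 1 [hs]
        rw [sum_inner]
        refine Finset.sum_eq_zero fun k hk => ?_
        rw [inner_smul_left, hin k (Finset.mem_range.mp hk), mul_zero]
      have hp := norm_add_sq_eq_norm_sq_add_norm_sq_of_inner_eq_zero s (f - s) hfs
      rw [add_sub_cancel] at hp
      nlinarith [norm_nonneg f, norm_nonneg (f - s), mul_self_nonneg ‖s‖]
    rw [← hTs, ← norm_neg, neg_sub, ← map_sub]
    exact (hmax n (f - s) hin).trans (mul_le_mul_of_nonneg_left hle (hnn n))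
  have := hsum.hasSum.tendsto_sum_nat
  rw [← tendsto_nhds_unique this hpart]
  exact hsum.hasSum

end Abstract

/-! ### Parseval identities for a diagonalization. -/

section EigenSystem

variable {E : Type*} [NormedAddCommGroup E] [InnerProductSpace ℂ E]

theorem _root_.Orthonormal.inner_eq_of_hasSum {κ : Type*} {e : κ → E} (he : Orthonormal ℂ e)
    {a : κ → ℂ} {x : E} (h : HasSum (fun k => a k • e k) x) (k : κ) : inner ℂ (e k) x = a k := by
  classical
  have h1 := h.mapL (innerSL ℂ (e k))
  have h2 : (fun l => innerSL ℂ (e k) (a l • e l)) = fun l => if l = k then a k else 0 := by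
    funext l
    rw [map_smul, innerSL_apply_apply, orthonormal_iff_ite.mp he k l]
    by_cases hkl : l = k
    · simp [hkl]
    · simp [hkl, Ne.symm hkl]
  rw [h2] at h1
  exact h1.unique (hasSum_ite_eq k (a k))

theorem _root_.Orthonormal.hasSum_norm_sq {κ : Type*} {e : κ → E} (he : Orthonormal ℂ e)
    {a : κ → ℂ} {x : E} (h : HasSum (fun k => a k • e k) x) :
    HasSum (fun k => ‖a k‖ ^ 2) (‖x‖ ^ 2) := by
  have h1 := h.mapL (innerSL ℂ x)
  have h2 : (fun k => innerSL ℂ x (a k • e k)) = fun k => ((‖a k‖ ^ 2 : ℝ) : ℂ) := by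
    funext k
    rw [map_smul, innerSL_apply_apply, ← inner_conj_symm, he.inner_eq_of_hasSum h k, smul_eq_mul,
      Complex.mul_conj, Complex.normSq_eq_norm_sq]
  rw [h2, innerSL_apply_apply, inner_self_eq_norm_sq_to_K] at h1
  have h3 : HasSum (fun k => ((‖a k‖ ^ 2 : ℝ) : ℂ)) ((‖x‖ ^ 2 : ℝ) : ℂ) := by simpa using h1
  exact Complex.hasSum_ofReal.mp h3

variable {H : L2R → L2R} {lam : ℕ → ℝ} {e : ℕ → L2R}

theorem IsEigenSystem.hasSum_norm_sq (h : IsEigenSystem H lam e) (f : L2R) :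
    HasSum (fun k => lam k ^ 2 * ‖inner ℂ (e k) f‖ ^ 2) (‖H f‖ ^ 2) := by
  convert! h.orthonormal.hasSum_norm_sq (h.hasSum f) using 2 with k
  rw [norm_mul, mul_pow, Complex.norm_of_nonneg (h.nonneg k)]

theorem IsEigenSystem.hasSum_norm_sq_sq (h : IsEigenSystem H lam e) (f : L2R) :
    HasSum (fun k => lam k ^ 4 * ‖inner ℂ (e k) f‖ ^ 2) (‖H (H f)‖ ^ 2) := by
  convert! h.hasSum_norm_sq (H f) using 2 with k
  rw [h.orthonormal.inner_eq_of_hasSum (h.hasSum f) k, norm_mul, Complex.norm_of_nonneg (h.nonneg k)]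
  ring

theorem IsEigenSystem.le_of_norm_le (h : IsEigenSystem H lam e) {b : ℝ}
    (hb : ∀ f, ‖H f‖ ≤ b * ‖f‖) (k : ℕ) : lam k ≤ b := by
  have h1 := hb (e k)
  rw [h.orthonormal.1 k, mul_one] at h1
  refine le_trans ?_ h1
  have h2 := h.orthonormal.inner_eq_of_hasSum (h.hasSum (e k)) k
  rw [inner_self_eq_norm_sq_to_K, h.orthonormal.1 k] at h2
  have h3 := norm_inner_le_norm (𝕜 := ℂ) (e k) (H (e k))
  rw [h2, h.orthonormal.1 k, one_mul] at h3
  refine le_trans ?_ h3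
  simp [abs_of_nonneg (h.nonneg k)]

theorem IsEigenSystem.hasSum_norm_sq_truncOp (h : IsEigenSystem H lam e) (ε : ℝ) (f : L2R) :
    HasSum ({k | ε < lam k}.indicator fun k => lam k ^ 2 * ‖inner ℂ (e k) f‖ ^ 2)
      (‖truncOp lam e ε f‖ ^ 2) := by
  have h1 : Summable (fun k : {k : ℕ // ε < lam k} => ((lam k : ℂ) * inner ℂ (e k) f) • e k) :=
    (h.hasSum f).summable.subtype _
  have h2 := (h.orthonormal.comp _ (Subtype.val_injective (p := fun k => ε < lam k))).hasSum_norm_sq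
    h1.hasSum
  refine (hasSum_subtype_iff_indicator (s := {k | ε < lam k})).mp ?_
  convert! h2 using 2 with k
  simp [mul_pow]

end EigenSystem

/-! ### From form bounds to square-sum bounds and frames of eigenvectors. -/

section Frames

variable {ι : Type*} {T : ι → L2R →L[ℂ] L2R} {b : ℝ}

theorem summable_form (hpos : ∀ j, (T j).IsPositive)
    (hb : ∀ (f : L2R) (F : Finset ι), ∑ j ∈ F, RCLike.re (inner ℂ (T j f) f) ≤ b * ‖f‖ ^ 2)
    (f : L2R) : Summable (fun j => RCLike.re (inner ℂ (T j f) f)) :=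
  summable_of_sum_le (fun j => (hpos j).re_inner_nonneg_left f) (hb f)

theorem tsum_form_le (hpos : ∀ j, (T j).IsPositive)
    (hb : ∀ (f : L2R) (F : Finset ι), ∑ j ∈ F, RCLike.re (inner ℂ (T j f) f) ≤ b * ‖f‖ ^ 2)
    (f : L2R) : ∑' j, RCLike.re (inner ℂ (T j f) f) ≤ b * ‖f‖ ^ 2 :=
  (summable_form hpos hb f).tsum_le_of_sum_le (hb f)

theorem form_le (hb : ∀ (f : L2R) (F : Finset ι), ∑ j ∈ F, RCLike.re (inner ℂ (T j f) f)
    ≤ b * ‖f‖ ^ 2) (j : ι) (f : L2R) : RCLike.re (inner ℂ (T j f) f) ≤ b * ‖f‖ ^ 2 := by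
  simpa using hb f {j}

theorem summable_norm_sq (hpos : ∀ j, (T j).IsPositive)
    (hb : ∀ (f : L2R) (F : Finset ι), ∑ j ∈ F, RCLike.re (inner ℂ (T j f) f) ≤ b * ‖f‖ ^ 2)
    (f : L2R) : Summable (fun j => ‖T j f‖ ^ 2) :=
  Summable.of_nonneg_of_le (fun _ => sq_nonneg _)
    (fun j => norm_sq_apply_le (hpos j) (form_le hb j) f) ((summable_form hpos hb f).mul_left b)

theorem tsum_norm_sq_le (hb0 : 0 ≤ b) (hpos : ∀ j, (T j).IsPositive)
    (hb : ∀ (f : L2R) (F : Finset ι), ∑ j ∈ F, RCLike.re (inner ℂ (T j f) f) ≤ b * ‖f‖ ^ 2)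
    (f : L2R) : ∑' j, ‖T j f‖ ^ 2 ≤ b ^ 2 * ‖f‖ ^ 2 := by
  have h1 := (summable_norm_sq hpos hb f).tsum_le_tsum
    (fun j => norm_sq_apply_le (hpos j) (form_le hb j) f) ((summable_form hpos hb f).mul_left b)
  rw [tsum_mul_left] at h1
  have h2 := mul_le_mul_of_nonneg_left (tsum_form_le hpos hb f) hb0
  linarith

theorem norm_sq_apply_apply_le (hb0 : 0 ≤ b) (hpos : ∀ j, (T j).IsPositive)
    (hb : ∀ (f : L2R) (F : Finset ι), ∑ j ∈ F, RCLike.re (inner ℂ (T j f) f) ≤ b * ‖f‖ ^ 2)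
    (j : ι) (f : L2R) : ‖T j (T j f)‖ ^ 2 ≤ b ^ 2 * ‖T j f‖ ^ 2 := by
  rw [← mul_pow]
  exact pow_le_pow_left₀ (norm_nonneg _) (norm_apply_le_of_form_le (hpos j) hb0 (form_le hb j) _) 2

theorem summable_norm_sq_sq (hb0 : 0 ≤ b) (hpos : ∀ j, (T j).IsPositive)
    (hb : ∀ (f : L2R) (F : Finset ι), ∑ j ∈ F, RCLike.re (inner ℂ (T j f) f) ≤ b * ‖f‖ ^ 2)
    (f : L2R) : Summable (fun j => ‖T j (T j f)‖ ^ 2) :=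
  Summable.of_nonneg_of_le (fun _ => sq_nonneg _)
    (fun j => norm_sq_apply_apply_le hb0 hpos hb j f) ((summable_norm_sq hpos hb f).mul_left _)

/-- The interpolation inequality is summed with δ = a/(2b): the form term then absorbs exactly half
of the lower bound a, and the other half bounds Σ‖T_j² f‖² from below. -/
theorem exists_sqSumBounds (hb0 : 0 < b) (hpos : ∀ j, (T j).IsPositive)
    (hb : ∀ (f : L2R) (F : Finset ι), ∑ j ∈ F, RCLike.re (inner ℂ (T j f) f) ≤ b * ‖f‖ ^ 2)
    {a : ℝ} (ha : 0 < a) (hlow : ∀ f, a * ‖f‖ ^ 2 ≤ ∑' j, ‖T j f‖ ^ 2) :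
    ∃ A B : ℝ, 0 < A ∧ A ≤ B ∧
      SqSumBounds (fun j f => T j (T j f)) A B ∧ SqSumBounds (fun j f => T j f) A B := by
  set δ := a / (2 * b) with hδ
  have hδ0 : 0 < δ := by positivity
  refine ⟨min a (δ ^ 2 * (a / 2)), max (min a (δ ^ 2 * (a / 2))) (max (b ^ 2) (b ^ 2 * b ^ 2)),
    lt_min ha (by positivity), le_max_left _ _, fun f => ?_, fun f => ?_⟩
  · have hs1 := summable_norm_sq hpos hb f
    have hs2 := summable_norm_sq_sq hb0.le hpos hb f
    refine ⟨hs2, ?_, ?_⟩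
    · have h1 : ∑' j, ‖T j f‖ ^ 2 ≤ ∑' j, (δ * RCLike.re (inner ℂ (T j f) f)
          + ‖T j (T j f)‖ ^ 2 / δ ^ 2) :=
        hs1.tsum_le_tsum (fun j => norm_sq_apply_le_interpolation (hpos j) hδ0 f)
          (((summable_form hpos hb f).mul_left δ).add (hs2.div_const _))
      rw [((summable_form hpos hb f).mul_left δ).tsum_add (hs2.div_const _), tsum_mul_left,
        tsum_div_const] at h1
      have h2 := mul_le_mul_of_nonneg_left (tsum_form_le hpos hb f) hδ0.le
      have h3 : δ * (b * ‖f‖ ^ 2) = a / 2 * ‖f‖ ^ 2 := by rw [hδ]; field_simp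
      have h4 : a / 2 * ‖f‖ ^ 2 ≤ (∑' j, ‖T j (T j f)‖ ^ 2) / δ ^ 2 := by
        linarith [hlow f]
      rw [le_div_iff₀ (by positivity)] at h4
      calc _ ≤ (δ ^ 2 * (a / 2)) * ‖f‖ ^ 2 := by gcongr; exact min_le_right _ _
        _ = a / 2 * ‖f‖ ^ 2 * δ ^ 2 := by ring
        _ ≤ _ := h4
    · have h1 := hs2.tsum_le_tsum (norm_sq_apply_apply_le hb0.le hpos hb · f) (hs1.mul_left _)
      rw [tsum_mul_left] at h1
      have h2 := mul_le_mul_of_nonneg_left (tsum_norm_sq_le hb0.le hpos hb f) (sq_nonneg b)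
      calc _ ≤ b ^ 2 * b ^ 2 * ‖f‖ ^ 2 := by linarith
        _ ≤ _ := by
          gcongr
          exact (le_max_right _ _).trans (le_max_right _ _)
  · refine ⟨summable_norm_sq hpos hb f, ?_, ?_⟩
    · refine le_trans ?_ (hlow f)
      gcongr
      exact min_le_left _ _
    · refine (tsum_norm_sq_le hb0.le hpos hb f).trans ?_
      gcongr
      exact (le_max_left _ _).trans (le_max_right _ _)

/-- Eigenvalues at most ε contribute at most ε²B‖f‖² to Σ‖T_j² f‖² ≥ A‖f‖², so the large ones carry
at least (A - ε²B)‖f‖²; being at most b, they can be replaced by constants. -/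
theorem frames_of_eigenSystems (hb0 : 0 < b) (hpos : ∀ j, (T j).IsPositive)
    (hb : ∀ (f : L2R) (F : Finset ι), ∑ j ∈ F, RCLike.re (inner ℂ (T j f) f) ≤ b * ‖f‖ ^ 2)
    {A B : ℝ} (hA : 0 < A) (hAB : A ≤ B)
    (hlow : ∀ f, A * ‖f‖ ^ 2 ≤ ∑' j, ‖T j (T j f)‖ ^ 2)
    (hup : ∀ f, ∑' j, ‖T j f‖ ^ 2 ≤ B * ‖f‖ ^ 2)
    {ε : ℝ} (hε : 0 < ε) (hεAB : ε < A / B) {lam : ι → ℕ → ℝ} {e : ι → ℕ → L2R}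
    (heig : ∀ j, IsEigenSystem (T j) (lam j) (e j)) :
    IsFrame (fun q : {q : ι × ℕ // ε < lam q.1 q.2} => e q.1.1 q.1.2) ∧
      ∃ A' B' : ℝ, 0 < A' ∧ A' ≤ B' ∧
        SqSumBounds (fun j f => truncOp (lam j) (e j) ε f) A' B' := by
  have hB : 0 < B := hA.trans_le hAB
  -- As A ≤ B, the hypothesis gives ε < 1, whence ε²B < εB < A.
  have hgap : 0 < A - ε ^ 2 * B := by
    have h1 : ε * B < A := (lt_div_iff₀ hB).mp hεAB
    have h2 : ε < 1 := hεAB.trans_le ((div_le_one hB).mpr hAB)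
    nlinarith [mul_pos hε hB]
  have hlamle : ∀ j k, lam j k ≤ b := fun j k =>
    (heig j).le_of_norm_le (fun f => norm_apply_le_of_form_le (hpos j) hb0.le (form_le hb j) f) k
  have hs1 := summable_norm_sq hpos hb
  have hs2 := summable_norm_sq_sq hb0.le hpos hb
  constructor
  · let c : L2R → ι × ℕ → ℝ := fun f q => ‖inner ℂ (e q.1 q.2) f‖ ^ 2
    have hc0 : ∀ f q, 0 ≤ c f q := fun f q => sq_nonneg _
    have hP : ∀ f, HasSum (fun q : ι × ℕ => lam q.1 q.2 ^ 2 * c f q) (∑' j, ‖T j f‖ ^ 2) := by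
      intro f
      have hs : Summable (fun q : ι × ℕ => lam q.1 q.2 ^ 2 * c f q) := by
        refine (summable_prod_of_nonneg fun q => mul_nonneg (sq_nonneg _) (hc0 f q)).mpr
          ⟨fun j => ((heig j).hasSum_norm_sq f).summable, ?_⟩
        exact (hs1 f).congr fun j => ((heig j).hasSum_norm_sq f).tsum_eq.symm
      convert! hs.hasSum using 1
      rw [hs.tsum_prod]
      exact tsum_congr fun j => ((heig j).hasSum_norm_sq f).tsum_eq.symm
    have hQ : ∀ f, HasSum (fun q : ι × ℕ => lam q.1 q.2 ^ 4 * c f q)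
        (∑' j, ‖T j (T j f)‖ ^ 2) := by
      intro f
      have hs : Summable (fun q : ι × ℕ => lam q.1 q.2 ^ 4 * c f q) := by
        refine (summable_prod_of_nonneg fun q => mul_nonneg (by positivity) (hc0 f q)).mpr
          ⟨fun j => ((heig j).hasSum_norm_sq_sq f).summable, ?_⟩
        exact (hs2 f).congr fun j => ((heig j).hasSum_norm_sq_sq f).tsum_eq.symm
      convert! hs.hasSum using 1
      rw [hs.tsum_prod]
      exact tsum_congr fun j => ((heig j).hasSum_norm_sq_sq f).tsum_eq.symm
    let S : Set (ι × ℕ) := {q | ε < lam q.1 q.2}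
    have hcP : ∀ f q, S.indicator (c f) q ≤ (ε ^ 2)⁻¹ * (lam q.1 q.2 ^ 2 * c f q) := by
      intro f q
      by_cases hq : q ∈ S
      · rw [Set.indicator_of_mem hq, ← mul_assoc]
        refine le_mul_of_one_le_left (hc0 f q) ?_
        rw [inv_mul_eq_div, one_le_div (by positivity)]
        exact pow_le_pow_left₀ hε.le (le_of_lt hq) 2
      · rw [Set.indicator_of_notMem hq]
        have := hc0 f q
        positivity
    have hcs : ∀ f, Summable (S.indicator (c f)) := fun f =>
      Summable.of_nonneg_of_le (fun q => Set.indicator_nonneg (fun q _ => hc0 f q) q) (hcP f)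
        ((hP f).summable.mul_left _)
    -- The central split: λ ≤ b on the large eigenvalues, λ⁴ ≤ ε²λ² on the others.
    have hQc : ∀ f q, lam q.1 q.2 ^ 4 * c f q
        ≤ b ^ 4 * S.indicator (c f) q + ε ^ 2 * (lam q.1 q.2 ^ 2 * c f q) := by
      intro f q
      have hn := (heig q.1).nonneg q.2
      have hc := hc0 f q
      by_cases hq : q ∈ S
      · rw [Set.indicator_of_mem hq]
        have : lam q.1 q.2 ^ 4 * c f q ≤ b ^ 4 * c f q := by
          gcongr
          exact hlamle _ _
        have : 0 ≤ ε ^ 2 * (lam q.1 q.2 ^ 2 * c f q) := by positivity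
        linarith
      · rw [Set.indicator_of_notMem hq, mul_zero, zero_add, ← mul_assoc]
        gcongr
        have hle : lam q.1 q.2 ≤ ε := not_lt.mp hq
        calc lam q.1 q.2 ^ 4 = lam q.1 q.2 ^ 2 * lam q.1 q.2 ^ 2 := by ring
          _ ≤ ε ^ 2 * lam q.1 q.2 ^ 2 := by gcongr
    have hsub : ∀ f, ∑' q : {q : ι × ℕ // ε < lam q.1 q.2}, ‖inner ℂ (e q.1.1 q.1.2) f‖ ^ 2
        = ∑' q, S.indicator (c f) q := fun f => tsum_subtype S (c f)
    refine ⟨(A - ε ^ 2 * B) / b ^ 4, max ((A - ε ^ 2 * B) / b ^ 4) ((ε ^ 2)⁻¹ * B),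
      by positivity, le_max_left _ _, fun f => ⟨?_, ?_, ?_⟩⟩
    · exact (summable_subtype_iff_indicator (s := S)).mpr (hcs f)
    · rw [hsub]
      have h1 := (hQ f).summable.tsum_le_tsum (hQc f)
        (((hcs f).mul_left (b ^ 4)).add ((hP f).summable.mul_left (ε ^ 2)))
      rw [((hcs f).mul_left (b ^ 4)).tsum_add ((hP f).summable.mul_left (ε ^ 2)), tsum_mul_left,
        tsum_mul_left, (hQ f).tsum_eq, (hP f).tsum_eq] at h1
      have h2 := mul_le_mul_of_nonneg_left (hup f) (sq_nonneg ε)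
      rw [div_mul_eq_mul_div, div_le_iff₀ (by positivity)]
      linarith [hlow f]
    · rw [hsub]
      have h1 := (hcs f).tsum_le_tsum (hcP f) ((hP f).summable.mul_left _)
      rw [tsum_mul_left, (hP f).tsum_eq] at h1
      calc _ ≤ (ε ^ 2)⁻¹ * B * ‖f‖ ^ 2 := by
            rw [mul_assoc]
            exact h1.trans (mul_le_mul_of_nonneg_left (hup f) (by positivity))
        _ ≤ _ := by gcongr; exact le_max_right _ _
  · have hle : ∀ f j, ‖truncOp (lam j) (e j) ε f‖ ^ 2 ≤ ‖T j f‖ ^ 2 := by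
      intro f j
      refine hasSum_le (fun k => ?_) ((heig j).hasSum_norm_sq_truncOp ε f)
        ((heig j).hasSum_norm_sq f)
      exact Set.indicator_le_self' (fun _ _ => by positivity) k
    have hst : ∀ f, Summable (fun j => ‖truncOp (lam j) (e j) ε f‖ ^ 2) := fun f =>
      Summable.of_nonneg_of_le (fun _ => sq_nonneg _) (hle f) (hs1 f)
    -- The same split with a factor λ² kept on the large eigenvalues, so b² replaces b⁴.
    have hge : ∀ f j, ‖T j (T j f)‖ ^ 2
        ≤ b ^ 2 * ‖truncOp (lam j) (e j) ε f‖ ^ 2 + ε ^ 2 * ‖T j f‖ ^ 2 := by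
      intro f j
      refine hasSum_le (fun k => ?_) ((heig j).hasSum_norm_sq_sq f)
        ((((heig j).hasSum_norm_sq_truncOp ε f).mul_left (b ^ 2)).add
          (((heig j).hasSum_norm_sq f).mul_left (ε ^ 2)))
      have hn := (heig j).nonneg k
      have e4 : lam j k ^ 4 * ‖inner ℂ (e j k) f‖ ^ 2
          = lam j k ^ 2 * (lam j k ^ 2 * ‖inner ℂ (e j k) f‖ ^ 2) := by ring
      rw [e4]
      by_cases hk : ε < lam j k
      · rw [Set.indicator_of_mem (show k ∈ {k | ε < lam j k} from hk)]
        have h1 : lam j k ^ 2 * (lam j k ^ 2 * ‖inner ℂ (e j k) f‖ ^ 2)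
            ≤ b ^ 2 * (lam j k ^ 2 * ‖inner ℂ (e j k) f‖ ^ 2) := by
          gcongr
          exact hlamle _ _
        have h2 : 0 ≤ ε ^ 2 * (lam j k ^ 2 * ‖inner ℂ (e j k) f‖ ^ 2) := by positivity
        linarith
      · rw [Set.indicator_of_notMem (show k ∉ {k | ε < lam j k} from hk), mul_zero, zero_add]
        gcongr
        exact not_lt.mp hk
    refine ⟨(A - ε ^ 2 * B) / b ^ 2, max ((A - ε ^ 2 * B) / b ^ 2) B,
      by positivity, le_max_left _ _, fun f => ⟨hst f, ?_, ?_⟩⟩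
    · have h1 := (hs2 f).tsum_le_tsum (hge f)
        (((hst f).mul_left (b ^ 2)).add ((hs1 f).mul_left (ε ^ 2)))
      rw [((hst f).mul_left (b ^ 2)).tsum_add ((hs1 f).mul_left (ε ^ 2)), tsum_mul_left,
        tsum_mul_left] at h1
      have h2 := mul_le_mul_of_nonneg_left (hup f) (sq_nonneg ε)
      rw [div_mul_eq_mul_div, div_le_iff₀ (by positivity)]
      linarith [hlow f]
    · calc _ ≤ B * ‖f‖ ^ 2 := ((hst f).tsum_le_tsum (hle f) (hs1 f)).trans (hup f)
        _ ≤ _ := by gcongr; exact le_max_right _ _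

end Frames

/-! ### Time-frequency shifts: commutation, continuity, covariance of the STFT. -/

section Shifts

open Filter Topology

/-- The unimodular factor `exp(2 π i a)`. -/
def phase (a : ℝ) : ℂ := Complex.exp (((2 * Real.pi * a : ℝ) : ℂ) * Complex.I)

@[simp] theorem norm_phase (a : ℝ) : ‖phase a‖ = 1 := Complex.norm_exp_ofReal_mul_I _

@[simp] theorem phase_zero : phase 0 = 1 := by simp [phase]

theorem phase_add (a b : ℝ) : phase (a + b) = phase a * phase b := by
  rw [phase, phase, phase, ← Complex.exp_add]
  congr 1
  push_cast
  ring

theorem conj_phase (a : ℝ) : conj (phase a) = phase (-a) := by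
  rw [phase, phase, ← Complex.exp_conj]
  congr 1
  simp only [map_mul, Complex.conj_ofReal, Complex.conj_I]
  push_cast
  ring

@[fun_prop]
theorem continuous_phase : Continuous phase := by unfold phase; fun_prop

theorem norm_phase_sub_one_le (a : ℝ) : ‖phase a - 1‖ ≤ 2 * Real.pi * |a| := by
  have h := Real.norm_exp_I_mul_ofReal_sub_one_le (x := 2 * Real.pi * a)
  rw [mul_comm Complex.I] at h
  refine h.trans (le_of_eq ?_)
  rw [Real.norm_eq_abs, abs_mul, abs_of_pos Real.two_pi_pos]

theorem shiftFun_eq (z : ℝ × ℝ) (φ : ℝ → ℂ) (t : ℝ) :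
    shiftFun z φ t = phase (z.2 * t) * φ (t - z.1) := by
  rw [shiftFun, phase, mul_assoc (2 * Real.pi)]

theorem coeFn_tfShift (z : ℝ × ℝ) (φ : L2R) : tfShift z φ =ᵐ[volume] shiftFun z φ :=
  (memLp_shiftFun z φ).coeFn_toLp

theorem shiftFun_congr (z : ℝ × ℝ) {φ ψ : ℝ → ℂ} (h : φ =ᵐ[volume] ψ) :
    shiftFun z φ =ᵐ[volume] shiftFun z ψ := by
  filter_upwards [(measurePreserving_sub_right volume z.1).quasiMeasurePreserving.ae_eq_comp h]
    with t ht
  rw [shiftFun_eq, shiftFun_eq]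
  exact congrArg _ ht

theorem tfShift_eq_of_ae {z : ℝ × ℝ} {φ ψ : L2R} (h : shiftFun z φ =ᵐ[volume] ψ) :
    tfShift z φ = ψ := Lp.ext ((coeFn_tfShift z φ).trans h)

theorem tfShift_add (z : ℝ × ℝ) (φ ψ : L2R) : tfShift z (φ + ψ) = tfShift z φ + tfShift z ψ := by
  refine tfShift_eq_of_ae ?_
  filter_upwards [shiftFun_congr z (Lp.coeFn_add φ ψ), coeFn_tfShift z φ, coeFn_tfShift z ψ,
    Lp.coeFn_add (tfShift z φ) (tfShift z ψ)] with t h1 h2 h3 h4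
  rw [h1, h4, Pi.add_apply, h2, h3, shiftFun_eq, shiftFun_eq, shiftFun_eq, Pi.add_apply, mul_add]

theorem tfShift_smul (z : ℝ × ℝ) (c : ℂ) (φ : L2R) : tfShift z (c • φ) = c • tfShift z φ := by
  refine tfShift_eq_of_ae ?_
  filter_upwards [shiftFun_congr z (Lp.coeFn_smul c φ), coeFn_tfShift z φ,
    Lp.coeFn_smul c (tfShift z φ)] with t h1 h2 h3
  rw [h1, h3, Pi.smul_apply, h2, shiftFun_eq, shiftFun_eq, Pi.smul_apply, smul_eq_mul, smul_eq_mul,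
    mul_left_comm]

@[simp] theorem norm_tfShift (z : ℝ × ℝ) (φ : L2R) : ‖tfShift z φ‖ = ‖φ‖ := by
  rw [tfShift, Lp.norm_toLp, Lp.norm_def]
  congr 1
  have h : eLpNorm (shiftFun z φ) 2 volume = eLpNorm (fun t => φ (t - z.1)) 2 volume := by
    refine eLpNorm_congr_norm_ae (Eventually.of_forall fun t => ?_)
    rw [shiftFun_eq, norm_mul, norm_phase, one_mul]
  rw [h]
  exact eLpNorm_comp_measurePreserving (Lp.aestronglyMeasurable φ)
    (measurePreserving_sub_right volume z.1)

/-- The time-frequency shift as a linear isometry. -/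
def tfShiftₗᵢ (z : ℝ × ℝ) : L2R →ₗᵢ[ℂ] L2R where
  toFun := tfShift z
  map_add' := tfShift_add z
  map_smul' := tfShift_smul z
  norm_map' := norm_tfShift z

theorem inner_tfShift_tfShift (z : ℝ × ℝ) (f g : L2R) :
    inner ℂ (tfShift z f) (tfShift z g) = inner ℂ f g := (tfShiftₗᵢ z).inner_map_map f g

theorem tfShift_sub (z : ℝ × ℝ) (φ ψ : L2R) : tfShift z (φ - ψ) = tfShift z φ - tfShift z ψ :=
  map_sub (tfShiftₗᵢ z) φ ψ

theorem tfShift_tfShift (z w : ℝ × ℝ) (φ : L2R) :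
    tfShift z (tfShift w φ) = phase (-(w.2 * z.1)) • tfShift (z + w) φ := by
  refine tfShift_eq_of_ae ?_
  filter_upwards [shiftFun_congr z (coeFn_tfShift w φ), coeFn_tfShift (z + w) φ,
    Lp.coeFn_smul (phase (-(w.2 * z.1))) (tfShift (z + w) φ)] with t h1 h2 h3
  rw [h1, h3, Pi.smul_apply, h2, shiftFun_eq, shiftFun_eq, shiftFun_eq, smul_eq_mul, ← mul_assoc,
    ← mul_assoc, ← phase_add, ← phase_add, Prod.fst_add, Prod.snd_add, sub_sub]
  congr 2
  ring

/-- The symplectic form on the plane. -/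
def symp (ζ z : ℝ × ℝ) : ℝ := ζ.2 * z.1 - ζ.1 * z.2

theorem tfShift_comm (z w : ℝ × ℝ) (φ : L2R) :
    tfShift z (tfShift w φ) = phase (-symp w z) • tfShift w (tfShift z φ) := by
  rw [tfShift_tfShift, tfShift_tfShift, smul_smul, ← phase_add, add_comm w z]
  congr 2
  simp only [symp]
  ring

theorem tfShift_zero (φ : L2R) : tfShift 0 φ = φ := by
  refine tfShift_eq_of_ae (Eventually.of_forall fun t => ?_)
  simp [shiftFun_eq]

theorem continuous_translation (φ : L2R) : Continuous fun x : ℝ => tfShift (x, 0) φ := by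
  have hmp : ∀ x : ℝ, MeasurePreserving
      ((ContinuousMap.mk (fun p : ℝ × ℝ => p.2 - p.1) (by fun_prop)).curry x) volume volume :=
    fun x => measurePreserving_sub_right volume x
  have h := (continuous_const (y := φ)).compMeasurePreservingLp
    (ContinuousMap.continuous (ContinuousMap.mk (fun p : ℝ × ℝ => p.2 - p.1) (by fun_prop)).curry)
    hmp ENNReal.ofNat_ne_top
  refine h.congr fun x => (tfShift_eq_of_ae ?_).symm
  filter_upwards [Lp.coeFn_compMeasurePreserving φ (hmp x)] with t ht
  rw [ht, shiftFun_eq]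
  simp

/-- For isometries, ‖u - v‖² = 2‖φ‖² - 2 Re⟨u, v⟩ reduces norm continuity to that of inner products,
which follows by dominated convergence. -/
theorem continuous_modulation (φ : L2R) : Continuous fun ω : ℝ => tfShift (0, ω) φ := by
  rw [continuous_iff_continuousAt]
  intro ω₀
  have hin : ∀ ω : ℝ, inner ℂ (tfShift (0, ω₀) φ) (tfShift (0, ω) φ)
      = ∫ t, phase ((ω - ω₀) * t) * (inner ℂ (φ t) (φ t)) := by
    intro ω
    rw [L2.inner_def]
    refine integral_congr_ae ?_
    filter_upwards [coeFn_tfShift (0, ω₀) φ, coeFn_tfShift (0, ω) φ] with t h1 h2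
    rw [h1, h2, shiftFun_eq, shiftFun_eq]
    simp only [sub_zero]
    rw [RCLike.inner_apply, RCLike.inner_apply, map_mul, conj_phase,
      show (ω - ω₀) * t = ω * t + -(ω₀ * t) by ring, phase_add]
    ring
  have hcont : Continuous fun ω : ℝ => inner ℂ (tfShift (0, ω₀) φ) (tfShift (0, ω) φ) := by
    simp_rw [hin]
    refine continuous_of_dominated (bound := fun t => ‖inner ℂ (φ t) (φ t)‖) ?_ ?_ ?_ ?_
    · intro ω
      exact (by fun_prop : Continuous fun t : ℝ => phase ((ω - ω₀) * t)).aestronglyMeasurable.mul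
        (L2.integrable_inner φ φ).1
    · intro ω
      exact Eventually.of_forall fun t => by rw [norm_mul, norm_phase, one_mul]
    · exact (L2.integrable_inner φ φ).norm
    · exact Eventually.of_forall fun t => by fun_prop
  have hsq : ∀ ω : ℝ, ‖tfShift (0, ω) φ - tfShift (0, ω₀) φ‖ ^ 2
      = 2 * ‖φ‖ ^ 2 - 2 * RCLike.re (inner ℂ (tfShift (0, ω₀) φ) (tfShift (0, ω) φ)) := by
    intro ω
    rw [norm_sub_rev, @norm_sub_sq ℂ, norm_tfShift, norm_tfShift]
    ring
  have hlim : Tendsto (fun ω : ℝ => ‖tfShift (0, ω) φ - tfShift (0, ω₀) φ‖ ^ 2) (𝓝 ω₀) (𝓝 0) := by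
    simp_rw [hsq]
    have : Continuous fun ω : ℝ =>
        2 * ‖φ‖ ^ 2 - 2 * RCLike.re (inner ℂ (tfShift (0, ω₀) φ) (tfShift (0, ω) φ)) := by
      fun_prop
    refine (this.tendsto ω₀).trans (le_of_eq ?_)
    rw [inner_self_eq_norm_sq, norm_tfShift, sub_self]
  rw [ContinuousAt, tendsto_iff_norm_sub_tendsto_zero]
  have := (Real.continuous_sqrt.tendsto 0).comp hlim
  rw [Real.sqrt_zero] at this
  refine this.congr fun ω => ?_
  simp

theorem continuous_tfShift (φ : L2R) : Continuous fun z : ℝ × ℝ => tfShift z φ := by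
  have hdec : ∀ z : ℝ × ℝ, tfShift z φ = tfShift (0, z.2) (tfShift (z.1, 0) φ) := by
    intro z
    rw [tfShift_tfShift]
    simp
  rw [continuous_iff_continuousAt]
  intro z₀
  rw [ContinuousAt, tendsto_iff_norm_sub_tendsto_zero]
  have h1 : Tendsto (fun z : ℝ × ℝ => ‖tfShift (z.1, 0) φ - tfShift (z₀.1, 0) φ‖) (𝓝 z₀) (𝓝 0) :=
    tendsto_iff_norm_sub_tendsto_zero.mp
      (((continuous_translation φ).comp continuous_fst).tendsto z₀)
  have h2 : Tendsto (fun z : ℝ × ℝ => ‖tfShift (0, z.2) (tfShift (z₀.1, 0) φ)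
      - tfShift (0, z₀.2) (tfShift (z₀.1, 0) φ)‖) (𝓝 z₀) (𝓝 0) :=
    tendsto_iff_norm_sub_tendsto_zero.mp
      (((continuous_modulation (tfShift (z₀.1, 0) φ)).comp continuous_snd).tendsto z₀)
  have h3 := h1.add h2
  rw [add_zero] at h3
  refine squeeze_zero (fun _ => norm_nonneg _) (fun z => ?_) h3
  rw [hdec z, hdec z₀]
  calc _ = ‖tfShift (0, z.2) (tfShift (z.1, 0) φ - tfShift (z₀.1, 0) φ)
        + (tfShift (0, z.2) (tfShift (z₀.1, 0) φ) - tfShift (0, z₀.2) (tfShift (z₀.1, 0) φ))‖ := by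
        rw [tfShift_sub]; congr 1; abel
    _ ≤ _ := (norm_add_le _ _).trans (by rw [norm_tfShift])

theorem stft_eq_inner (φ f : L2R) (z : ℝ × ℝ) : stft φ f z = inner ℂ (tfShift z φ) f := by
  rw [L2.inner_def, stft]
  refine integral_congr_ae ?_
  filter_upwards [coeFn_tfShift z φ] with t ht
  rw [ht, RCLike.inner_apply]

theorem continuous_stft (φ f : L2R) : Continuous (stft φ f) := by
  have := continuous_tfShift φ
  have h : stft φ f = fun z => inner ℂ (tfShift z φ) f := funext (stft_eq_inner φ f)
  rw [h]
  fun_prop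

theorem norm_stft_le (φ f : L2R) (z : ℝ × ℝ) : ‖stft φ f z‖ ≤ ‖φ‖ * ‖f‖ := by
  rw [stft_eq_inner]
  exact (norm_inner_le_norm _ _).trans (by rw [norm_tfShift])

theorem stft_sub_left (φ ψ f : L2R) (z : ℝ × ℝ) :
    stft (φ - ψ : L2R) f z = stft φ f z - stft ψ f z := by
  simp only [stft_eq_inner, tfShift_sub, inner_sub_left]

theorem stft_sub_right (φ f g : L2R) (z : ℝ × ℝ) :
    stft φ (f - g : L2R) z = stft φ f z - stft φ g z := by
  simp only [stft_eq_inner, inner_sub_right]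

theorem stft_smul_right (φ f : L2R) (c : ℂ) (z : ℝ × ℝ) :
    stft φ (c • f : L2R) z = c * stft φ f z := by
  simp only [stft_eq_inner, inner_smul_right]

/-- Covariance: the commutation phase of two shifts is all that remains. Shifting f alone thus acts
on the STFT as a character, up to the cost of moving the window. -/
theorem stft_tfShift_tfShift (φ f : L2R) (ζ z : ℝ × ℝ) :
    stft (tfShift ζ φ) (tfShift ζ f) z = phase (symp ζ z) * stft φ f z := by
  rw [stft_eq_inner, stft_eq_inner, tfShift_comm, inner_smul_left, inner_tfShift_tfShift,
    conj_phase, neg_neg]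

end Shifts

/-! ### Localization operators: boundedness, compactness, positivity. -/

section LocalizationOperators

open InnerProductSpace Filter

/-- The localization operator as a bounded operator. -/
def locOpL (m : ℝ × ℝ → ℝ) (φ : L2R) : L2R →L[ℂ] L2R :=
  ∫ z, (m z : ℂ) • rankOne ℂ (tfShift z φ) (tfShift z φ)

theorem continuous_rankOne_tfShift (φ : L2R) :
    Continuous fun z : ℝ × ℝ => rankOne ℂ (tfShift z φ) (tfShift z φ) := by
  have h := continuous_tfShift φ
  exact ((ContinuousLinearMap.smulRightL ℂ L2R L2R).continuous.comp
    ((innerSL ℂ).continuous.comp h)).clm_apply h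

theorem integrable_smul_of_bounded {F : Type*} [NormedAddCommGroup F] [NormedSpace ℂ F]
    {m : ℝ × ℝ → ℝ} (hm : Integrable m) {u : ℝ × ℝ → F} (hu : Continuous u) {C : ℝ}
    (hC : ∀ z, ‖u z‖ ≤ C) : Integrable fun z => (m z : ℂ) • u z := by
  refine Integrable.mono' (hm.norm.mul_const C)
    ((Complex.continuous_ofReal.comp_aestronglyMeasurable hm.1).smul hu.aestronglyMeasurable)
    (Eventually.of_forall fun z => ?_)
  rw [norm_smul, Complex.norm_real]
  exact mul_le_mul_of_nonneg_left (hC z) (norm_nonneg _)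

variable {m : ℝ × ℝ → ℝ} (φ : L2R)

theorem integrable_locOpL (hm : Integrable m) :
    Integrable fun z : ℝ × ℝ => (m z : ℂ) • rankOne ℂ (tfShift z φ) (tfShift z φ) :=
  integrable_smul_of_bounded hm (continuous_rankOne_tfShift φ) (C := ‖φ‖ * ‖φ‖)
    fun z => by rw [norm_rankOne, norm_tfShift]

theorem locOpL_apply (hm : Integrable m) (f : L2R) : locOpL m φ f = locOp m φ f := by
  rw [locOpL, ContinuousLinearMap.integral_apply (integrable_locOpL φ hm), locOp]
  refine integral_congr_ae (Eventually.of_forall fun z => ?_)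
  simp only [_root_.smul_apply, rankOne_apply, stft_eq_inner, smul_smul, mul_comm]

/-- The integral commutes with the quotient map modulo K, which annihilates the integrand. -/
theorem integral_mem_of_isClosed {α F : Type*} [MeasurableSpace α] {μ : Measure α}
    [NormedAddCommGroup F] [NormedSpace ℂ F] [CompleteSpace F] {K : Submodule ℂ F}
    (hK : IsClosed (K : Set F)) {f : α → F} (hf : Integrable f μ) (hfK : ∀ a, f a ∈ K) :
    ∫ a, f a ∂μ ∈ K := by
  have : IsClosed (K : Set F) := hK
  rw [← Submodule.Quotient.mk_eq_zero]
  have h := K.mkQL.integral_comp_comm hf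
  have h0 : ∀ a, K.mkQL (f a) = 0 := fun a => (Submodule.Quotient.mk_eq_zero K).mpr (hfK a)
  simp only [h0, integral_zero] at h
  exact h.symm

/-- The operator-valued integrand has rank at most one, and compact operators form a norm-closed
subspace. -/
theorem isCompactOperator_locOpL (hm : Integrable m) : IsCompactOperator (locOpL m φ) := by
  have hK : ∀ z, rankOne ℂ (tfShift z φ) (tfShift z φ) ∈
      compactOperator (RingHom.id ℂ) L2R L2R := fun z =>
    (isCompactOperator_of_locallyCompactSpace_rng
      (ContinuousLinearMap.toSpanSingleton ℂ (tfShift z φ))).comp_clm (innerSL ℂ (tfShift z φ))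
  exact integral_mem_of_isClosed isClosed_setOfPred_isCompactOperator
    (integrable_locOpL φ hm) fun z => Submodule.smul_mem _ _ (hK z)

theorem integrable_locOp (hm : Integrable m) (f : L2R) :
    Integrable fun z : ℝ × ℝ => (stft φ f z * (m z : ℂ)) • tfShift z φ := by
  have h := integrable_smul_of_bounded hm (u := fun z => stft φ f z • tfShift z φ)
    ((continuous_stft φ f).smul (continuous_tfShift φ)) (C := ‖φ‖ * ‖f‖ * ‖φ‖) fun z => by
      rw [norm_smul, norm_tfShift]
      exact mul_le_mul_of_nonneg_right (norm_stft_le φ f z) (norm_nonneg _)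
  refine h.congr (Eventually.of_forall fun z => ?_)
  simp only [smul_smul, mul_comm]

theorem inner_locOp (hm : Integrable m) (h f : L2R) :
    inner ℂ h (locOp m φ f) = ∫ z, (m z : ℂ) * (stft φ f z * conj (stft φ h z)) := by
  rw [locOp, ← integral_inner (integrable_locOp φ hm f)]
  refine integral_congr_ae (Eventually.of_forall fun z => ?_)
  simp only [inner_smul_right, stft_eq_inner, inner_conj_symm]
  ring

theorem inner_locOp_left (hm : Integrable m) (h f : L2R) :
    inner ℂ (locOp m φ h) f = ∫ z, (m z : ℂ) * (stft φ f z * conj (stft φ h z)) := by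
  rw [← inner_conj_symm, inner_locOp φ hm, ← integral_conj]
  refine integral_congr_ae (Eventually.of_forall fun z => ?_)
  simp only [map_mul, Complex.conj_ofReal, Complex.conj_conj]
  ring

theorem inner_locOp_self (hm : Integrable m) (f : L2R) :
    inner ℂ (locOp m φ f) f = ((∫ z, m z * ‖stft φ f z‖ ^ 2 : ℝ) : ℂ) := by
  rw [inner_locOp_left φ hm, ← integral_complex_ofReal]
  refine integral_congr_ae (Eventually.of_forall fun z => ?_)
  simp only [Complex.mul_conj, Complex.normSq_eq_norm_sq, Complex.ofReal_mul]

theorem isPositive_locOpL (hm : Integrable m) (hm0 : ∀ᵐ z, 0 ≤ m z) :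
    (locOpL m φ).IsPositive := by
  rw [ContinuousLinearMap.isPositive_iff_complex]
  intro f
  rw [locOpL_apply φ hm, inner_locOp_self φ hm]
  refine ⟨by simp, ?_⟩
  rw [RCLike.re_to_complex, Complex.ofReal_re]
  refine integral_nonneg_of_ae ?_
  filter_upwards [hm0] with z hz
  simp only [Pi.zero_apply]
  positivity

end LocalizationOperators

/-- Indicators of the disjoint intervals [n, n+1) are orthonormal. -/
theorem not_finiteDimensional_L2R : ¬ FiniteDimensional ℂ L2R := by
  intro hfin
  let e : ℕ → L2R := fun n =>
    indicatorConstLp 2 (measurableSet_Ico (a := (n : ℝ)) (b := n + 1)) (by simp) (1 : ℂ)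
  have hinner : ∀ m n : ℕ, inner ℂ (e m) (e n) = if m = n then 1 else 0 := by
    intro m n
    rw [L2.inner_indicatorConstLp_one_indicatorConstLp_one _ _ (by simp) (by simp)]
    split_ifs with h
    · subst h; simp
    · have : Set.Ico (m : ℝ) (m + 1) ∩ Set.Ico (n : ℝ) (n + 1) = ∅ := by
        rw [Set.eq_empty_iff_forall_notMem]
        rintro x ⟨⟨h1, h2⟩, h3, h4⟩
        have h5 : (m : ℝ) < n + 1 := h1.trans_lt h4
        have h6 : (n : ℝ) < m + 1 := h3.trans_lt h2
        norm_cast at h5 h6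
        omega
      rw [this]; simp
  have := (orthonormal_iff_ite.mpr hinner).linearIndependent
  exact not_finite_iff_infinite.mpr inferInstance this.finite_of_isNoetherian

/-! ### Plancherel for the integral Fourier transform on L¹ ∩ L². -/

section Plancherel

open FourierTransform Filter
open scoped SchwartzMap ContDiff

/-- Tested against a smooth compactly supported function, each transform can be moved onto the test
function: on the L² side through tempered distributions, on the L¹ side by Fubini. -/
theorem fourier_toLp_ae_eq {g : ℝ → ℂ} (h1 : Integrable g) (h2 : MemLp g 2) :
    (𝓕 g : ℝ → ℂ) =ᵐ[volume] (𝓕 h2.toLp : L2R) := by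
  have hcont : Continuous (𝓕 g : ℝ → ℂ) :=
    VectorFourier.fourierIntegral_continuous Real.continuous_fourierChar
      (by exact continuous_inner) h1
  refine ae_eq_of_integral_contDiff_smul_eq hcont.locallyIntegrable
    ((Lp.memLp (𝓕 h2.toLp : L2R)).locallyIntegrable (by norm_num)) ?_
  intro ψ hψ hψc
  have hψ' : ContDiff ℝ ∞ fun t => (ψ t : ℂ) := Complex.ofRealCLM.contDiff.comp hψ
  have hψc' : HasCompactSupport fun t => (ψ t : ℂ) := hψc.comp_left Complex.ofReal_zero
  let Ψ : 𝓢(ℝ, ℂ) := hψc'.toSchwartzMap hψ'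
  have hΨ : ∀ t, Ψ t = (ψ t : ℂ) := fun t => rfl
  have e1 : ∫ t, Ψ t • (𝓕 h2.toLp : L2R) t = ∫ t, (𝓕 Ψ) t • h2.toLp g t := by
    rw [← Lp.toTemperedDistribution_apply, ← Lp.toTemperedDistribution_apply,
      ← TemperedDistribution.fourier_apply, Lp.fourier_toTemperedDistribution_eq]
  have e2 : ∫ t, (𝓕 Ψ) t • h2.toLp g t = ∫ t, (𝓕 Ψ) t • g t := by
    refine integral_congr_ae ?_
    filter_upwards [h2.coeFn_toLp] with t ht
    rw [ht]
  have e3 : ∫ t, (𝓕 Ψ) t • g t = ∫ t, Ψ t • (𝓕 g) t := by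
    have := VectorFourier.integral_fourierIntegral_smul_eq_flip (μ := volume) (ν := volume)
      (L := innerₗ ℝ) (e := Real.fourierChar) (f := (Ψ : ℝ → ℂ)) (g := g)
      Real.continuous_fourierChar (by exact continuous_inner) Ψ.integrable h1
    rw [flip_innerₗ] at this
    rw [SchwartzMap.fourier_coe]
    exact this
  have e4 := (e1.trans (e2.trans e3)).symm
  simpa only [hΨ, Complex.coe_smul, smul_eq_mul, Complex.real_smul] using e4

theorem memLp_fourier {g : ℝ → ℂ} (h1 : Integrable g) (h2 : MemLp g 2) :
    MemLp (𝓕 g : ℝ → ℂ) 2 :=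
  (memLp_congr_ae (fourier_toLp_ae_eq h1 h2)).mpr (Lp.memLp _)

theorem integral_fourier_mul_conj_fourier {g h : ℝ → ℂ} (hg1 : Integrable g) (hg2 : MemLp g 2)
    (hh1 : Integrable h) (hh2 : MemLp h 2) :
    ∫ ξ, (𝓕 g : ℝ → ℂ) ξ * conj ((𝓕 h : ℝ → ℂ) ξ) = ∫ t, g t * conj (h t) := by
  have e := Lp.inner_fourier_eq hh2.toLp hg2.toLp
  rw [L2.inner_def, L2.inner_def] at e
  convert! e using 1
  · refine integral_congr_ae ?_
    filter_upwards [fourier_toLp_ae_eq hg1 hg2, fourier_toLp_ae_eq hh1 hh2] with t a b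
    rw [a, b, RCLike.inner_apply]
  · refine integral_congr_ae ?_
    filter_upwards [hg2.coeFn_toLp, hh2.coeFn_toLp] with t a b
    rw [a, b, RCLike.inner_apply]

end Plancherel

/-! ### Moyal's orthogonality relations. -/

section Moyal

open FourierTransform Filter
open scoped Convolution

/-- The product of `f` with the conjugate of a translate of `φ`. -/
def windowed (φ f : ℝ → ℂ) (x t : ℝ) : ℂ := f t * conj (φ (t - x))

theorem memLp_translate (φ : L2R) (x : ℝ) : MemLp (fun t => φ (t - x)) 2 (volume : Measure ℝ) :=
  (Lp.memLp φ).comp_measurePreserving (measurePreserving_sub_right volume x)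

theorem integrable_windowed (φ f : L2R) (x : ℝ) : Integrable (windowed φ f x) :=
  (Lp.memLp f).integrable_mul (memLp_translate φ x).star

theorem stft_eq_fourier (φ f : ℝ → ℂ) (x ω : ℝ) :
    stft φ f (x, ω) = (𝓕 (windowed φ f x) : ℝ → ℂ) ω := by
  rw [Real.fourier_real_eq_integral_exp_smul, stft]
  congr 1
  funext t
  rw [shiftFun_eq, map_mul, conj_phase, phase, windowed, smul_eq_mul]
  rw [show 2 * Real.pi * -(ω * t) = -2 * Real.pi * t * ω by ring]
  ring

theorem integrable_norm_sq (f : L2R) : Integrable fun t => ‖f t‖ ^ 2 :=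
  (memLp_two_iff_integrable_sq_norm (Lp.aestronglyMeasurable f)).mp (Lp.memLp f)

theorem norm_windowed_sq (φ f : ℝ → ℂ) (x t : ℝ) :
    ‖windowed φ f x t‖ ^ 2
      = ContinuousLinearMap.mul ℝ ℝ (‖f t‖ ^ 2) (‖φ (-(x - t))‖ ^ 2) := by
  rw [windowed, norm_mul, RCLike.norm_conj, mul_pow, neg_sub]
  rfl

/-- As a function of x, the squared norm is the convolution of |f|² with the reflection of |φ|²,
finite almost everywhere. -/
theorem ae_memLp_windowed (φ f : L2R) : ∀ᵐ x, MemLp (windowed φ f x) 2 := by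
  have h := (integrable_norm_sq f).ae_convolution_exists (ContinuousLinearMap.mul ℝ ℝ)
    (integrable_norm_sq φ).comp_neg
  filter_upwards [h] with x hx
  rw [memLp_two_iff_integrable_sq_norm (integrable_windowed φ f x).1]
  refine Integrable.congr hx (Eventually.of_forall fun t => ?_)
  exact (norm_windowed_sq φ f x t).symm

theorem integral_norm_stft_sq_slice (φ f : L2R) {x : ℝ} (hx : MemLp (windowed φ f x) 2) :
    ∫ ω, ‖stft φ f (x, ω)‖ ^ 2 = ∫ t, ‖windowed φ f x t‖ ^ 2 := by
  have h := integral_fourier_mul_conj_fourier (integrable_windowed φ f x) hx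
    (integrable_windowed φ f x) hx
  simp only [Complex.mul_conj, Complex.normSq_eq_norm_sq, integral_complex_ofReal] at h
  simp only [stft_eq_fourier]
  exact_mod_cast h

theorem memLp_stft (φ f : L2R) : MemLp (stft φ f) 2 := by
  have hmeas := (continuous_stft φ f).aestronglyMeasurable (μ := (volume : Measure (ℝ × ℝ)))
  rw [memLp_two_iff_integrable_sq_norm hmeas]
  have hm2 : AEStronglyMeasurable (fun z => ‖stft φ f z‖ ^ 2) (volume : Measure (ℝ × ℝ)) :=
    (by have := continuous_stft φ f; fun_prop :
      Continuous fun z => ‖stft φ f z‖ ^ 2).aestronglyMeasurable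
  rw [Measure.volume_eq_prod] at hm2 ⊢
  rw [integrable_prod_iff hm2]
  constructor
  · filter_upwards [ae_memLp_windowed φ f] with x hx
    have h := memLp_fourier (integrable_windowed φ f x) hx
    have h2 := (memLp_two_iff_integrable_sq_norm h.1).mp h
    simpa only [stft_eq_fourier] using h2
  · have h := (integrable_norm_sq f).integrable_convolution (ContinuousLinearMap.mul ℝ ℝ)
      (integrable_norm_sq φ).comp_neg
    refine h.congr ?_
    filter_upwards [ae_memLp_windowed φ f] with x hx
    simp only [norm_pow, norm_norm]
    rw [integral_norm_stft_sq_slice φ f hx]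
    simp only [norm_windowed_sq]
    rfl

theorem integrable_stft_mul_conj (φ₁ f₁ φ₂ f₂ : L2R) :
    Integrable fun z => stft φ₁ f₁ z * conj (stft φ₂ f₂ z) :=
  (memLp_stft φ₁ f₁).integrable_mul (memLp_stft φ₂ f₂).star

/-- Orthogonality relations for the short-time Fourier transform. -/
theorem integral_stft_mul_conj (φ₁ f₁ φ₂ f₂ : L2R) :
    ∫ z, stft φ₁ f₁ z * conj (stft φ₂ f₂ z) = inner ℂ f₂ f₁ * inner ℂ φ₁ φ₂ := by
  have hint := integrable_stft_mul_conj φ₁ f₁ φ₂ f₂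
  rw [Measure.volume_eq_prod] at hint ⊢
  rw [integral_prod _ hint]
  -- Plancherel in ω turns the slice at x into the convolution of F and K at x, and the integral of
  -- a convolution factors.
  let F : ℝ → ℂ := fun t => f₁ t * conj (f₂ t)
  let K : ℝ → ℂ := fun u => conj (φ₁ (-u)) * φ₂ (-u)
  have hF : Integrable F := (Lp.memLp f₁).integrable_mul (Lp.memLp f₂).star
  have hK : Integrable K := ((Lp.memLp φ₁).star.integrable_mul (Lp.memLp φ₂)).comp_neg
  have hFi : ∫ t, F t = inner ℂ f₂ f₁ := by
    rw [L2.inner_def]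
    simp only [F, RCLike.inner_apply]
  have hKi : ∫ t, K t = inner ℂ φ₁ φ₂ := by
    rw [L2.inner_def]
    simp only [K, RCLike.inner_apply]
    rw [integral_neg_eq_self (fun u => conj (φ₁ u) * φ₂ u)]
    simp only [mul_comm]
  rw [← hFi, ← hKi]
  have hc := integral_convolution (ContinuousLinearMap.mul ℝ ℂ) hF hK
  refine Eq.trans ?_ hc
  refine integral_congr_ae ?_
  filter_upwards [ae_memLp_windowed φ₁ f₁, ae_memLp_windowed φ₂ f₂] with x h1 h2
  simp only [stft_eq_fourier]
  rw [integral_fourier_mul_conj_fourier (integrable_windowed φ₁ f₁ x) h1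
    (integrable_windowed φ₂ f₂ x) h2, convolution]
  congr 1
  funext t
  simp only [windowed, F, K, ContinuousLinearMap.mul_apply', map_mul, Complex.conj_conj, neg_sub]
  ring

theorem integrable_norm_stft_sq (φ f : L2R) : Integrable fun z => ‖stft φ f z‖ ^ 2 :=
  (memLp_two_iff_integrable_sq_norm (memLp_stft φ f).1).mp (memLp_stft φ f)

theorem integral_norm_stft_sq (φ f : L2R) : ∫ z, ‖stft φ f z‖ ^ 2 = ‖φ‖ ^ 2 * ‖f‖ ^ 2 := by
  have h := integral_stft_mul_conj φ f φ f
  simp only [Complex.mul_conj, Complex.normSq_eq_norm_sq, integral_complex_ofReal,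
    inner_self_eq_norm_sq_to_K] at h
  rw [mul_comm]
  exact Complex.ofReal_injective (by rw [h]; simp)

theorem integral_norm_stft_mul_norm_stft_le (φ f ψ g : L2R) :
    ∫ z, ‖stft φ f z‖ * ‖stft ψ g z‖ ≤ ‖φ‖ * ‖f‖ * (‖ψ‖ * ‖g‖) := by
  have h := integral_mul_le_Lp_mul_Lq_of_nonneg (μ := (volume : Measure (ℝ × ℝ)))
    (p := 2) (q := 2) (by constructor <;> norm_num)
    (f := fun z => ‖stft φ f z‖) (g := fun z => ‖stft ψ g z‖)
    (Eventually.of_forall fun _ => norm_nonneg _) (Eventually.of_forall fun _ => norm_nonneg _)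
    (by simpa using (memLp_stft φ f).norm) (by simpa using (memLp_stft ψ g).norm)
  refine h.trans (le_of_eq ?_)
  simp only [Real.rpow_two]
  rw [integral_norm_stft_sq, integral_norm_stft_sq, ← mul_pow, ← mul_pow, ← Real.sqrt_eq_rpow,
    ← Real.sqrt_eq_rpow, Real.sqrt_sq (by positivity), Real.sqrt_sq (by positivity)]

end Moyal

/-! ### Relatively separated points and decay of well-spread symbols. -/

section Separated

open Filter

variable {ι : Type*} {p : ι → ℝ × ℝ}

theorem RelativelySeparated.countable (hp : RelativelySeparated p) : Countable ι := by
  obtain ⟨N, hN⟩ := hp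
  obtain ⟨D, hDc, hD⟩ := TopologicalSpace.exists_countable_dense (ℝ × ℝ)
  have hcov : (Set.univ : Set ι) ⊆ ⋃ z ∈ D, {j | ‖p j - z‖ ≤ 1} := by
    intro j _
    obtain ⟨z, hz, hd⟩ := hD.exists_dist_lt (p j) zero_lt_one
    rw [dist_eq_norm] at hd
    exact Set.mem_biUnion hz hd.le
  rw [← Set.countable_univ_iff]
  refine Set.Countable.mono hcov (hDc.biUnion fun z _ => Set.Finite.countable ?_)
  exact Set.finite_of_encard_le_coe (hN z)

theorem integrable_japanese {s : ℝ} (hs : 1 < s) :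
    Integrable fun u : ℝ × ℝ => (1 + ‖u‖ ^ 2) ^ (-s) := by
  have h := integrable_rpow_neg_one_add_norm_sq (E := ℝ × ℝ) (μ := volume) (r := 2 * s)
    (by simp; linarith)
  convert! h using 3
  ring

theorem japanese_le_of_norm_sub_le_one {s : ℝ} (hs : 0 ≤ s) (z u w : ℝ × ℝ) (h : ‖w - u‖ ≤ 1) :
    (1 + ‖z - w‖ ^ 2) ^ (-s) ≤ 3 ^ s * (1 + ‖z - u‖ ^ 2) ^ (-s) := by
  have h1 : ‖z - u‖ ≤ ‖z - w‖ + 1 := by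
    calc _ = ‖(z - w) + (w - u)‖ := by congr 1; abel
      _ ≤ _ := (norm_add_le _ _).trans (by linarith)
  have h2 : 1 + ‖z - u‖ ^ 2 ≤ 3 * (1 + ‖z - w‖ ^ 2) := by
    have := pow_le_pow_left₀ (norm_nonneg _) h1 2
    nlinarith [sq_nonneg (‖z - w‖ - 1)]
  have h3 := Real.rpow_le_rpow_of_nonpos (by positivity) h2 (neg_nonpos.mpr hs)
  rw [Real.mul_rpow (by norm_num) (by positivity), Real.rpow_neg (by norm_num)] at h3
  have h4 : (0 : ℝ) < 3 ^ s := by positivity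
  rw [inv_mul_le_iff₀ h4] at h3
  exact h3

/-- Each term is at most 3^s times the integral of the weight over the unit sup-norm ball at p j,
which has area at least 1; at most N of these balls overlap at any point, so the sum is dominated by
the integral over the plane. -/
theorem RelativelySeparated.exists_sum_le (hp : RelativelySeparated p) {s : ℝ} (hs : 1 < s) :
    ∃ C : ℝ, 0 ≤ C ∧ ∀ (z : ℝ × ℝ) (F : Finset ι),
      ∑ j ∈ F, (1 + ‖z - p j‖ ^ 2) ^ (-s) ≤ C := by
  classical
  obtain ⟨N, hN⟩ := hp
  have hw := integrable_japanese hs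
  set W := ∫ u : ℝ × ℝ, (1 + ‖u‖ ^ 2) ^ (-s) with hW
  have hW0 : 0 ≤ W := integral_nonneg fun u => by positivity
  refine ⟨3 ^ s * N * W, by positivity, fun z F => ?_⟩
  have hwz : Integrable fun u : ℝ × ℝ => (1 + ‖z - u‖ ^ 2) ^ (-s) := hw.comp_sub_left z
  have hvol : ∀ a : ℝ × ℝ, (1 : ℝ) ≤ volume.real (Metric.closedBall a 1) := by
    intro a
    rw [← closedBall_prod_same, Measure.volume_eq_prod, measureReal_def, Measure.prod_prod,
      Real.volume_closedBall, Real.volume_closedBall, ENNReal.toReal_mul,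
      ENNReal.toReal_ofReal (by norm_num)]
    norm_num
  have hone : ∀ j, (1 + ‖z - p j‖ ^ 2) ^ (-s)
      ≤ ∫ u, (Metric.closedBall (p j) 1).indicator
        (fun u => 3 ^ s * (1 + ‖z - u‖ ^ 2) ^ (-s)) u := by
    intro j
    have h1 : ∫ u in Metric.closedBall (p j) 1, (1 + ‖z - p j‖ ^ 2) ^ (-s)
        ≤ ∫ u in Metric.closedBall (p j) 1, 3 ^ s * (1 + ‖z - u‖ ^ 2) ^ (-s) := by
      refine setIntegral_mono_on ?_ (hwz.const_mul _).integrableOn measurableSet_closedBall ?_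
      · exact integrableOn_const (by simp [(isCompact_closedBall (p j) 1).measure_lt_top.ne])
      · intro u hu
        refine japanese_le_of_norm_sub_le_one (by linarith) z u (p j) ?_
        rw [Metric.mem_closedBall, dist_eq_norm, norm_sub_rev] at hu
        exact hu
    rw [setIntegral_const, smul_eq_mul] at h1
    rw [integral_indicator measurableSet_closedBall]
    refine le_trans (le_mul_of_one_le_left (by positivity) (hvol (p j))) h1
  calc ∑ j ∈ F, (1 + ‖z - p j‖ ^ 2) ^ (-s)
      ≤ ∑ j ∈ F, ∫ u, (Metric.closedBall (p j) 1).indicator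
        (fun u => 3 ^ s * (1 + ‖z - u‖ ^ 2) ^ (-s)) u := Finset.sum_le_sum fun j _ => hone j
    _ = ∫ u, ∑ j ∈ F, (Metric.closedBall (p j) 1).indicator
        (fun u => 3 ^ s * (1 + ‖z - u‖ ^ 2) ^ (-s)) u := by
        rw [integral_finsetSum]
        intro j _
        exact (hwz.const_mul _).indicator measurableSet_closedBall
    _ ≤ ∫ u, (3 ^ s * N) * (1 + ‖z - u‖ ^ 2) ^ (-s) := by
        refine integral_mono (integrable_finsetSum _ fun j _ =>
          (hwz.const_mul _).indicator measurableSet_closedBall) (hwz.const_mul _) fun u => ?_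
        simp only [Set.indicator_apply]
        rw [← Finset.sum_filter, Finset.sum_const, nsmul_eq_mul]
        have hcard : ((F.filter fun j => u ∈ Metric.closedBall (p j) 1).card : ℝ) ≤ N := by
          have h1 : ((F.filter fun j => u ∈ Metric.closedBall (p j) 1 : Finset ι) : Set ι)
              ⊆ {j | ‖p j - u‖ ≤ 1} := by
            intro j hj
            have hj2 := (Finset.mem_filter.mp hj).2
            rw [Metric.mem_closedBall, dist_eq_norm, norm_sub_rev] at hj2
            exact hj2
          have h2 := (Set.encard_le_encard h1).trans (hN u)
          rw [Set.encard_coe_eq_coe_finsetCard] at h2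
          exact_mod_cast h2
        have h3 : (0 : ℝ) ≤ 3 ^ s * (1 + ‖z - u‖ ^ 2) ^ (-s) := by positivity
        calc _ ≤ (N : ℝ) * (3 ^ s * (1 + ‖z - u‖ ^ 2) ^ (-s)) :=
              mul_le_mul_of_nonneg_right hcard h3
          _ = _ := by ring
    _ = 3 ^ s * N * W := by
        rw [integral_const_mul, hW]
        congr 1
        exact integral_sub_left_eq_self (fun u : ℝ × ℝ => (1 + ‖u‖ ^ 2) ^ (-s)) volume z

theorem norm_sq_le_euclidean (z : ℝ × ℝ) : ‖z‖ ^ 2 ≤ z.1 ^ 2 + z.2 ^ 2 := by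
  rw [Prod.norm_def]
  rcases max_cases ‖z.1‖ ‖z.2‖ with ⟨h, _⟩ | ⟨h, _⟩
  · rw [h, Real.norm_eq_abs, sq_abs]; nlinarith [sq_nonneg z.2]
  · rw [h, Real.norm_eq_abs, sq_abs]; nlinarith [sq_nonneg z.1]

theorem PolynomialDecay.exists_le {g : ℝ × ℝ → ℝ} (hg : PolynomialDecay g) :
    ∃ C s : ℝ, 0 ≤ C ∧ 1 < s ∧ ∀ z, g z ≤ C * (1 + ‖z‖ ^ 2) ^ (-s) := by
  obtain ⟨C, s, hs, h⟩ := hg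
  refine ⟨max C 0, s, le_max_right _ _, hs, fun z => (le_abs_self _).trans ((h z).trans ?_)⟩
  have h1 : (1 + (z.1 ^ 2 + z.2 ^ 2)) ^ (-s) ≤ (1 + ‖z‖ ^ 2) ^ (-s) :=
    Real.rpow_le_rpow_of_nonpos (by positivity) (by linarith [norm_sq_le_euclidean z])
      (by linarith)
  calc _ ≤ max C 0 * (1 + (z.1 ^ 2 + z.2 ^ 2)) ^ (-s) := by
        gcongr
        exact le_max_left _ _
    _ ≤ _ := by gcongr

theorem abs_symp_le (ζ z : ℝ × ℝ) : |symp ζ z| ≤ 2 * ‖ζ‖ * ‖z‖ := by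
  have h1 : |ζ.2 * z.1| ≤ ‖ζ‖ * ‖z‖ := by
    rw [abs_mul]
    exact mul_le_mul (norm_snd_le ζ) (norm_fst_le z) (abs_nonneg _) (norm_nonneg _)
  have h2 : |ζ.1 * z.2| ≤ ‖ζ‖ * ‖z‖ := by
    rw [abs_mul]
    exact mul_le_mul (norm_fst_le ζ) (norm_snd_le z) (abs_nonneg _) (norm_nonneg _)
  have := abs_sub (ζ.2 * z.1) (ζ.1 * z.2)
  rw [symp]
  linarith

/-- The Lipschitz bound serves for |a| ≤ 1 and the trivial bound 2 otherwise. A small θ limits the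
growth in z that the symbols have to compensate. -/
theorem norm_phase_sub_one_le_rpow {θ : ℝ} (h0 : 0 < θ) (h1 : θ ≤ 1) (a : ℝ) :
    ‖phase a - 1‖ ≤ 2 * Real.pi * |a| ^ θ := by
  have hpi := Real.pi_gt_three
  rcases le_total |a| 1 with h | h
  · refine (norm_phase_sub_one_le a).trans ?_
    gcongr
    rcases eq_or_lt_of_le (abs_nonneg a) with h3 | h3
    · rw [← h3]; positivity
    · have := Real.rpow_le_rpow_of_exponent_ge h3 h h1
      rwa [Real.rpow_one] at this
  · have h2 : ‖phase a - 1‖ ≤ 2 := (norm_sub_le _ _).trans (by rw [norm_phase, norm_one]; norm_num)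
    have h3 : 1 ≤ |a| ^ θ := Real.one_le_rpow h h0.le
    nlinarith

/-- Well-spread symbols are concentrated near their points, uniformly: the oscillating factors
`phase (symp ζ (z - p j))` are uniformly close to `1` in the mean as `ζ → 0`. -/
theorem exists_sum_mul_phase_le [Countable ι] (hp : RelativelySeparated p)
    {η : ι → ℝ × ℝ → ℝ} (hη0 : ∀ j, ∀ᵐ z, 0 ≤ η j z) {g : ℝ × ℝ → ℝ} (hg : PolynomialDecay g)
    (hle : ∀ j, ∀ᵐ z, |η j z| ≤ g (z - p j)) :
    ∃ C θ : ℝ, 0 < θ ∧ 0 ≤ C ∧ ∀ᵐ z, ∀ (ζ : ℝ × ℝ) (F : Finset ι),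
      ∑ j ∈ F, η j z * ‖phase (symp ζ (z - p j)) - 1‖ ≤ C * ‖ζ‖ ^ θ := by
  obtain ⟨C, s, hC, hs, hgC⟩ := hg.exists_le
  -- The factor ‖z - p j‖^θ costs θ/2 in the decay exponent, and s - θ/2 ≥ (s + 1)/2 is still larger
  -- than 1.
  set θ := min 1 (s - 1) with hθ
  have hθ0 : 0 < θ := lt_min one_pos (by linarith)
  have hθ1 : θ ≤ 1 := min_le_left _ _
  have hθs : θ ≤ s - 1 := min_le_right _ _
  obtain ⟨M, hM0, hM⟩ := hp.exists_sum_le (s := s - θ / 2) (by linarith)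
  refine ⟨C * (2 * Real.pi * 2 ^ θ) * M, θ, hθ0, by positivity, ?_⟩
  filter_upwards [ae_all_iff.mpr hη0, ae_all_iff.mpr hle] with z h0 h1 ζ F
  have hterm : ∀ j, η j z * ‖phase (symp ζ (z - p j)) - 1‖
      ≤ (C * (2 * Real.pi * 2 ^ θ) * ‖ζ‖ ^ θ) * (1 + ‖z - p j‖ ^ 2) ^ (-(s - θ / 2)) := by
    intro j
    set u := z - p j
    have e1 : η j z ≤ C * (1 + ‖u‖ ^ 2) ^ (-s) := ((le_abs_self _).trans (h1 j)).trans (hgC _)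
    have e2 : ‖phase (symp ζ u) - 1‖ ≤ 2 * Real.pi * (2 ^ θ * ‖ζ‖ ^ θ * ‖u‖ ^ θ) := by
      refine (norm_phase_sub_one_le_rpow hθ0 hθ1 _).trans ?_
      gcongr
      rw [← Real.mul_rpow (by norm_num) (norm_nonneg _),
        ← Real.mul_rpow (by positivity) (norm_nonneg _)]
      exact Real.rpow_le_rpow (abs_nonneg _) (abs_symp_le ζ u) hθ0.le
    have e3 : ‖u‖ ^ θ ≤ (1 + ‖u‖ ^ 2) ^ (θ / 2) := by
      have : ‖u‖ ^ θ = (‖u‖ ^ 2) ^ (θ / 2) := by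
        rw [← Real.rpow_natCast, ← Real.rpow_mul (norm_nonneg _)]
        congr 1
        push_cast
        ring
      rw [this]
      exact Real.rpow_le_rpow (by positivity) (by linarith) (by positivity)
    have e4 : (1 + ‖u‖ ^ 2) ^ (-(s - θ / 2)) = (1 + ‖u‖ ^ 2) ^ (-s) * (1 + ‖u‖ ^ 2) ^ (θ / 2) := by
      rw [← Real.rpow_add (by positivity)]
      congr 1
      ring
    calc _ ≤ C * (1 + ‖u‖ ^ 2) ^ (-s) * (2 * Real.pi * (2 ^ θ * ‖ζ‖ ^ θ * ‖u‖ ^ θ)) :=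
          mul_le_mul e1 e2 (norm_nonneg _) (by positivity)
      _ ≤ C * (1 + ‖u‖ ^ 2) ^ (-s)
          * (2 * Real.pi * (2 ^ θ * ‖ζ‖ ^ θ * (1 + ‖u‖ ^ 2) ^ (θ / 2))) := by gcongr
      _ = _ := by rw [e4]; ring
  calc _ ≤ ∑ j ∈ F, (C * (2 * Real.pi * 2 ^ θ) * ‖ζ‖ ^ θ)
        * (1 + ‖z - p j‖ ^ 2) ^ (-(s - θ / 2)) := Finset.sum_le_sum fun j _ => hterm j
    _ = (C * (2 * Real.pi * 2 ^ θ) * ‖ζ‖ ^ θ)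
        * ∑ j ∈ F, (1 + ‖z - p j‖ ^ 2) ^ (-(s - θ / 2)) := by rw [Finset.mul_sum]
    _ ≤ (C * (2 * Real.pi * 2 ^ θ) * ‖ζ‖ ^ θ) * M :=
        mul_le_mul_of_nonneg_left (hM z F) (by positivity)
    _ = _ := by ring

end Separated

/-! ### Upper form bounds for finitely many windows. -/

section Families

open Filter

variable {ι : Type*} {η : ι → ℝ × ℝ → ℝ} {b : ℝ}

/-- A majorant U independent of j lets Σ η_j ≤ b act pointwise. With finitely many windows, U can be
the sum over all of them. -/
theorem sum_integral_mul_le (hη0 : ∀ j, ∀ᵐ z, 0 ≤ η j z)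
    (F : Finset ι) (hb : ∀ᵐ z, ∑ j ∈ F, η j z ≤ b) {u : ι → ℝ × ℝ → ℝ} {U : ℝ × ℝ → ℝ}
    (hu : ∀ j z, u j z ≤ U z) (hU : Integrable U) (hU0 : ∀ z, 0 ≤ U z)
    (hint : ∀ j ∈ F, Integrable fun z => η j z * u j z) :
    ∑ j ∈ F, ∫ z, η j z * u j z ≤ b * ∫ z, U z := by
  have h0 : ∀ᵐ z, ∀ j ∈ F, 0 ≤ η j z := (ae_ball_iff F.countable_toSet).mpr fun j _ => hη0 j
  rw [← integral_finsetSum F hint, ← integral_const_mul]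
  refine integral_mono_ae (integrable_finsetSum F hint) (hU.const_mul b) ?_
  filter_upwards [h0, hb] with z hz hbz
  calc ∑ j ∈ F, η j z * u j z ≤ ∑ j ∈ F, η j z * U z :=
        Finset.sum_le_sum fun j hj => mul_le_mul_of_nonneg_left (hu j z) (hz j hj)
    _ = (∑ j ∈ F, η j z) * U z := by rw [Finset.sum_mul]
    _ ≤ b * U z := mul_le_mul_of_nonneg_right hbz (hU0 z)

theorem integrable_mul_of_bounded {m u : ℝ × ℝ → ℝ} (hm : Integrable m)
    (hu : Continuous u) {C : ℝ} (hC : ∀ z, |u z| ≤ C) : Integrable fun z => m z * u z :=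
  hm.mul_bdd (c := C) hu.aestronglyMeasurable (Eventually.of_forall hC)

variable {K : Type*} [Fintype K] (φ : K → L2R) (k : ι → K)

theorem sum_form_le (hη : ∀ j, Integrable (η j)) (hη0 : ∀ j, ∀ᵐ z, 0 ≤ η j z)
    (F : Finset ι) (hb : ∀ᵐ z, ∑ j ∈ F, η j z ≤ b) (hφ : ∀ l, ‖φ l‖ = 1) (f : L2R) :
    ∑ j ∈ F, ∫ z, η j z * ‖stft (φ (k j)) f z‖ ^ 2 ≤ b * (Fintype.card K * ‖f‖ ^ 2) := by
  have h := sum_integral_mul_le hη0 F hb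
    (u := fun j z => ‖stft (φ (k j)) f z‖ ^ 2) (U := fun z => ∑ l, ‖stft (φ l) f z‖ ^ 2)
    (fun j z => Finset.single_le_sum (f := fun l => ‖stft (φ l) f z‖ ^ 2)
      (fun l _ => sq_nonneg _) (Finset.mem_univ (k j)))
    (integrable_finsetSum _ fun l _ => integrable_norm_stft_sq (φ l) f)
    (fun z => Finset.sum_nonneg fun l _ => sq_nonneg _)
    (fun j _ => integrable_mul_of_bounded (hη j) (by have := continuous_stft (φ (k j)) f; fun_prop)
      (C := ‖f‖ ^ 2) fun z => by
        rw [abs_of_nonneg (sq_nonneg _)]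
        exact pow_le_pow_left₀ (norm_nonneg _)
          ((norm_stft_le _ _ _).trans (by rw [hφ, one_mul])) 2)
  refine h.trans (le_of_eq ?_)
  rw [integral_finsetSum _ fun l _ => integrable_norm_stft_sq (φ l) f]
  simp [integral_norm_stft_sq, hφ]

theorem re_inner_locOpL {m : ℝ × ℝ → ℝ} (ψ : L2R) (hm : Integrable m) (f : L2R) :
    RCLike.re (inner ℂ (locOpL m ψ f) f) = ∫ z, m z * ‖stft ψ f z‖ ^ 2 := by
  rw [locOpL_apply ψ hm, inner_locOp_self ψ hm, RCLike.re_to_complex, Complex.ofReal_re]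

theorem sum_re_inner_locOpL_le (hη : ∀ j, Integrable (η j)) (hη0 : ∀ j, ∀ᵐ z, 0 ≤ η j z)
    (hb : ∀ᵐ z, ∀ F : Finset ι, ∑ j ∈ F, η j z ≤ b) (hφ : ∀ l, ‖φ l‖ = 1) (f : L2R)
    (F : Finset ι) :
    ∑ j ∈ F, RCLike.re (inner ℂ (locOpL (η j) (φ (k j)) f) f)
      ≤ (b * Fintype.card K) * ‖f‖ ^ 2 := by
  simp only [re_inner_locOpL _ (hη _)]
  rw [mul_assoc]
  exact sum_form_le φ k hη hη0 F (hb.mono fun z h => h F) hφ f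

end Families

/-! ### Gaussian symbols as averages of time-frequency shifts. -/

section GaussianAverages

open Filter

/-- The normalized Gaussian on the plane. -/
def gaussianWeight (u : ℝ × ℝ) : ℝ := Real.exp (-Real.pi * u.1 ^ 2) * Real.exp (-Real.pi * u.2 ^ 2)

theorem gaussianWeight_pos (u : ℝ × ℝ) : 0 < gaussianWeight u := by
  unfold gaussianWeight; positivity

@[fun_prop]
theorem continuous_gaussianWeight : Continuous gaussianWeight := by
  unfold gaussianWeight; fun_prop

theorem integrable_gaussianWeight : Integrable gaussianWeight :=
  (integrable_exp_neg_mul_sq Real.pi_pos).mul_prod (integrable_exp_neg_mul_sq Real.pi_pos)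

theorem integral_gaussian_mul_phase (a : ℝ) :
    ∫ t : ℝ, (Real.exp (-Real.pi * t ^ 2) : ℂ) * phase (t * a)
      = (Real.exp (-Real.pi * a ^ 2) : ℂ) := by
  have h := congrFun (fourier_gaussian_pi (b := 1) (by simp)) (-a)
  rw [Real.fourier_real_eq_integral_exp_smul] at h
  convert! h using 1
  · congr 1
    funext t
    rw [phase, smul_eq_mul, mul_comm]
    congr 1
    · congr 2
      congr 1
      ring
    · push_cast; congr 1; ring
  · simp

/-- The Gaussian is its own Fourier transform in each variable; the symplectic form merely exchanges
the two. -/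
theorem integral_gaussianWeight_mul_phase (v : ℝ × ℝ) (r : ℝ) :
    ∫ u : ℝ × ℝ, (gaussianWeight u : ℂ) * phase (symp (r • u) v) = (gaussianWeight (r • v) : ℂ) := by
  have h : ∀ u : ℝ × ℝ, (gaussianWeight u : ℂ) * phase (symp (r • u) v)
      = ((Real.exp (-Real.pi * u.1 ^ 2) : ℂ) * phase (u.1 * (-(r * v.2))))
        * ((Real.exp (-Real.pi * u.2 ^ 2) : ℂ) * phase (u.2 * (r * v.1))) := by
    intro u
    have e : symp (r • u) v = u.1 * (-(r * v.2)) + u.2 * (r * v.1) := by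
      simp only [symp, Prod.smul_fst, Prod.smul_snd, smul_eq_mul]
      ring
    rw [e, phase_add, gaussianWeight]
    push_cast
    ring
  simp_rw [h]
  rw [Measure.volume_eq_prod, integral_prod_mul
    (fun t : ℝ => (Real.exp (-Real.pi * t ^ 2) : ℂ) * phase (t * (-(r * v.2))))
    (fun t : ℝ => (Real.exp (-Real.pi * t ^ 2) : ℂ) * phase (t * (r * v.1))),
    integral_gaussian_mul_phase, integral_gaussian_mul_phase, gaussianWeight, neg_sq, mul_comm,
    Prod.smul_fst, Prod.smul_snd, smul_eq_mul, smul_eq_mul, Complex.ofReal_mul]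

theorem integral_gaussianWeight : ∫ u, gaussianWeight u = 1 := by
  have h := integral_gaussianWeight_mul_phase 0 0
  have e : ∀ u : ℝ × ℝ, symp ((0 : ℝ) • u) 0 = 0 := fun u => by simp [symp]
  simp only [e, phase_zero, mul_one, integral_complex_ofReal] at h
  rw [Complex.ofReal_injective h]
  simp [gaussianWeight]

theorem exists_gaussianWeight_le {r : ℝ} (hr : 0 < r) :
    ∃ C : ℝ, 0 ≤ C ∧ ∀ u : ℝ × ℝ, gaussianWeight (r • u) ≤ C * (1 + ‖u‖ ^ 2) ^ (-(2 : ℝ)) := by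
  set c := Real.pi * r ^ 2 with hc
  have hc0 : 0 < c := by positivity
  -- Chosen so that 1 + x ≤ M exp(c x / 2) for x ≥ 0; squaring this gives decay of order 2.
  set M := max 1 (2 / c) with hM
  have hM1 : 1 ≤ M := le_max_left _ _
  have hM2 : 2 ≤ M * c := by
    have := le_max_right 1 (2 / c)
    rwa [← hM, div_le_iff₀ hc0] at this
  refine ⟨M ^ 2, by positivity, fun u => ?_⟩
  have h1 : gaussianWeight (r • u) ≤ Real.exp (-c * ‖u‖ ^ 2) := by
    rw [gaussianWeight, ← Real.exp_add]
    refine Real.exp_le_exp.mpr ?_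
    have := mul_le_mul_of_nonneg_left (norm_sq_le_euclidean u) hc0.le
    simp only [Prod.smul_fst, Prod.smul_snd, smul_eq_mul]
    rw [hc] at this ⊢
    linarith
  refine h1.trans ?_
  rw [Real.rpow_neg (by positivity), ← div_eq_mul_inv, le_div_iff₀ (by positivity), Real.rpow_two]
  have h2 : 1 + ‖u‖ ^ 2 ≤ M * Real.exp (c * ‖u‖ ^ 2 / 2) := by
    have := Real.add_one_le_exp (c * ‖u‖ ^ 2 / 2)
    have h3 := mul_le_mul_of_nonneg_left this (by positivity : 0 ≤ M)
    nlinarith [sq_nonneg ‖u‖]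
  calc Real.exp (-c * ‖u‖ ^ 2) * (1 + ‖u‖ ^ 2) ^ 2
      ≤ Real.exp (-c * ‖u‖ ^ 2) * (M * Real.exp (c * ‖u‖ ^ 2 / 2)) ^ 2 := by gcongr
    _ = M ^ 2 * (Real.exp (-c * ‖u‖ ^ 2) * Real.exp (c * ‖u‖ ^ 2 / 2) ^ 2) := by ring
    _ = M ^ 2 := by
        rw [← Real.exp_nat_mul, ← Real.exp_add]
        rw [show -c * ‖u‖ ^ 2 + ((2 : ℕ) : ℝ) * (c * ‖u‖ ^ 2 / 2) = 0 by push_cast; ring,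
          Real.exp_zero, mul_one]

/-- Gaussian symbol at `a` with scale `1 / r`. -/
def gaussianSymbol (r : ℝ) (a z : ℝ × ℝ) : ℝ := gaussianWeight (r • (z - a))

theorem integrable_gaussianSymbol {r : ℝ} (hr : 0 < r) (a : ℝ × ℝ) :
    Integrable (gaussianSymbol r a) := by
  have h := integrable_gaussianWeight.comp_smul hr.ne'
  exact h.comp_sub_right a

/-- A localization operator with Gaussian symbol is an average of time-frequency shifts. -/
theorem inner_locOp_gaussianSymbol {r : ℝ} (hr : 0 < r) (a : ℝ × ℝ) (g h f : L2R) :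
    inner ℂ h (locOp (gaussianSymbol r a) g f)
      = ∫ u, (gaussianWeight u : ℂ) * (phase (symp (r • u) (-a)) *
        (inner ℂ h (tfShift (r • u) f) * inner ℂ (tfShift (r • u) g) g)) := by
  rw [inner_locOp g (integrable_gaussianSymbol hr a)]
  -- The symbol is expanded as a symplectic Fourier integral. After Fubini, covariance absorbs the
  -- z-dependent phase into shifts of g and f, and Moyal's formula evaluates the z-integral.
  have h1 : ∀ z, ((gaussianSymbol r a z : ℝ) : ℂ) * (stft g f z * conj (stft g h z))
      = ∫ u, (gaussianWeight u : ℂ) * phase (symp (r • u) (z - a))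
        * (stft g f z * conj (stft g h z)) := by
    intro z
    rw [integral_mul_const, integral_gaussianWeight_mul_phase, gaussianSymbol]
  simp_rw [h1]
  rw [integral_integral_swap]
  · congr 1
    funext u
    rw [← integral_stft_mul_conj, ← integral_const_mul, ← integral_const_mul]
    congr 1
    funext z
    rw [stft_tfShift_tfShift]
    have : symp (r • u) (z - a) = symp (r • u) (-a) + symp (r • u) z := by
      simp only [symp, Prod.fst_sub, Prod.snd_sub, Prod.fst_neg, Prod.snd_neg]
      ring
    rw [this, phase_add]
    ring
  · have hG : Integrable fun u => (gaussianWeight u : ℂ) := integrable_gaussianWeight.ofReal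
    have hprod := (integrable_stft_mul_conj g f g h).mul_prod hG
    have hc : Continuous fun q : (ℝ × ℝ) × (ℝ × ℝ) => phase (symp (r • q.2) (q.1 - a)) := by
      unfold symp; fun_prop
    refine (hprod.bdd_mul hc.aestronglyMeasurable (c := 1)
      (Eventually.of_forall fun q => by rw [norm_phase])).congr (Eventually.of_forall fun q => ?_)
    simp only [Function.uncurry]
    ring

end GaussianAverages

/-! ### Lower form bound and the error of twisting by a shift. -/

section LowerBound

open Filter Topology

variable {ι K : Type*} [Fintype K] {p : ι → ℝ × ℝ} {η : ι → ℝ × ℝ → ℝ} {a b : ℝ}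
  {φ : K → L2R} (k : ι → K)

theorem integrable_mul_norm_stft_mul {m : ℝ × ℝ → ℝ} (hm : Integrable m) (φ f ψ g : L2R) :
    Integrable fun z => m z * (‖stft φ f z‖ * ‖stft ψ g z‖) := by
  have h1 := continuous_stft φ f
  have h2 := continuous_stft ψ g
  refine integrable_mul_of_bounded hm (by fun_prop) (C := (‖φ‖ * ‖f‖) * (‖ψ‖ * ‖g‖)) fun z => ?_
  rw [abs_of_nonneg (by positivity)]
  exact mul_le_mul (norm_stft_le _ _ _) (norm_stft_le _ _ _) (norm_nonneg _) (by positivity)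

theorem integrable_mul_norm_stft_sq {m : ℝ × ℝ → ℝ} (hm : Integrable m) (φ f : L2R) :
    Integrable fun z => m z * ‖stft φ f z‖ ^ 2 := by
  simp only [sq]
  exact integrable_mul_norm_stft_mul hm φ f φ f

/-- Pointwise, |V_{φ_k} f|² ≥ |V_{φ_{l₀}} f|²/2 - Σ_l |V_{φ_l - φ_{l₀}} f|², a minorant independent
of j, and Moyal's formula integrates it. -/
theorem exists_form_lower_bound [Countable ι] (hη : ∀ j, Integrable (η j))
    (hη0 : ∀ j, ∀ᵐ z, 0 ≤ η j z) (ha : 0 < a)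
    (hab : ∀ᵐ z : ℝ × ℝ, Summable (fun j => η j z) ∧ a ≤ ∑' j, η j z ∧ ∑' j, η j z ≤ b)
    {l₀ : K} (h₀ : ‖φ l₀‖ = 1) (f : L2R) (hs : Summable fun j => ∫ z, η j z * ‖stft (φ (k j)) f z‖ ^ 2) :
    a * (1 / 2 - ∑ l, ‖φ l - φ l₀‖ ^ 2) * ‖f‖ ^ 2
      ≤ ∑' j, ∫ z, η j z * ‖stft (φ (k j)) f z‖ ^ 2 := by
  have hη0' := ae_all_iff.mpr hη0
  let y : ℝ × ℝ → ℝ := fun z =>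
    ‖stft (φ l₀) f z‖ ^ 2 / 2 - ∑ l, ‖stft (φ l - φ l₀ : L2R) f z‖ ^ 2
  have hyint : Integrable y := ((integrable_norm_stft_sq _ _).div_const 2).sub
    (integrable_finsetSum _ fun l _ => integrable_norm_stft_sq _ _)
  have hyval : ∫ z, y z = (1 / 2 - ∑ l, ‖φ l - φ l₀‖ ^ 2) * ‖f‖ ^ 2 := by
    simp only [y]
    rw [integral_sub ((integrable_norm_stft_sq _ _).div_const 2)
      (integrable_finsetSum _ fun l _ => integrable_norm_stft_sq _ _),
      integral_finsetSum _ fun l _ => integrable_norm_stft_sq _ _, integral_div,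
      integral_norm_stft_sq, h₀, sub_mul, Finset.sum_mul]
    simp only [integral_norm_stft_sq]
    ring
  -- The positive part is needed because a ≤ Σ η_j may be multiplied only by a non-negative
  -- function.
  have hyle : ∀ j z, max (y z) 0 ≤ ‖stft (φ (k j)) f z‖ ^ 2 := by
    intro j z
    refine max_le ?_ (sq_nonneg _)
    have h1 : ‖stft (φ (k j) - φ l₀ : L2R) f z‖ ^ 2
        ≤ ∑ l, ‖stft (φ l - φ l₀ : L2R) f z‖ ^ 2 :=
      Finset.single_le_sum (f := fun l => ‖stft (φ l - φ l₀ : L2R) f z‖ ^ 2)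
        (fun l _ => sq_nonneg _) (Finset.mem_univ (k j))
    have h2 : ‖stft (φ l₀) f z‖ ≤ ‖stft (φ (k j)) f z‖ + ‖stft (φ (k j) - φ l₀ : L2R) f z‖ := by
      rw [stft_sub_left]
      have := norm_sub_le (stft (φ (k j)) f z) (stft (φ (k j)) f z - stft (φ l₀) f z)
      rwa [sub_sub_cancel] at this
    have h3 := pow_le_pow_left₀ (norm_nonneg _) h2 2
    simp only [y]
    nlinarith [sq_nonneg (‖stft (φ (k j)) f z‖ - ‖stft (φ (k j) - φ l₀ : L2R) f z‖)]
  have hmp : Integrable fun z => max (y z) 0 := hyint.pos_part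
  have htend : ∀ᵐ z, Tendsto (fun F : Finset ι => (∑ j ∈ F, η j z) * max (y z) 0) atTop
      (𝓝 ((∑' j, η j z) * max (y z) 0)) := by
    filter_upwards [hab] with z hz
    exact hz.1.hasSum.mul_const _
  have hmeas : ∀ F : Finset ι, AEStronglyMeasurable
      (fun z => (∑ j ∈ F, η j z) * max (y z) 0) volume := fun F =>
    (integrable_finsetSum F fun j _ => hη j).1.mul hmp.1
  have hbound : ∀ F : Finset ι, ∀ᵐ z, ‖(∑ j ∈ F, η j z) * max (y z) 0‖ ≤ b * max (y z) 0 := by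
    intro F
    filter_upwards [hab, hη0'] with z hz h0
    have hF0 : 0 ≤ ∑ j ∈ F, η j z := Finset.sum_nonneg fun j _ => h0 j
    have hm0 : 0 ≤ max (y z) 0 := le_max_right _ _
    rw [Real.norm_eq_abs, abs_of_nonneg (by positivity)]
    gcongr
    exact (hz.1.sum_le_tsum F fun j _ => h0 j).trans hz.2.2
  have hlim := tendsto_integral_filter_of_dominated_convergence (fun z => b * max (y z) 0)
    (Eventually.of_forall hmeas) (Eventually.of_forall hbound) (hmp.const_mul b) htend
  have hmeasT : AEStronglyMeasurable (fun z => (∑' j, η j z) * max (y z) 0) volume :=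
    aestronglyMeasurable_of_tendsto_ae atTop hmeas htend
  have hintT : Integrable fun z => (∑' j, η j z) * max (y z) 0 := by
    refine (hmp.const_mul b).mono' hmeasT ?_
    filter_upwards [hab, hη0'] with z hz h0
    have hm0 : 0 ≤ max (y z) 0 := le_max_right _ _
    have hT0 : 0 ≤ ∑' j, η j z := tsum_nonneg h0
    rw [Real.norm_eq_abs, abs_of_nonneg (by positivity)]
    gcongr
    exact hz.2.2
  have h1 : a * ∫ z, y z ≤ ∫ z, (∑' j, η j z) * max (y z) 0 := by
    rw [← integral_const_mul]
    refine integral_mono_ae (hyint.const_mul a) hintT ?_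
    filter_upwards [hab] with z hz
    calc a * y z ≤ a * max (y z) 0 := by gcongr; exact le_max_left _ _
      _ ≤ _ := mul_le_mul_of_nonneg_right hz.2.1 (le_max_right _ _)
  rw [hyval, ← mul_assoc] at h1
  refine h1.trans (le_of_tendsto hlim (Eventually.of_forall fun F => ?_))
  have hjint : ∀ j, Integrable fun z => η j z * ‖stft (φ (k j)) f z‖ ^ 2 := fun j =>
    integrable_mul_norm_stft_sq (hη j) _ _
  have hj0 : ∀ j, 0 ≤ ∫ z, η j z * ‖stft (φ (k j)) f z‖ ^ 2 := fun j =>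
    integral_nonneg_of_ae ((hη0 j).mono fun z hz => mul_nonneg hz (sq_nonneg _))
  refine le_trans ?_ (hs.sum_le_tsum F fun j _ => hj0 j)
  rw [← integral_finsetSum F fun j _ => hjint j]
  have hi : Integrable fun z => (∑ j ∈ F, η j z) * max (y z) 0 :=
    (hmp.const_mul b).mono' (hmeas F) (hbound F)
  refine integral_mono_ae hi (integrable_finsetSum F fun j _ => hjint j) ?_
  filter_upwards [hη0'] with z h0
  rw [Finset.sum_mul]
  exact Finset.sum_le_sum fun j _ => mul_le_mul_of_nonneg_left (hyle j z) (h0 j)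

/-- Modulus of continuity at `ζ = 0` of the twisted quadratic forms. -/
def twistError (φ : K → L2R) (l₀ : K) (b C θ : ℝ) (ζ : ℝ × ℝ) : ℝ :=
  b * Fintype.card K * ‖inner ℂ (tfShift ζ (φ l₀)) (φ l₀) - 1‖
    + Fintype.card K * min (2 * b) (C * ‖ζ‖ ^ θ) + b * ∑ l, ‖φ l - tfShift ζ (φ l)‖

/-- Writing ψ = π(ζ)ψ + (ψ - π(ζ)ψ) in the STFT of π(ζ)f, covariance yields a character times V_ψ f
plus a remainder. The phase at -q recentres the character at q. The three error terms come from c ≠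
1, from the recentred character, and from the moved window. -/
theorem norm_inner_sub_twisted_le {m : ℝ × ℝ → ℝ} (hm : Integrable m) (hm0 : ∀ᵐ z, 0 ≤ m z)
    (ψ f : L2R) (ζ q : ℝ × ℝ) {c : ℂ} (hc : ‖c‖ ≤ 1) :
    ‖inner ℂ (locOp m ψ f) f
        - phase (symp ζ (-q)) * (inner ℂ (locOp m ψ f) (tfShift ζ f) * c)‖
      ≤ ‖c - 1‖ * (∫ z, m z * ‖stft ψ f z‖ ^ 2)
        + (∫ z, (m z * ‖phase (symp ζ (z - q)) - 1‖) * ‖stft ψ f z‖ ^ 2)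
        + ∫ z, m z * (‖stft ψ f z‖ * ‖stft (ψ - tfShift ζ ψ : L2R) (tfShift ζ f) z‖) := by
  have hE : Continuous fun z => phase (symp ζ (z - q)) := by unfold symp; fun_prop
  have hi1 := (integrable_mul_norm_stft_sq hm ψ f).const_mul ‖c - 1‖
  have hi2 : Integrable fun z => (m z * ‖phase (symp ζ (z - q)) - 1‖) * ‖stft ψ f z‖ ^ 2 :=
    integrable_mul_norm_stft_sq (integrable_mul_of_bounded hm (by fun_prop) (C := 2) fun z => by
      rw [abs_norm]
      exact (norm_sub_le _ _).trans (by rw [norm_phase, norm_one]; norm_num)) ψ f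
  have hi3 := integrable_mul_norm_stft_mul hm ψ f (ψ - tfShift ζ ψ) (tfShift ζ f)
  have hform : ∀ g : L2R, Integrable fun z => (m z : ℂ) * (stft ψ g z * conj (stft ψ f z)) := by
    intro g
    refine (integrable_mul_norm_stft_mul hm ψ g ψ f).mono ?_ (Eventually.of_forall fun z => ?_)
    · exact (Complex.continuous_ofReal.comp_aestronglyMeasurable hm.1).mul
        (integrable_stft_mul_conj ψ g ψ f).1
    · simp
  have hi12 : Integrable fun z => ‖c - 1‖ * (m z * ‖stft ψ f z‖ ^ 2)
      + (m z * ‖phase (symp ζ (z - q)) - 1‖) * ‖stft ψ f z‖ ^ 2 := hi1.add hi2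
  rw [inner_locOp_left ψ hm, inner_locOp_left ψ hm, ← integral_mul_const, ← integral_const_mul,
    ← integral_sub (hform f) (((hform _).mul_const _).const_mul _), ← integral_const_mul,
    ← integral_add hi1 hi2, ← integral_add hi12 hi3]
  refine norm_integral_le_of_norm_le (hi12.add hi3) ?_
  filter_upwards [hm0] with z hz
  set V := stft ψ f z
  set W := stft (ψ - tfShift ζ ψ : L2R) (tfShift ζ f) z with hW
  have hV : stft ψ (tfShift ζ f) z = phase (symp ζ z) * V + W := by
    rw [hW, stft_sub_left, stft_tfShift_tfShift]
    ring
  have hph : phase (symp ζ (z - q)) = phase (symp ζ (-q)) * phase (symp ζ z) := by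
    rw [← phase_add]
    congr 1
    simp only [symp, Prod.fst_sub, Prod.snd_sub, Prod.fst_neg, Prod.snd_neg]
    ring
  rw [hV]
  set P := phase (symp ζ (-q)) with hP
  set E := phase (symp ζ (z - q))
  have hPn : ‖P‖ = 1 := norm_phase _
  have e : (m z : ℂ) * (V * conj V) - P * ((m z : ℂ) * ((phase (symp ζ z) * V + W) * conj V) * c)
      = -((m z : ℂ) * (conj V * (((c - 1) + c * (E - 1)) * V + c * P * W))) := by
    rw [hph]; ring
  rw [e, norm_neg, norm_mul, norm_mul, Complex.norm_real, RCLike.norm_conj, Real.norm_eq_abs,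
    abs_of_nonneg hz]
  have h1 : ‖((c - 1) + c * (E - 1)) * V + c * P * W‖ ≤ (‖c - 1‖ + ‖E - 1‖) * ‖V‖ + ‖W‖ := by
    refine (norm_add_le _ _).trans (add_le_add ?_ ?_)
    · rw [norm_mul]
      gcongr
      refine (norm_add_le _ _).trans (add_le_add le_rfl ?_)
      rw [norm_mul]
      exact mul_le_of_le_one_left (norm_nonneg _) hc
    · rw [norm_mul, norm_mul, hPn, mul_one]
      exact mul_le_of_le_one_left (norm_nonneg _) hc
  calc m z * (‖V‖ * ‖((c - 1) + c * (E - 1)) * V + c * P * W‖)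
      ≤ m z * (‖V‖ * ((‖c - 1‖ + ‖E - 1‖) * ‖V‖ + ‖W‖)) := by gcongr
    _ = _ := by ring

theorem sum_norm_inner_sub_twisted_le (hη : ∀ j, Integrable (η j))
    (hη0 : ∀ j, ∀ᵐ z, 0 ≤ η j z) (hb : ∀ᵐ z, ∀ F : Finset ι, ∑ j ∈ F, η j z ≤ b)
    {C θ : ℝ} (hC : ∀ᵐ z, ∀ (ζ : ℝ × ℝ) (F : Finset ι),
      ∑ j ∈ F, η j z * ‖phase (symp ζ (z - p j)) - 1‖ ≤ C * ‖ζ‖ ^ θ)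
    (hφ : ∀ l, ‖φ l‖ = 1) (l₀ : K) (f : L2R) (ζ : ℝ × ℝ) (F : Finset ι) :
    ∑ j ∈ F, ‖inner ℂ (locOp (η j) (φ (k j)) f) f - phase (symp ζ (-p j))
        * (inner ℂ (locOp (η j) (φ (k j)) f) (tfShift ζ f)
          * inner ℂ (tfShift ζ (φ l₀)) (φ l₀))‖
      ≤ twistError φ l₀ b C θ ζ * ‖f‖ ^ 2 := by
  have hc : ‖inner ℂ (tfShift ζ (φ l₀)) (φ l₀)‖ ≤ 1 :=
    (norm_inner_le_norm _ _).trans (by rw [norm_tfShift, hφ, one_mul])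
  have hE : ∀ q, Continuous fun z => phase (symp ζ (z - q)) := fun q => by unfold symp; fun_prop
  have hEle : ∀ q z, ‖phase (symp ζ (z - q)) - 1‖ ≤ 2 := fun q z =>
    (norm_sub_le _ _).trans (by rw [norm_phase, norm_one]; norm_num)
  have hbF : ∀ᵐ z, ∑ j ∈ F, η j z ≤ b := hb.mono fun z h => h F
  have h0 : ∀ᵐ z, ∀ j ∈ F, 0 ≤ η j z := (ae_ball_iff F.countable_toSet).mpr fun j _ => hη0 j
  have s1 := sum_form_le φ k hη hη0 F hbF hφ f
  have s2 := sum_form_le (η := fun j z => η j z * ‖phase (symp ζ (z - p j)) - 1‖)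
    (b := min (2 * b) (C * ‖ζ‖ ^ θ)) φ k
    (fun j => integrable_mul_of_bounded (hη j) (by have := hE (p j); fun_prop) (C := 2) fun z => by
      rw [abs_norm]; exact hEle _ _)
    (fun j => (hη0 j).mono fun z hz => mul_nonneg hz (norm_nonneg _)) F
    (by
      filter_upwards [hbF, hC, h0] with z h1 h2 h3
      refine le_min ?_ (h2 ζ F)
      calc _ ≤ ∑ j ∈ F, η j z * 2 :=
            Finset.sum_le_sum fun j hj => mul_le_mul_of_nonneg_left (hEle _ _) (h3 j hj)
        _ = 2 * ∑ j ∈ F, η j z := by rw [← Finset.sum_mul, mul_comm]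
        _ ≤ 2 * b := by gcongr) hφ f
  have hVW : ∀ l, Integrable fun z =>
      ‖stft (φ l) f z‖ * ‖stft (φ l - tfShift ζ (φ l) : L2R) (tfShift ζ f) z‖ := fun l => by
    simpa using (integrable_stft_mul_conj (φ l) f (φ l - tfShift ζ (φ l)) (tfShift ζ f)).norm
  have s3 := sum_integral_mul_le hη0 F hbF
    (u := fun j z => ‖stft (φ (k j)) f z‖
      * ‖stft (φ (k j) - tfShift ζ (φ (k j)) : L2R) (tfShift ζ f) z‖)
    (U := fun z => ∑ l, ‖stft (φ l) f z‖
      * ‖stft (φ l - tfShift ζ (φ l) : L2R) (tfShift ζ f) z‖)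
    (fun j z => Finset.single_le_sum (f := fun l => ‖stft (φ l) f z‖
      * ‖stft (φ l - tfShift ζ (φ l) : L2R) (tfShift ζ f) z‖)
      (fun l _ => by positivity) (Finset.mem_univ (k j)))
    (integrable_finsetSum _ fun l _ => hVW l)
    (fun z => Finset.sum_nonneg fun l _ => by positivity)
    (fun j _ => integrable_mul_norm_stft_mul (hη j) _ _ _ _)
  rw [integral_finsetSum _ fun l _ => hVW l] at s3
  have hb0 : 0 ≤ b := by
    obtain ⟨z, hz⟩ := hb.exists
    simpa using hz ∅
  have s4 : ∑ l, ∫ z, ‖stft (φ l) f z‖ * ‖stft (φ l - tfShift ζ (φ l) : L2R) (tfShift ζ f) z‖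
      ≤ ∑ l, ‖φ l - tfShift ζ (φ l)‖ * ‖f‖ ^ 2 := by
    refine Finset.sum_le_sum fun l _ => (integral_norm_stft_mul_norm_stft_le _ _ _ _).trans ?_
    rw [hφ, norm_tfShift]
    exact le_of_eq (by ring)
  rw [← Finset.sum_mul] at s4
  have s5 := Finset.sum_le_sum (s := F) fun j _ =>
    norm_inner_sub_twisted_le (hη j) (hη0 j) (φ (k j)) f ζ (p j) hc
  rw [Finset.sum_add_distrib, Finset.sum_add_distrib, ← Finset.mul_sum] at s5
  refine s5.trans ?_
  have s6 := mul_le_mul_of_nonneg_left s1 (norm_nonneg (inner ℂ (tfShift ζ (φ l₀)) (φ l₀) - 1))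
  have s7 := mul_le_mul_of_nonneg_left s4 hb0
  calc _ ≤ ‖inner ℂ (tfShift ζ (φ l₀)) (φ l₀) - 1‖ * (b * (Fintype.card K * ‖f‖ ^ 2))
        + min (2 * b) (C * ‖ζ‖ ^ θ) * (Fintype.card K * ‖f‖ ^ 2)
        + b * ((∑ l, ‖φ l - tfShift ζ (φ l)‖) * ‖f‖ ^ 2) :=
        add_le_add (add_le_add s6 s2) (s3.trans s7)
    _ = _ := by rw [twistError]; ring

end LowerBound

/-! ### Averaging the twisted forms and the lower bound for norms. -/

section LowerBoundConclusion

open Filter Topology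

variable {ι K : Type*} [Fintype K] {p : ι → ℝ × ℝ} {η : ι → ℝ × ℝ → ℝ} {a b C θ : ℝ}
  {φ : K → L2R}

theorem continuous_twistError (hθ : 0 < θ) (l₀ : K) : Continuous (twistError φ l₀ b C θ) := by
  have h : ∀ l, Continuous fun ζ => tfShift ζ (φ l) := fun l => continuous_tfShift (φ l)
  have h2 : Continuous fun ζ : ℝ × ℝ => ‖ζ‖ ^ θ := continuous_norm.rpow_const fun _ => Or.inr hθ.le
  unfold twistError
  have h3 : Continuous fun ζ => ∑ l, ‖φ l - tfShift ζ (φ l)‖ :=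
    continuous_finsetSum _ fun l _ => (continuous_const.sub (h l)).norm
  have h4 := h l₀
  fun_prop

theorem twistError_zero (hb : 0 ≤ b) (hθ : 0 < θ) (l₀ : K) (h₀ : ‖φ l₀‖ = 1) :
    twistError φ l₀ b C θ 0 = 0 := by
  simp [twistError, tfShift_zero, h₀, Real.zero_rpow hθ.ne', hb]

theorem twistError_nonneg (hb : 0 ≤ b) (hC : 0 ≤ C) (l₀ : K) (ζ : ℝ × ℝ) :
    0 ≤ twistError φ l₀ b C θ ζ := by
  unfold twistError
  have h1 : 0 ≤ ∑ l, ‖φ l - tfShift ζ (φ l)‖ := Finset.sum_nonneg fun l _ => norm_nonneg _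
  have h2 : 0 ≤ min (2 * b) (C * ‖ζ‖ ^ θ) := le_min (by positivity) (by positivity)
  positivity

theorem twistError_le (hb : 0 ≤ b) (hφ : ∀ l, ‖φ l‖ = 1) (l₀ : K) (ζ : ℝ × ℝ) :
    twistError φ l₀ b C θ ζ ≤ b * Fintype.card K * 2 + Fintype.card K * (2 * b)
      + b * (Fintype.card K * 2) := by
  unfold twistError
  have h1 : ‖inner ℂ (tfShift ζ (φ l₀)) (φ l₀) - 1‖ ≤ 2 := by
    have : ‖inner ℂ (tfShift ζ (φ l₀)) (φ l₀)‖ ≤ 1 :=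
      (norm_inner_le_norm _ _).trans (by rw [norm_tfShift, hφ, one_mul])
    refine (norm_sub_le _ _).trans ?_
    rw [norm_one]
    linarith
  have h2 : ∑ l, ‖φ l - tfShift ζ (φ l)‖ ≤ Fintype.card K * 2 := by
    calc _ ≤ ∑ _l : K, (2 : ℝ) := Finset.sum_le_sum fun l _ =>
          (norm_sub_le _ _).trans (by rw [norm_tfShift, hφ]; norm_num)
      _ = _ := by simp
  gcongr
  exact min_le_left _ _

/-- The average depends continuously on r, by dominated convergence, and vanishes at r = 0. The cap
2b inside `twistError` provides the uniform bound. -/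
theorem exists_average_twistError_lt (hb : 0 ≤ b) (hC : 0 ≤ C) (hθ : 0 < θ)
    (hφ : ∀ l, ‖φ l‖ = 1) (l₀ : K) {ε : ℝ} (hε : 0 < ε) :
    ∃ r : ℝ, 0 < r ∧ ∫ u, gaussianWeight u * twistError φ l₀ b C θ (r • u) < ε := by
  have hcont := continuous_twistError (φ := φ) (b := b) (C := C) hθ l₀
  have h : Continuous fun r : ℝ => ∫ u, gaussianWeight u * twistError φ l₀ b C θ (r • u) := by
    refine continuous_of_dominated (bound := fun u => gaussianWeight u *
      (b * Fintype.card K * 2 + Fintype.card K * (2 * b) + b * (Fintype.card K * 2))) ?_ ?_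
      (integrable_gaussianWeight.mul_const _) ?_
    · intro r
      exact (by fun_prop : Continuous fun u => gaussianWeight u
        * twistError φ l₀ b C θ (r • u)).aestronglyMeasurable
    · intro r
      refine Eventually.of_forall fun u => ?_
      rw [Real.norm_eq_abs, abs_of_nonneg
        (mul_nonneg (gaussianWeight_pos u).le (twistError_nonneg hb hC l₀ _))]
      exact mul_le_mul_of_nonneg_left (twistError_le hb hφ l₀ _) (gaussianWeight_pos u).le
    · exact Eventually.of_forall fun u => by fun_prop
  have h0 : ∫ u, gaussianWeight u * twistError φ l₀ b C θ ((0 : ℝ) • u) < ε := by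
    simpa [twistError_zero hb hθ l₀ (hφ l₀)] using hε
  have hev := ((h.tendsto 0).eventually (gt_mem_nhds h0)).filter_mono
    (nhdsWithin_le_nhds (s := Set.Ioi (0 : ℝ)))
  obtain ⟨r, hr, hr0⟩ := (hev.and self_mem_nhdsWithin).exists
  exact ⟨r, hr0, hr⟩

theorem sum_norm_inner_sub_average_le (k : ι → K) (hη : ∀ j, Integrable (η j))
    (hη0 : ∀ j, ∀ᵐ z, 0 ≤ η j z) (hb : ∀ᵐ z, ∀ F : Finset ι, ∑ j ∈ F, η j z ≤ b)
    (hθ : 0 < θ) (hC : ∀ᵐ z, ∀ (ζ : ℝ × ℝ) (F : Finset ι),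
      ∑ j ∈ F, η j z * ‖phase (symp ζ (z - p j)) - 1‖ ≤ C * ‖ζ‖ ^ θ) (hC0 : 0 ≤ C)
    (hφ : ∀ l, ‖φ l‖ = 1) (l₀ : K) {r : ℝ} (hr : 0 < r) (f : L2R) (F : Finset ι) :
    ∑ j ∈ F, ‖inner ℂ (locOp (η j) (φ (k j)) f) f - inner ℂ (locOp (η j) (φ (k j)) f)
        (locOp (gaussianSymbol r (p j)) (φ l₀) f)‖
      ≤ (∫ u, gaussianWeight u * twistError φ l₀ b C θ (r • u)) * ‖f‖ ^ 2 := by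
  have hb0 : 0 ≤ b := by
    obtain ⟨z, hz⟩ := hb.exists
    simpa using hz ∅
  let D : ι → ℝ × ℝ → ℂ := fun j ζ => inner ℂ (locOp (η j) (φ (k j)) f) f
    - phase (symp ζ (-p j)) * (inner ℂ (locOp (η j) (φ (k j)) f) (tfShift ζ f)
      * inner ℂ (tfShift ζ (φ l₀)) (φ l₀))
  have hDc : ∀ j, Continuous (D j) := by
    intro j
    have h1 := continuous_tfShift f
    have h2 := continuous_tfShift (φ l₀)
    have h3 : Continuous fun ζ => phase (symp ζ (-p j)) := by unfold symp; fun_prop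
    fun_prop
  have hDb : ∀ j ζ, ‖D j ζ‖ ≤ ‖locOp (η j) (φ (k j)) f‖ * ‖f‖ + ‖locOp (η j) (φ (k j)) f‖ * ‖f‖ := by
    intro j ζ
    refine (norm_sub_le _ _).trans (add_le_add (norm_inner_le_norm _ _) ?_)
    rw [norm_mul, norm_mul, norm_phase, one_mul]
    have h1 : ‖inner ℂ (locOp (η j) (φ (k j)) f) (tfShift ζ f)‖
        ≤ ‖locOp (η j) (φ (k j)) f‖ * ‖f‖ :=
      (norm_inner_le_norm _ _).trans (by rw [norm_tfShift])
    have h2 : ‖inner ℂ (tfShift ζ (φ l₀)) (φ l₀)‖ ≤ 1 :=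
      (norm_inner_le_norm _ _).trans (by rw [norm_tfShift, hφ, one_mul])
    exact (mul_le_of_le_one_right (norm_nonneg _) h2).trans h1
  have hDint : ∀ j, Integrable fun u : ℝ × ℝ => (gaussianWeight u : ℂ) * D j (r • u) := fun j => by
    have h4 := hDc j
    exact integrable_smul_of_bounded integrable_gaussianWeight (u := fun u => D j (r • u))
      (by fun_prop) fun u => hDb j _
  have hconst : Integrable fun u : ℝ × ℝ => (gaussianWeight u : ℂ) :=
    integrable_gaussianWeight.ofReal
  have heq : ∀ j, inner ℂ (locOp (η j) (φ (k j)) f) f - inner ℂ (locOp (η j) (φ (k j)) f)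
      (locOp (gaussianSymbol r (p j)) (φ l₀) f) = ∫ u, (gaussianWeight u : ℂ) * D j (r • u) := by
    intro j
    have hone : inner ℂ (locOp (η j) (φ (k j)) f) f
        = ∫ u, (gaussianWeight u : ℂ) * inner ℂ (locOp (η j) (φ (k j)) f) f := by
      rw [integral_mul_const, integral_complex_ofReal, integral_gaussianWeight]
      simp
    have h1 := hconst.mul_const (inner ℂ (locOp (η j) (φ (k j)) f) f)
    have h2 := h1.sub (hDint j)
    rw [inner_locOp_gaussianSymbol hr]
    nth_rewrite 1 [hone]
    rw [← integral_sub h1 (h2.congr (Eventually.of_forall fun u => ?_))]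
    · congr 1
      funext u
      simp only [D]
      ring
    · simp only [D, Pi.sub_apply]
      ring
  have hnint : ∀ j, Integrable fun u : ℝ × ℝ => gaussianWeight u * ‖D j (r • u)‖ := fun j => by
    refine (hDint j).norm.congr (Eventually.of_forall fun u => ?_)
    simp only [norm_mul, Complex.norm_real, Real.norm_eq_abs, abs_of_pos (gaussianWeight_pos u)]
  have hTint : Integrable fun u => gaussianWeight u * twistError φ l₀ b C θ (r • u) := by
    have hcont := continuous_twistError (φ := φ) (b := b) (C := C) hθ l₀
    refine integrable_mul_of_bounded integrable_gaussianWeight (by fun_prop)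
      (C := b * Fintype.card K * 2 + Fintype.card K * (2 * b) + b * (Fintype.card K * 2))
      fun u => ?_
    rw [abs_of_nonneg (twistError_nonneg hb0 hC0 l₀ _)]
    exact twistError_le hb0 hφ l₀ _
  calc _ ≤ ∑ j ∈ F, ∫ u, gaussianWeight u * ‖D j (r • u)‖ := by
        refine Finset.sum_le_sum fun j _ => ?_
        rw [heq]
        refine (norm_integral_le_integral_norm _).trans (le_of_eq ?_)
        congr 1
        funext u
        simp only [norm_mul, Complex.norm_real, Real.norm_eq_abs, abs_of_pos (gaussianWeight_pos u)]
    _ = ∫ u, ∑ j ∈ F, gaussianWeight u * ‖D j (r • u)‖ := by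
        rw [integral_finsetSum F fun j _ => hnint j]
    _ ≤ ∫ u, gaussianWeight u * twistError φ l₀ b C θ (r • u) * ‖f‖ ^ 2 := by
        refine integral_mono (integrable_finsetSum F fun j _ => hnint j)
          (hTint.mul_const _) fun u => ?_
        simp only
        rw [← Finset.mul_sum, mul_assoc]
        exact mul_le_mul_of_nonneg_left
          (sum_norm_inner_sub_twisted_le k hη hη0 hb hC hφ l₀ f (r • u) F) (gaussianWeight_pos u).le
    _ = _ := by rw [integral_mul_const]

theorem sum_le_of_sumEquiv [Countable ι] (hη0 : ∀ j, ∀ᵐ z, 0 ≤ η j z)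
    (hab : ∀ᵐ z : ℝ × ℝ, Summable (fun j => η j z) ∧ a ≤ ∑' j, η j z ∧ ∑' j, η j z ≤ b) :
    ∀ᵐ z, ∀ F : Finset ι, ∑ j ∈ F, η j z ≤ b := by
  filter_upwards [hab, ae_all_iff.mpr hη0] with z hz h0 F
  exact (hz.1.sum_le_tsum F fun j _ => h0 j).trans hz.2.2

/-- Lower bound for the square sum of localization operators with finitely many windows
that are close to each other. -/
theorem exists_norm_sq_lower_bound (k : ι → K) (hspread : WellSpread p η)
    (hη0 : ∀ j, ∀ᵐ z, 0 ≤ η j z) (ha : 0 < a)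
    (hab : ∀ᵐ z : ℝ × ℝ, Summable (fun j => η j z) ∧ a ≤ ∑' j, η j z ∧ ∑' j, η j z ≤ b)
    (hφ : ∀ l, ‖φ l‖ = 1) {l₀ : K} (hclose : ∑ l, ‖φ l - φ l₀‖ ^ 2 < 1 / 2) :
    ∃ A : ℝ, 0 < A ∧ ∀ f, A * ‖f‖ ^ 2 ≤ ∑' j, ‖locOpL (η j) (φ (k j)) f‖ ^ 2 := by
  have hcount := hspread.separated.countable
  have hη := hspread.integrable
  obtain ⟨g, -, -, hgdec, hgle⟩ := hspread.envelope
  obtain ⟨C, θ, hθ, hC0, hC⟩ := exists_sum_mul_phase_le hspread.separated hη0 hgdec hgle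
  have hb := sum_le_of_sumEquiv hη0 hab
  have hb0 : 0 ≤ b := by
    obtain ⟨z, hz⟩ := hb.exists
    simpa using hz ∅
  have hpos : ∀ j, (locOpL (η j) (φ (k j))).IsPositive := fun j =>
    isPositive_locOpL _ (hη j) (hη0 j)
  have hform := sum_re_inner_locOpL_le φ k hη hη0 hb hφ
  set κ := a * (1 / 2 - ∑ l, ‖φ l - φ l₀‖ ^ 2) with hκ
  have hκ0 : 0 < κ := mul_pos ha (by linarith)
  obtain ⟨r, hr, hrκ⟩ := exists_average_twistError_lt (φ := φ) (C := C) (θ := θ) hb0 hC0 hθ hφ l₀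
    (half_pos hκ0)
  -- Bessel bound for the Gaussian localization operators
  obtain ⟨C₁, hC₁, hG⟩ := exists_gaussianWeight_le hr
  obtain ⟨C₂, hC₂, hS⟩ := hspread.separated.exists_sum_le (s := 2) (by norm_num)
  have hN0 : 0 ≤ C₁ * C₂ := by positivity
  have hχ : ∀ᵐ z, ∀ F : Finset ι, ∑ j ∈ F, gaussianSymbol r (p j) z ≤ C₁ * C₂ := by
    refine Eventually.of_forall fun z F => ?_
    calc _ ≤ ∑ j ∈ F, C₁ * (1 + ‖z - p j‖ ^ 2) ^ (-(2 : ℝ)) :=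
          Finset.sum_le_sum fun j _ => hG _
      _ = C₁ * ∑ j ∈ F, (1 + ‖z - p j‖ ^ 2) ^ (-(2 : ℝ)) := by rw [Finset.mul_sum]
      _ ≤ _ := mul_le_mul_of_nonneg_left (hS z F) hC₁
  have hχ0 : ∀ j, ∀ᵐ z, 0 ≤ gaussianSymbol r (p j) z := fun j =>
    Eventually.of_forall fun z => (gaussianWeight_pos _).le
  have hχi : ∀ j, Integrable (gaussianSymbol r (p j)) := fun j => integrable_gaussianSymbol hr _
  have hAform := sum_re_inner_locOpL_le (η := fun j => gaussianSymbol r (p j))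
    (fun _ : Unit => φ l₀) (fun _ => ()) hχi hχ0 hχ (fun _ => hφ l₀)
  have hApos : ∀ j, (locOpL (gaussianSymbol r (p j)) (φ l₀)).IsPositive := fun j =>
    isPositive_locOpL _ (hχi j) (hχ0 j)
  set N := C₁ * C₂ * (Fintype.card Unit : ℝ) with hN
  have hNn : 0 ≤ N := by positivity
  have hA2 := tsum_norm_sq_le hNn hApos hAform
  have hA2s := summable_norm_sq hApos hAform
  -- N + 1 instead of N only keeps the denominator positive.
  refine ⟨(κ / 2) ^ 2 / (N + 1) ^ 2, by positivity, fun f => ?_⟩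
  set S := ∑' j, ‖locOpL (η j) (φ (k j)) f‖ ^ 2 with hSdef
  have hSs := summable_norm_sq hpos hform f
  have hS0 : 0 ≤ S := tsum_nonneg fun j => sq_nonneg _
  have hlow : κ * ‖f‖ ^ 2 ≤ ∑' j, RCLike.re (inner ℂ (locOpL (η j) (φ (k j)) f) f) := by
    have hs := summable_form hpos hform f
    simp only [re_inner_locOpL _ (hη _)] at hs ⊢
    exact exists_form_lower_bound k hη hη0 ha hab (hφ l₀) f hs
  -- The second f is replaced by its Gaussian localization, at total cost κ/2 ‖f‖²; Cauchy–Schwarz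
  -- over F handles the rest.
  have hpart : ∀ F : Finset ι, ∑ j ∈ F, RCLike.re (inner ℂ (locOpL (η j) (φ (k j)) f) f)
      ≤ κ / 2 * ‖f‖ ^ 2 + Real.sqrt S * ((N + 1) * ‖f‖) := by
    intro F
    have h1 := sum_norm_inner_sub_average_le (p := p) k hη hη0 hb hθ hC hC0 hφ l₀ hr f F
    have h2 : ∀ j, RCLike.re (inner ℂ (locOpL (η j) (φ (k j)) f) f)
        ≤ ‖inner ℂ (locOp (η j) (φ (k j)) f) f - inner ℂ (locOp (η j) (φ (k j)) f)
          (locOp (gaussianSymbol r (p j)) (φ l₀) f)‖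
          + ‖locOpL (η j) (φ (k j)) f‖ * ‖locOpL (gaussianSymbol r (p j)) (φ l₀) f‖ := by
      intro j
      rw [locOpL_apply _ (hη j), locOpL_apply _ (hχi j)]
      set x := inner ℂ (locOp (η j) (φ (k j)) f) f
      set y := inner ℂ (locOp (η j) (φ (k j)) f) (locOp (gaussianSymbol r (p j)) (φ l₀) f)
      have hy : ‖y‖ ≤ _ := norm_inner_le_norm (𝕜 := ℂ) _ _
      have hx : RCLike.re x ≤ ‖x‖ := RCLike.re_le_norm x
      have hxy : ‖x‖ ≤ ‖x - y‖ + ‖y‖ := by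
        have := norm_add_le (x - y) y
        rwa [sub_add_cancel] at this
      linarith
    have h3 := Finset.sum_le_sum (s := F) fun j _ => h2 j
    rw [Finset.sum_add_distrib] at h3
    have h4 := Real.sum_mul_le_sqrt_mul_sqrt F (fun j => ‖locOpL (η j) (φ (k j)) f‖)
      (fun j => ‖locOpL (gaussianSymbol r (p j)) (φ l₀) f‖)
    have h5 : Real.sqrt (∑ j ∈ F, ‖locOpL (η j) (φ (k j)) f‖ ^ 2) ≤ Real.sqrt S :=
      Real.sqrt_le_sqrt (hSs.sum_le_tsum F fun j _ => sq_nonneg _)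
    have h6 : Real.sqrt (∑ j ∈ F, ‖locOpL (gaussianSymbol r (p j)) (φ l₀) f‖ ^ 2)
        ≤ (N + 1) * ‖f‖ := by
      rw [← Real.sqrt_sq (by positivity : 0 ≤ (N + 1) * ‖f‖)]
      refine Real.sqrt_le_sqrt (((hA2s f).sum_le_tsum F fun j _ => sq_nonneg _).trans
        ((hA2 f).trans ?_))
      have hN1 : N ^ 2 ≤ (N + 1) ^ 2 := pow_le_pow_left₀ hNn (by linarith) 2
      calc N ^ 2 * ‖f‖ ^ 2 ≤ (N + 1) ^ 2 * ‖f‖ ^ 2 := mul_le_mul_of_nonneg_right hN1 (sq_nonneg _)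
        _ = ((N + 1) * ‖f‖) ^ 2 := (mul_pow _ _ _).symm
    have h7 : (∫ u, gaussianWeight u * twistError φ l₀ b C θ (r • u)) * ‖f‖ ^ 2
        ≤ κ / 2 * ‖f‖ ^ 2 := by gcongr
    have h8 := mul_le_mul h5 h6 (Real.sqrt_nonneg _) (Real.sqrt_nonneg _)
    linarith
  have hfin := hlow.trans ((summable_form hpos hform f).tsum_le_of_sum_le hpart)
  have h9 : κ / 2 * ‖f‖ ^ 2 ≤ Real.sqrt S * ((N + 1) * ‖f‖) := by linarith
  have h10 : κ / 2 * ‖f‖ ≤ Real.sqrt S * (N + 1) := by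
    rcases eq_or_lt_of_le (norm_nonneg f) with h | h
    · rw [← h, mul_zero]; positivity
    · refine le_of_mul_le_mul_right ?_ h
      nlinarith
  have h11 := pow_le_pow_left₀ (by positivity) h10 2
  rw [mul_pow, mul_pow, Real.sq_sqrt hS0] at h11
  rw [div_mul_eq_mul_div, div_le_iff₀ (by positivity)]
  exact h11

end LowerBoundConclusion

/-! ### Bargmann transform and rigidity of windows close to the Gaussian. -/

section Gaussian

open Filter Topology

theorem stft_congr {φ φ' f f' : ℝ → ℂ} (hφ : φ =ᵐ[volume] φ') (hf : f =ᵐ[volume] f') (z : ℝ × ℝ) :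
    stft φ f z = stft φ' f' z := by
  refine integral_congr_ae ?_
  filter_upwards [shiftFun_congr z hφ, hf] with t h1 h2
  rw [h1, h2]

theorem memLp_real_gaussian {b : ℝ} (hb : 0 < b) :
    MemLp (fun t : ℝ => Real.exp (-b * t ^ 2)) 2 := by
  rw [memLp_two_iff_integrable_sq (by fun_prop : Continuous fun t : ℝ =>
    Real.exp (-b * t ^ 2)).aestronglyMeasurable]
  refine (integrable_exp_neg_mul_sq (b := 2 * b) (by positivity)).congr
    (Eventually.of_forall fun t => ?_)
  simp only
  rw [← Real.exp_nat_mul]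
  congr 1
  push_cast
  ring

theorem memLp_gaussianWindow : MemLp gaussianWindow 2 := by
  have h := ((memLp_real_gaussian Real.pi_pos).const_mul ((2 : ℝ) ^ (1 / 4 : ℝ))).ofReal (K := ℂ)
  exact h

/-- The Gaussian window as an element of `L²(ℝ)`. -/
def gaussianL2 : L2R := memLp_gaussianWindow.toLp gaussianWindow

theorem coeFn_gaussianL2 : gaussianL2 =ᵐ[volume] gaussianWindow := memLp_gaussianWindow.coeFn_toLp

/-- The (unnormalized) Bargmann transform of a function on the line. -/
def bargmann (f : ℝ → ℂ) (ζ : ℂ) : ℂ :=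
  ∫ t : ℝ, f t * Complex.exp (-Real.pi * t ^ 2 + 2 * Real.pi * t * ζ)

/-- Up to a nonvanishing factor independent of f, the Gaussian STFT is a holomorphic function of x -
iω; this opens the way to Liouville's theorem. -/
theorem stft_gaussianWindow (f : ℝ → ℂ) (x ω : ℝ) :
    stft gaussianWindow f (x, ω)
      = (((2 : ℝ) ^ (1 / 4 : ℝ) * Real.exp (-Real.pi * x ^ 2) : ℝ) : ℂ)
        * bargmann f (x - ω * Complex.I) := by
  rw [stft, bargmann, ← integral_const_mul]
  congr 1
  funext t
  rw [shiftFun_eq, map_mul, conj_phase, phase, gaussianWindow, Complex.conj_ofReal]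
  have e : Complex.exp (((2 * Real.pi * -(ω * t) : ℝ) : ℂ) * Complex.I)
        * (Real.exp (-Real.pi * (t - x) ^ 2) : ℂ)
      = (Real.exp (-Real.pi * x ^ 2) : ℂ)
        * Complex.exp (-Real.pi * t ^ 2 + 2 * Real.pi * t * (x - ω * Complex.I)) := by
    push_cast
    rw [← Complex.exp_add, ← Complex.exp_add]
    congr 1
    ring
  rw [Complex.ofReal_mul ((2 : ℝ) ^ (1 / 4 : ℝ)) (Real.exp (-Real.pi * (t - x) ^ 2)),
    Complex.ofReal_mul ((2 : ℝ) ^ (1 / 4 : ℝ)) (Real.exp (-Real.pi * x ^ 2))]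
  linear_combination (f t * (((2 : ℝ) ^ (1 / 4 : ℝ) : ℝ) : ℂ)) * e

theorem exp_bound {S t : ℝ} :
    -Real.pi * t ^ 2 + S * |t| ≤ S ^ 2 / (2 * Real.pi) + -(Real.pi / 2) * t ^ 2 := by
  have h : 0 ≤ (S - Real.pi * |t|) ^ 2 / (2 * Real.pi) := by positivity
  have e : (S - Real.pi * |t|) ^ 2 / (2 * Real.pi)
      = S ^ 2 / (2 * Real.pi) - S * |t| + Real.pi / 2 * |t| ^ 2 := by
    field_simp
    ring
  rw [e, sq_abs] at h
  linarith

theorem norm_bargmann_kernel_le {R : ℝ} {ζ : ℂ} (hζ : ‖ζ‖ ≤ R) (t : ℝ) :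
    ‖Complex.exp (-Real.pi * t ^ 2 + 2 * Real.pi * t * ζ)‖
      ≤ Real.exp (-Real.pi * t ^ 2 + 2 * Real.pi * R * |t|) := by
  rw [Complex.norm_exp]
  refine Real.exp_le_exp.mpr ?_
  have h1 : (-(Real.pi : ℂ) * t ^ 2 + 2 * Real.pi * t * ζ).re
      = -Real.pi * t ^ 2 + 2 * Real.pi * (t * ζ.re) := by
    have : (-(Real.pi : ℂ) * t ^ 2 + 2 * Real.pi * t * ζ)
        = ((-Real.pi * t ^ 2 : ℝ) : ℂ) + ((2 * Real.pi * t : ℝ) : ℂ) * ζ := by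
      push_cast; ring
    rw [this, Complex.add_re, Complex.ofReal_re, Complex.re_ofReal_mul]
    ring
  rw [h1]
  have h2 : t * ζ.re ≤ |t| * R := by
    refine (le_abs_self _).trans ?_
    rw [abs_mul]
    exact mul_le_mul_of_nonneg_left ((Complex.abs_re_le_norm ζ).trans hζ) (abs_nonneg _)
  have := mul_le_mul_of_nonneg_left h2 Real.two_pi_pos.le
  linarith

theorem differentiable_bargmann (f : L2R) : Differentiable ℂ (bargmann f) := by
  intro ζ₀
  set R := ‖ζ₀‖ + 1 with hR
  have hR0 : 0 ≤ R := by positivity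
  -- The extra 1 absorbs 1 + |t| ≤ exp |t|; the factor |t| comes from the ζ-derivative.
  set S := 2 * Real.pi * R + 1 with hS
  have hdom : ∀ {ζ : ℂ}, ‖ζ‖ ≤ R → ∀ t : ℝ,
      (1 + |t|) * ‖Complex.exp (-Real.pi * t ^ 2 + 2 * Real.pi * t * ζ)‖
        ≤ Real.exp (S ^ 2 / (2 * Real.pi)) * Real.exp (-(Real.pi / 2) * t ^ 2) := by
    intro ζ hζ t
    calc _ ≤ Real.exp |t| * Real.exp (-Real.pi * t ^ 2 + 2 * Real.pi * R * |t|) := by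
          refine mul_le_mul ?_ (norm_bargmann_kernel_le hζ t) (norm_nonneg _) (Real.exp_nonneg _)
          linarith [Real.add_one_le_exp |t|]
      _ = Real.exp (-Real.pi * t ^ 2 + S * |t|) := by
          rw [← Real.exp_add, hS]
          congr 1
          ring
      _ ≤ _ := by
          rw [← Real.exp_add]
          exact Real.exp_le_exp.mpr exp_bound
  have hfi : Integrable fun t => ‖f t‖
      * (Real.exp (S ^ 2 / (2 * Real.pi)) * Real.exp (-(Real.pi / 2) * t ^ 2)) :=
    (Lp.memLp f).norm.integrable_mul
      ((memLp_real_gaussian (b := Real.pi / 2) (by positivity)).const_mul _)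
  have hmeas : ∀ ζ : ℂ, AEStronglyMeasurable
      (fun t : ℝ => f t * Complex.exp (-Real.pi * t ^ 2 + 2 * Real.pi * t * ζ)) volume := fun ζ =>
    (Lp.aestronglyMeasurable f).mul (by fun_prop : Continuous fun t : ℝ =>
      Complex.exp (-Real.pi * t ^ 2 + 2 * Real.pi * t * ζ)).aestronglyMeasurable
  refine (hasDerivAt_integral_of_dominated_loc_of_deriv_le (μ := volume)
    (F := fun (ζ : ℂ) (t : ℝ) => f t * Complex.exp (-Real.pi * t ^ 2 + 2 * Real.pi * t * ζ))
    (F' := fun (ζ : ℂ) (t : ℝ) => f t * (Complex.exp (-Real.pi * t ^ 2 + 2 * Real.pi * t * ζ)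
      * (2 * Real.pi * t)))
    (bound := fun t => 2 * Real.pi * (‖f t‖
      * (Real.exp (S ^ 2 / (2 * Real.pi)) * Real.exp (-(Real.pi / 2) * t ^ 2))))
    (Metric.ball_mem_nhds ζ₀ one_pos) (Eventually.of_forall hmeas) ?_ ?_ ?_
    (hfi.const_mul _) ?_).2.differentiableAt
  · refine hfi.mono' (hmeas ζ₀) (Eventually.of_forall fun t => ?_)
    rw [norm_mul]
    refine mul_le_mul_of_nonneg_left (le_trans ?_ (hdom (by linarith : ‖ζ₀‖ ≤ R) t)) (norm_nonneg _)
    exact le_mul_of_one_le_left (norm_nonneg _) (by linarith [abs_nonneg t])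
  · exact (Lp.aestronglyMeasurable f).mul (by fun_prop : Continuous fun t : ℝ =>
      Complex.exp (-Real.pi * t ^ 2 + 2 * Real.pi * t * ζ₀)
        * (2 * Real.pi * t)).aestronglyMeasurable
  · refine Eventually.of_forall fun t ζ hζ => ?_
    have hζR : ‖ζ‖ ≤ R := by
      rw [Metric.mem_ball, dist_eq_norm] at hζ
      have := norm_add_le (ζ - ζ₀) ζ₀
      rw [sub_add_cancel] at this
      linarith
    have h1 : ‖(2 * Real.pi * t : ℂ)‖ = 2 * Real.pi * |t| := by
      rw [norm_mul, norm_mul, Complex.norm_real, Complex.norm_real, Real.norm_eq_abs,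
        Real.norm_eq_abs, abs_of_pos Real.pi_pos]
      norm_num
    rw [norm_mul, norm_mul, h1]
    have h2 := hdom hζR t
    have h3 : |t| * ‖Complex.exp (-Real.pi * t ^ 2 + 2 * Real.pi * t * ζ)‖
        ≤ (1 + |t|) * ‖Complex.exp (-Real.pi * t ^ 2 + 2 * Real.pi * t * ζ)‖ := by
      gcongr
      linarith
    calc _ = 2 * Real.pi * (‖f t‖
          * (|t| * ‖Complex.exp (-Real.pi * t ^ 2 + 2 * Real.pi * t * ζ)‖)) := by ring
      _ ≤ _ := by
          exact mul_le_mul_of_nonneg_left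
            (mul_le_mul_of_nonneg_left (h3.trans h2) (norm_nonneg _)) Real.two_pi_pos.le
  · refine Eventually.of_forall fun t ζ _ => ?_
    have h1 : HasDerivAt
        (fun ζ : ℂ => -(Real.pi : ℂ) * (t : ℂ) ^ 2 + 2 * (Real.pi : ℂ) * (t : ℂ) * ζ)
        (2 * (Real.pi : ℂ) * (t : ℂ)) ζ := by
      simpa using ((hasDerivAt_id ζ).const_mul (2 * Real.pi * (t : ℂ))).const_add
        (-Real.pi * (t : ℂ) ^ 2)
    exact (h1.cexp).const_mul (f t)

theorem bargmann_gaussianWindow (ζ : ℂ) :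
    (((2 : ℝ) ^ (1 / 4 : ℝ) : ℝ) : ℂ) * bargmann gaussianWindow ζ
      = Complex.exp (Real.pi / 2 * ζ ^ 2) := by
  have h : ∀ t : ℝ, gaussianWindow t * Complex.exp (-Real.pi * t ^ 2 + 2 * Real.pi * t * ζ)
      = (((2 : ℝ) ^ (1 / 4 : ℝ) : ℝ) : ℂ)
        * Complex.exp (-(2 * Real.pi) * t ^ 2 + 2 * Real.pi * ζ * t + 0) := by
    intro t
    rw [gaussianWindow, Complex.ofReal_mul, mul_assoc, Complex.ofReal_exp, ← Complex.exp_add]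
    congr 2
    push_cast
    ring
  have hpi : (Real.pi : ℂ) ≠ 0 := Complex.ofReal_ne_zero.mpr Real.pi_ne_zero
  have hb : (-(2 * Real.pi) : ℂ).re < 0 := by
    have : (-(2 * Real.pi) : ℂ) = ((-(2 * Real.pi) : ℝ) : ℂ) := by push_cast; rfl
    rw [this, Complex.ofReal_re]
    linarith [Real.two_pi_pos]
  have e1 : (Real.pi / - -(2 * Real.pi) : ℂ) = ((1 / 2 : ℝ) : ℂ) := by
    push_cast
    field_simp
  have e2 : (((1 / 2 : ℝ) : ℂ)) ^ (1 / 2 : ℂ) = (((1 / 2 : ℝ) ^ (1 / 2 : ℝ) : ℝ) : ℂ) := by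
    rw [Complex.ofReal_cpow (by norm_num)]
    push_cast
    rfl
  have e3 : (2 : ℝ) ^ (1 / 4 : ℝ) * ((2 : ℝ) ^ (1 / 4 : ℝ) * (1 / 2 : ℝ) ^ (1 / 2 : ℝ)) = 1 := by
    rw [← mul_assoc, ← Real.rpow_add (by norm_num), one_div 2, Real.inv_rpow (by norm_num)]
    norm_num
  rw [bargmann]
  simp_rw [h]
  rw [integral_const_mul, integral_cexp_quadratic hb, e1, e2]
  have e4 : (0 - (2 * Real.pi * ζ) ^ 2 / (4 * -(2 * Real.pi)) : ℂ) = Real.pi / 2 * ζ ^ 2 := by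
    field_simp
    ring
  rw [e4, ← mul_assoc, ← mul_assoc, ← Complex.ofReal_mul, ← Complex.ofReal_mul, mul_assoc, e3,
    Complex.ofReal_one, one_mul]

theorem stft_gaussianWindow_self (x ω : ℝ) :
    stft gaussianWindow gaussianWindow (x, ω) = (Real.exp (-Real.pi * x ^ 2) : ℂ)
      * Complex.exp (Real.pi / 2 * (x - ω * Complex.I) ^ 2) := by
  rw [stft_gaussianWindow, ← bargmann_gaussianWindow, Complex.ofReal_mul]
  ring

theorem norm_stft_gaussianWindow_self (z : ℝ × ℝ) :
    ‖stft gaussianWindow gaussianWindow z‖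
      = Real.exp (-(Real.pi / 2) * z.1 ^ 2) * Real.exp (-(Real.pi / 2) * z.2 ^ 2) := by
  obtain ⟨x, ω⟩ := z
  rw [stft_gaussianWindow_self, norm_mul, Complex.norm_real, Real.norm_eq_abs, Real.abs_exp,
    Complex.norm_exp, ← Real.exp_add, ← Real.exp_add]
  congr 1
  have h : (Real.pi / 2 * (x - ω * Complex.I) ^ 2 : ℂ)
      = ((Real.pi / 2 * (x ^ 2 - ω ^ 2) : ℝ) : ℂ) + ((-(Real.pi * x * ω) : ℝ) : ℂ) * Complex.I := by
    push_cast
    linear_combination (Real.pi / 2 * (ω : ℂ) ^ 2) * Complex.I_sq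
  rw [h, Complex.add_re, Complex.ofReal_re, Complex.re_ofReal_mul, Complex.I_re]
  ring

theorem integral_norm_stft_gaussianWindow_self :
    ∫ z, ‖stft gaussianWindow gaussianWindow z‖ = 2 := by
  simp_rw [norm_stft_gaussianWindow_self]
  rw [Measure.volume_eq_prod, integral_prod_mul (fun t : ℝ => Real.exp (-(Real.pi / 2) * t ^ 2))
    (fun t : ℝ => Real.exp (-(Real.pi / 2) * t ^ 2)), integral_gaussian,
    Real.mul_self_sqrt (by positivity)]
  field_simp

theorem norm_gaussianL2 : ‖gaussianL2‖ = 1 := by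
  have h := stft_eq_inner gaussianL2 gaussianL2 0
  rw [tfShift_zero, inner_self_eq_norm_sq_to_K, stft_congr coeFn_gaussianL2 coeFn_gaussianL2] at h
  have h2 := stft_gaussianWindow_self 0 0
  have h3 : ((‖gaussianL2‖ ^ 2 : ℝ) : ℂ) = 1 := by
    rw [show ((0, 0) : ℝ × ℝ) = 0 from rfl, h] at h2
    simpa using h2
  have h4 : ‖gaussianL2‖ ^ 2 = 1 := by exact_mod_cast h3
  exact (pow_eq_one_iff_of_nonneg (norm_nonneg _) two_ne_zero).mp h4

/-- A window whose Gaussian short-time Fourier transform is pointwise close to that of the Gaussian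
is a multiple of the Gaussian. -/
theorem exists_eq_smul_gaussianL2 {φ : L2R} {C₀ : ℝ}
    (h : ∀ z, ‖stft gaussianWindow gaussianWindow z - stft gaussianWindow φ z‖
      < C₀ * ‖stft gaussianWindow gaussianWindow z‖) :
    ∃ c : ℂ, ‖c - 1‖ ≤ C₀ ∧ φ = c • gaussianL2 := by
  set s : ℝ := (2 : ℝ) ^ (1 / 4 : ℝ) with hs
  have hs0 : 0 < s := by positivity
  -- This is the quotient of the Bargmann transforms of φ and of the Gaussian, whose transform has
  -- no zeros; the pointwise hypothesis keeps it within C₀ of 1.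
  have hclose : ∀ ζ : ℂ, ‖s * bargmann φ ζ * Complex.exp (-(Real.pi / 2 * ζ ^ 2)) - 1‖ ≤ C₀ := by
    intro ζ
    have h1 := (h (ζ.re, -ζ.im)).le
    have hz : ((ζ.re : ℝ) : ℂ) - ((-ζ.im : ℝ) : ℂ) * Complex.I = ζ := by
      push_cast
      rw [neg_mul, sub_neg_eq_add, Complex.re_add_im]
    rw [stft_gaussianWindow, stft_gaussianWindow, hz, ← mul_sub, norm_mul, norm_mul] at h1
    have hw : 0 < ‖(((2 : ℝ) ^ (1 / 4 : ℝ) * Real.exp (-Real.pi * ζ.re ^ 2) : ℝ) : ℂ)‖ := by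
      rw [norm_pos_iff, Complex.ofReal_ne_zero]
      positivity
    have h2 : ‖bargmann gaussianWindow ζ - bargmann φ ζ‖ ≤ C₀ * ‖bargmann gaussianWindow ζ‖ := by
      refine le_of_mul_le_mul_left ?_ hw
      linarith
    have hg := bargmann_gaussianWindow ζ
    have hE : Complex.exp (Real.pi / 2 * ζ ^ 2) * Complex.exp (-(Real.pi / 2 * ζ ^ 2)) = 1 := by
      rw [← Complex.exp_add, add_neg_cancel, Complex.exp_zero]
    have e1 : s * bargmann φ ζ * Complex.exp (-(Real.pi / 2 * ζ ^ 2)) - 1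
        = -(s * Complex.exp (-(Real.pi / 2 * ζ ^ 2))
          * (bargmann gaussianWindow ζ - bargmann φ ζ)) := by
      rw [← hE, ← hg]; ring
    have e2 : ‖(s : ℂ) * Complex.exp (-(Real.pi / 2 * ζ ^ 2))‖ * ‖bargmann gaussianWindow ζ‖ = 1 := by
      rw [← norm_mul, show (s : ℂ) * Complex.exp (-(Real.pi / 2 * ζ ^ 2)) * bargmann gaussianWindow ζ
        = s * bargmann gaussianWindow ζ * Complex.exp (-(Real.pi / 2 * ζ ^ 2)) by ring, hg, hE,
        norm_one]
    rw [e1, norm_neg, norm_mul]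
    calc _ ≤ ‖(s : ℂ) * Complex.exp (-(Real.pi / 2 * ζ ^ 2))‖
          * (C₀ * ‖bargmann gaussianWindow ζ‖) := by gcongr
      _ = C₀ * (‖(s : ℂ) * Complex.exp (-(Real.pi / 2 * ζ ^ 2))‖ * ‖bargmann gaussianWindow ζ‖) := by
          ring
      _ = C₀ := by rw [e2, mul_one]
  have hdiff : Differentiable ℂ fun ζ : ℂ =>
      s * bargmann φ ζ * Complex.exp (-(Real.pi / 2 * ζ ^ 2)) := by
    have := differentiable_bargmann φ
    fun_prop
  have hbdd : Bornology.IsBounded (Set.range fun ζ : ℂ =>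
      s * bargmann φ ζ * Complex.exp (-(Real.pi / 2 * ζ ^ 2))) := by
    refine (Metric.isBounded_closedBall (x := (1 : ℂ)) (r := C₀)).subset ?_
    rintro _ ⟨ζ, rfl⟩
    rw [Metric.mem_closedBall, dist_eq_norm]
    exact hclose ζ
  obtain ⟨c, hc⟩ := hdiff.exists_const_forall_eq_of_bounded hbdd
  refine ⟨c, by simpa only [hc 0] using hclose 0, ?_⟩
  have hb : ∀ ζ, bargmann φ ζ = c * bargmann gaussianWindow ζ := by
    intro ζ
    have hsne : (s : ℂ) ≠ 0 := Complex.ofReal_ne_zero.mpr hs0.ne'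
    refine mul_left_cancel₀ hsne ?_
    have hg := bargmann_gaussianWindow ζ
    have hE : Complex.exp (-(Real.pi / 2 * ζ ^ 2)) * Complex.exp (Real.pi / 2 * ζ ^ 2) = 1 := by
      rw [← Complex.exp_add, neg_add_cancel, Complex.exp_zero]
    rw [mul_left_comm, hg, ← hc ζ, mul_assoc, hE, mul_one]
  -- Proportional Bargmann transforms make this STFT vanish, and Moyal's formula shows that the STFT
  -- determines the function.
  have hst : ∀ z, stft gaussianL2 (φ - c • gaussianL2 : L2R) z = 0 := by
    rintro ⟨x, ω⟩
    rw [stft_sub_right, stft_smul_right, stft_congr coeFn_gaussianL2 (ae_eq_refl φ),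
      stft_congr coeFn_gaussianL2 coeFn_gaussianL2, stft_gaussianWindow, stft_gaussianWindow, hb]
    ring
  have h0 := integral_norm_stft_sq gaussianL2 (φ - c • gaussianL2)
  simp only [hst, norm_zero, norm_gaussianL2] at h0
  simp only [ne_eq, OfNat.ofNat_ne_zero, not_false_eq_true, zero_pow, integral_zero, one_pow,
    one_mul] at h0
  exact sub_eq_zero.mp (norm_eq_zero.mp (pow_eq_zero_iff two_ne_zero |>.mp h0.symm))

end Gaussian

/-! ### Assembly for families of compact positive operators. -/

section EigenFrames

/-- Square-sum bounds for a family of operators and for their squares, diagonalizability, and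
the frame property of the eigenvectors with large eigenvalues. -/
def HasEigenFrames {ι : Type*} (H : ι → L2R → L2R) : Prop :=
  (∃ A B : ℝ, 0 < A ∧ A ≤ B ∧
    SqSumBounds (fun j f => H j (H j f)) A B ∧ SqSumBounds (fun j f => H j f) A B) ∧
  ((∀ j f, ‖H j f‖ ≤ ‖f‖) → ∀ f, ∑' j, ‖H j (H j f)‖ ^ 2 ≤ ∑' j, ‖H j f‖ ^ 2) ∧
  (∀ j, ∃ (lam : ℕ → ℝ) (e : ℕ → L2R), IsEigenSystem (H j) lam e) ∧
  (∀ A B : ℝ, 0 < A → A ≤ B →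
    (∀ f, A * ‖f‖ ^ 2 ≤ ∑' j, ‖H j (H j f)‖ ^ 2) →
    (∀ f, ∑' j, ‖H j f‖ ^ 2 ≤ B * ‖f‖ ^ 2) →
    ∀ ε : ℝ, 0 < ε → ε < A / B →
    ∀ (lam : ι → ℕ → ℝ) (e : ι → ℕ → L2R),
      (∀ j, IsEigenSystem (H j) (lam j) (e j)) →
      IsFrame (fun q : {q : ι × ℕ // ε < lam q.1 q.2} => e q.1.1 q.1.2) ∧
      ∃ A' B' : ℝ, 0 < A' ∧ A' ≤ B' ∧
        SqSumBounds (fun j f => truncOp (lam j) (e j) ε f) A' B')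

theorem hasEigenFrames_of_isPositive {ι : Type*} {T : ι → L2R →L[ℂ] L2R} {a b : ℝ}
    (hpos : ∀ j, (T j).IsPositive) (hc : ∀ j, IsCompactOperator (T j)) (hb0 : 0 < b)
    (hb : ∀ (f : L2R) (F : Finset ι), ∑ j ∈ F, RCLike.re (inner ℂ (T j f) f) ≤ b * ‖f‖ ^ 2)
    (ha : 0 < a) (hlow : ∀ f, a * ‖f‖ ^ 2 ≤ ∑' j, ‖T j f‖ ^ 2) :
    HasEigenFrames (fun j f => T j f) := by
  refine ⟨exists_sqSumBounds hb0 hpos hb ha hlow, fun hcon f => ?_, fun j => ?_,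
    fun A B hA hAB h1 h2 ε hε hεAB lam e heig =>
      frames_of_eigenSystems hb0 hpos hb hA hAB h1 h2 hε hεAB heig⟩
  · exact (summable_norm_sq_sq hb0.le hpos hb f).tsum_le_tsum
      (fun j => pow_le_pow_left₀ (norm_nonneg _) (hcon j (T j f)) 2)
      (summable_norm_sq hpos hb f)
  · obtain ⟨lam, e, h1, h2, h3, h4⟩ :=
      exists_spectral_decomposition not_finiteDimensional_L2R (hpos j) (hc j)
    exact ⟨lam, e, h1, h2, h3, h4⟩

variable {ι K : Type*} [Fintype K] {p : ι → ℝ × ℝ} {η : ι → ℝ × ℝ → ℝ} {φ : K → L2R}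

theorem hasEigenFrames_locOp (k : ι → K) (hspread : WellSpread p η)
    (hη0 : ∀ j, ∀ᵐ z, 0 ≤ η j z) (hsum : SumEquivOne η) (hφ : ∀ l, ‖φ l‖ = 1) {l₀ : K}
    (hclose : ∑ l, ‖φ l - φ l₀‖ ^ 2 < 1 / 2) :
    HasEigenFrames (fun j f => locOp (η j) (φ (k j)) f) := by
  obtain ⟨a, b, ha, hab, h⟩ := hsum
  have hη := hspread.integrable
  have := hspread.separated.countable
  have : Nonempty K := ⟨l₀⟩
  obtain ⟨A, hA, hlow⟩ := exists_norm_sq_lower_bound k hspread hη0 ha h hφ hclose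
  have hT : (fun j f => locOp (η j) (φ (k j)) f) = fun j f => locOpL (η j) (φ (k j)) f := by
    funext j f
    exact (locOpL_apply _ (hη j) f).symm
  rw [hT]
  exact hasEigenFrames_of_isPositive (fun j => isPositive_locOpL _ (hη j) (hη0 j))
    (fun j => isCompactOperator_locOpL _ (hη j))
    (mul_pos (ha.trans_le hab) (Nat.cast_pos.mpr Fintype.card_pos))
    (sum_re_inner_locOpL_le φ k hη hη0 (sum_le_of_sumEquiv hη0 h) hφ) hA hlow

end EigenFrames

/-! ### Moving scalar factors from windows to symbols. -/

section Scaling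

variable {ι : Type*} {p : ι → ℝ × ℝ} {η : ι → ℝ × ℝ → ℝ} {w : ι → ℝ} {M : ℝ}

/-- The window enters once linearly and once conjugate-linearly. -/
theorem locOp_smul (m : ℝ × ℝ → ℝ) (φ f : L2R) (c : ℂ) :
    locOp m (c • φ) f = locOp (fun z => ‖c‖ ^ 2 * m z) φ f := by
  refine integral_congr_ae (Filter.Eventually.of_forall fun z => ?_)
  simp only [stft_eq_inner, tfShift_smul, inner_smul_left, smul_smul]
  congr 1
  push_cast
  rw [← Complex.conj_mul']
  ring

theorem PolynomialDecay.const_mul {g : ℝ × ℝ → ℝ} (hg : PolynomialDecay g) (M : ℝ) :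
    PolynomialDecay fun z => M * g z := by
  obtain ⟨C, s, hs, h⟩ := hg
  refine ⟨|M| * C, s, hs, fun z => ?_⟩
  rw [abs_mul, mul_assoc]
  exact mul_le_mul_of_nonneg_left (h z) (abs_nonneg M)

theorem WellSpread.const_mul (h : WellSpread p η) (hw : ∀ j, |w j| ≤ M) :
    WellSpread p fun j z => w j * η j z := by
  obtain ⟨g, hg1, hg2, hg3, hg4⟩ := h.envelope
  refine ⟨h.separated, fun j => (h.integrable j).const_mul _, fun z => M * g z,
    hg1.const_mul M, hg2.const_mul M, hg3.const_mul M, fun j => ?_⟩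
  filter_upwards [hg4 j] with z hz
  rw [abs_mul]
  exact mul_le_mul (hw j) hz (abs_nonneg _) ((abs_nonneg _).trans (hw j))

theorem SumEquivOne.const_mul [Countable ι] (h : SumEquivOne η) (hη0 : ∀ j, ∀ᵐ z, 0 ≤ η j z)
    {m : ℝ} (hm : 0 < m) (hmM : m ≤ M) (hw1 : ∀ j, m ≤ w j) (hw2 : ∀ j, w j ≤ M) :
    SumEquivOne fun j z => w j * η j z := by
  obtain ⟨a, b, ha, hab, h⟩ := h
  refine ⟨m * a, M * b, mul_pos hm ha, mul_le_mul hmM hab ha.le (hm.le.trans hmM), ?_⟩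
  filter_upwards [h, ae_all_iff.mpr hη0] with z ⟨h1, h2, h3⟩ h0
  have hs : Summable fun j => w j * η j z :=
    Summable.of_nonneg_of_le (fun j => mul_nonneg (hm.le.trans (hw1 j)) (h0 j))
      (fun j => mul_le_mul_of_nonneg_right (hw2 j) (h0 j)) (h1.mul_left M)
  refine ⟨hs, ?_, ?_⟩
  · refine (mul_le_mul_of_nonneg_left h2 hm.le).trans ?_
    rw [← tsum_mul_left]
    exact (h1.mul_left m).tsum_le_tsum
      (fun j => mul_le_mul_of_nonneg_right (hw1 j) (h0 j)) hs
  · refine le_trans ?_ (mul_le_mul_of_nonneg_left h3 (hm.le.trans hmM))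
    rw [← tsum_mul_left]
    exact hs.tsum_le_tsum
      (fun j => mul_le_mul_of_nonneg_right (hw2 j) (h0 j)) (h1.mul_left M)

end Scaling

/-! ### The two window conditions. -/

section Windows

variable {ι I : Type*} {p : ι → ℝ × ℝ} {η : ι → ℝ × ℝ → ℝ} {Φ : I → L2R}

theorem NormCondition.hasEigenFrames (hwin : NormCondition Φ) (i : ι → I)
    (hspread : WellSpread p η) (hη0 : ∀ j, ∀ᵐ z, 0 ≤ η j z) (hsum : SumEquivOne η) :
    HasEigenFrames (fun j f => locOp (η j) (Φ (i j)) f) := by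
  obtain ⟨φ₁, φ₂, h1, h2, h12, hΦ⟩ := hwin
  let φ : Bool → L2R := fun l => cond l φ₁ φ₂
  have hk : ∀ j, ∃ l, Φ (i j) = φ l := fun j =>
    (hΦ (i j)).elim (fun h => ⟨true, h⟩) fun h => ⟨false, h⟩
  choose k hk using hk
  simp only [hk]
  refine hasEigenFrames_locOp (l₀ := true) k hspread hη0 hsum (fun l => ?_) ?_
  · cases l <;> assumption
  -- Only one difference is nonzero, and its square is below 1/4.
  · rw [Fintype.sum_bool]
    simp only [φ, cond_true, cond_false, sub_self, norm_zero]
    rw [norm_sub_rev]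
    nlinarith [norm_nonneg (φ₁ - φ₂)]

theorem PhaseSpaceCondition.hasEigenFrames (hwin : PhaseSpaceCondition Φ) (i : ι → I)
    (hspread : WellSpread p η) (hη0 : ∀ j, ∀ᵐ z, 0 ≤ η j z) (hsum : SumEquivOne η) :
    HasEigenFrames (fun j f => locOp (η j) (Φ (i j)) f) := by
  obtain ⟨-, C₀, hclose, hC₀⟩ := hwin
  rw [integral_norm_stft_gaussianWindow_self] at hC₀
  have := hspread.separated.countable
  choose c hc hΦ using fun l => exists_eq_smul_gaussianL2 (hclose l)
  have hlow : ∀ l, (1 - C₀) ^ 2 ≤ ‖c l‖ ^ 2 := fun l => by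
    have h := norm_sub_norm_le (1 : ℂ) (c l)
    rw [norm_one, norm_sub_rev] at h
    exact pow_le_pow_left₀ (by linarith) (by linarith [hc l]) 2
  -- The Gaussian STFT has L¹ norm 2, so C₀ < 1 and |c| ≤ 1 + C₀ < 2.
  have hup : ∀ l, ‖c l‖ ^ 2 ≤ 4 := fun l => by
    have h := norm_sub_norm_le (c l) 1
    rw [norm_one] at h
    nlinarith [hc l, norm_nonneg (c l)]
  have hm : 0 < (1 - C₀) ^ 2 := pow_pos (by linarith) 2
  -- An index is needed to compare the two bounds on |c|²; an empty family would contradict a ≤ Σ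
  -- η_j.
  rcases isEmpty_or_nonempty ι with hι | ⟨⟨j₀⟩⟩
  · obtain ⟨a, b, ha, -, h⟩ := hsum
    obtain ⟨z, -, hz, -⟩ := h.exists
    rw [tsum_empty] at hz
    exact absurd hz ha.not_ge
  simp only [hΦ, locOp_smul]
  refine hasEigenFrames_locOp (φ := fun _ : Unit => gaussianL2) (l₀ := ()) (fun _ => ())
    (hspread.const_mul (M := 4) fun j => ?_) (fun j => ?_)
    (hsum.const_mul hη0 hm ((hlow (i j₀)).trans (hup _)) (fun j => hlow (i j)) fun j => hup (i j))
    (fun _ => norm_gaussianL2) ?_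
  · rw [abs_of_nonneg (sq_nonneg _)]
    exact hup _
  · filter_upwards [hη0 j] with z hz
    exact mul_nonneg (sq_nonneg _) hz
  · simp only [sub_self, norm_zero, Finset.univ_unique, Finset.sum_const, Finset.card_singleton]
    norm_num

end Windows

end TimeFrequency

end

theorem mainTheorem4 {ι I : Type*} (p : ι → ℝ × ℝ) (η : ι → ℝ × ℝ → ℝ)
    (Φ : I → L2R) (i : ι → I)
    (hspread : WellSpread p η)
    (hnonneg : ∀ j, ∀ᵐ z, 0 ≤ η j z)
    (hsum : SumEquivOne η)
    (hwin : NormCondition Φ ∨ PhaseSpaceCondition Φ) :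
    -- norm equivalence for the operators and for their squares
    (∃ A B : ℝ, 0 < A ∧ A ≤ B ∧
      SqSumBounds (fun j f => locOp (η j) (Φ (i j)) (locOp (η j) (Φ (i j)) f)) A B ∧
      SqSumBounds (fun j f => locOp (η j) (Φ (i j)) f) A B) ∧
    -- comparison of the two sums for contractive operators
    ((∀ j f, ‖locOp (η j) (Φ (i j)) f‖ ≤ ‖f‖) →
      ∀ f, ∑' j, ‖locOp (η j) (Φ (i j)) (locOp (η j) (Φ (i j)) f)‖ ^ 2
        ≤ ∑' j, ‖locOp (η j) (Φ (i j)) f‖ ^ 2) ∧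
    -- the operators can be diagonalized
    (∀ j, ∃ (lam : ℕ → ℝ) (e : ℕ → L2R), IsEigenSystem (locOp (η j) (Φ (i j))) lam e) ∧
    -- frames of eigenfunctions
    (∀ A B : ℝ, 0 < A → A ≤ B →
      (∀ f, A * ‖f‖ ^ 2
        ≤ ∑' j, ‖locOp (η j) (Φ (i j)) (locOp (η j) (Φ (i j)) f)‖ ^ 2) →
      (∀ f, ∑' j, ‖locOp (η j) (Φ (i j)) f‖ ^ 2 ≤ B * ‖f‖ ^ 2) →
      ∀ ε : ℝ, 0 < ε → ε < A / B →
      ∀ (lam : ι → ℕ → ℝ) (e : ι → ℕ → L2R),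
        (∀ j, IsEigenSystem (locOp (η j) (Φ (i j))) (lam j) (e j)) →
        IsFrame (fun q : {q : ι × ℕ // ε < lam q.1 q.2} => e q.1.1 q.1.2) ∧
        ∃ A' B' : ℝ, 0 < A' ∧ A' ≤ B' ∧
          SqSumBounds (fun j f => truncOp (lam j) (e j) ε f) A' B') :=
  hwin.elim (fun h => h.hasEigenFrames i hspread hnonneg hsum)
    fun h => h.hasEigenFrames i hspread hnonneg hsum
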